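/- Let $n\ge 0$, let $N=\binom n2$, and let $(W_n)_k$ be the set of permutations in $S_n$ of length $k$ (the least number of factors in an expression as a product of simple transpositions $s_i=(i\ i{+}1)$), with $(W_n)_{-1}=\emptyset$. Put $\rho=(n-1,n-2,\dots,1)$. The Schubert polynomials are defined by $\mathfrak S_{w_0}=x^\rho=x_1^{n-1}x_2^{n-2}\cdots x_{n-1}$, where $w_0=n,n-1,\dots,1$, and $\mathfrak S_{s_iw}=\dfrac{\mathfrak S_w-s_i\cdot\mathfrak S_w}{x_i-x_{i+1}}$ whenever $\ell(s_iw)<\ell(w)$, where $s_i$ acts by exchanging $x_i$ and $x_{i+1}$. The padded Schubert polynomials $\widetilde{\mathfrak S}_w$ are their images under the linear map $x^\alpha\mapsto x^\alpha y^{\rho-\alpha}$ ($\alpha\le\rho$ componentwise); they form a basis of $\widetilde V=\operatorname{span}_{\mathbb C}\{x^\alpha y^{\rho-\alpha}:\alpha\le\rho\}$. On $\widetilde V$ consider $$\nabla=\sum_{i=1}^{n-1}y_i\frac{\partial}{\partial x_i},\qquad \Delta=\sum_{i=1}^{n-1}x_i\frac{\partial}{\partial y_i}.$$ Identify $\widetilde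 V$ with the space $\mathbb C S_n$ of formal linear combinations of permutations by $\widetilde{\mathfrak S}_w\leftrightarrow w$, so that the padded Schubert basis becomes the permutation basis; then $\Delta$ raises and $\nabla$ lowers the length by one. For $0\le i<j\le N$ let $\Delta^{[i,j]}:\mathbb C(W_n)_i\to\mathbb C(W_n)_j$ and $\nabla^{[i,j]}:\mathbb C(W_n)_j\to\mathbb C(W_n)_i$ be the restrictions of $\Delta^{j-i}$ and $\nabla^{j-i}$. For an integer matrix $A$, $\operatorname{snf}(A)=PAQ$ (with $P,Q$ invertible over $\mathbb Z$) is its Smith normal form, with nonnegative diagonal entries $b_1\mid b_2\mid\cdots$ and zeros off the diagonal, and $\widetilde{\operatorname{snf}}(A)$ is the square matrix obtained from it by deleting the extra zero rows or columns. **Theorem.** Let $0\le\ell<\ell'\le N$ with $\ell+\ell'\le N$. In the padded Schubert (permutation) basis, the operators $\Delta^{[\ell,\ell']}$, $\Delta^{[N-\ell',N-\ell]}$, $\nabla^{[\ell,\ell']}$ and $\nabla^{[N-\ell',N-\ell]}$ are given by integer matrices, and $$\widetilde{\operatorname{snf}}\,\Delta^{[\ell,\ell']}=\widetilde{\operatorname{snf}}\,\Delta^{[N-\ell',N-\ell]}=\widetilde{\operatorname{snf}}\,\nabla^{[\ell,\ell']}=\widetilde{\operatorname{snf}}\,\nabla^{[N-\ell',N-\ell]}=(\ell'-\ell)!\,\operatorname{snf}(\mathcal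 D),$$ where $\mathcal D$ is the diagonal matrix with $\#(W_n)_i-\#(W_n)_{i-1}$ diagonal entries equal to $\binom{\ell'-i}{\ell-i}$ for each $i=0,1,\dots,\ell$. -/

import Mathlib

open Equiv MvPolynomial

namespace PaddedSchubert

/-! ### The symmetric group: simple transpositions, length, ranks

Permutations of `{1, …, n}` are modelled as permutations of `Fin n = {0, …, n-1}`, and products are
compositions of functions. -/

/-- The simple transposition exchanging `i` and `i + 1` (both 0-based). -/
def simpleRefl (n i : ℕ) (h : i + 1 < n) : Perm (Fin n) :=
  swap ⟨i, Nat.lt_of_succ_lt h⟩ ⟨i + 1, h⟩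

/-- `w` is a product of a word of `k` simple transpositions. -/
def IsWordProd {n : ℕ} (w : Perm (Fin n)) (k : ℕ) : Prop :=
  ∃ L : List (Perm (Fin n)),
    L.length = k ∧ (∀ s ∈ L, ∃ i, ∃ h : i + 1 < n, s = simpleRefl n i h) ∧ L.prod = w

/-- The length of `w`: the smallest `k` such that `w` is a product of `k` simple transpositions. -/
noncomputable def permLength {n : ℕ} (w : Perm (Fin n)) : ℕ := sInf {k | IsWordProd w k}

/-- The permutations of length `k`, i.e. the rank `k` elements of the weak (and of the strong)
Bruhat order. -/
abbrev Level (n k : ℕ) : Type := {w : Perm (Fin n) // permLength w = k}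

/-- `#(W_n)_k - #(W_n)_{k-1}`, where `(W_n)_{-1}` is empty. It is used only in the lower half
of the ranks, where the difference is not negative. -/
noncomputable def rankJump (n : ℕ) : ℕ → ℕ
  | 0 => Fintype.card (Level n 0)
  | k + 1 => Fintype.card (Level n (k + 1)) - Fintype.card (Level n k)

/-! ### Divided differences -/

theorem sub_dvd_sub_rename_swap {σ : Type*} [DecidableEq σ] (a b : σ) (g : MvPolynomial σ ℂ) :
    (X a - X b : MvPolynomial σ ℂ) ∣ g - rename (swap a b) g := by
  induction g using MvPolynomial.induction_on with
  | C r => simp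
  | add p q hp hq =>
    rw [map_add, add_sub_add_comm]
    exact dvd_add hp hq
  | mul_X p k hp =>
    rw [map_mul, rename_X]
    have hk : (X a - X b : MvPolynomial σ ℂ) ∣ X k - X (swap a b k) := by
      by_cases h1 : k = a
      · subst h1; simp
      · by_cases h2 : k = b
        · subst h2
          rw [swap_apply_right]
          exact ⟨-1, by ring⟩
        · rw [swap_apply_of_ne_of_ne h1 h2]; simp
    have e : p * X k - rename (swap a b) p * X (swap a b k)
        = (p - rename (swap a b) p) * X k + rename (swap a b) p * (X k - X (swap a b k)) := by
      ring
    rw [e]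
    exact dvd_add (hp.mul_right _) (hk.mul_left _)

/-- The Newton divided difference `(g - s_i g) / (x_i - x_{i+1})`, the quotient being exact. -/
noncomputable def dividedDiff (n i : ℕ) (h : i + 1 < n) (g : MvPolynomial (Fin n) ℂ) :
    MvPolynomial (Fin n) ℂ :=
  Classical.choose
    (sub_dvd_sub_rename_swap (⟨i, Nat.lt_of_succ_lt h⟩ : Fin n) ⟨i + 1, h⟩ g)

theorem mul_dividedDiff (n i : ℕ) (h : i + 1 < n) (g : MvPolynomial (Fin n) ℂ) :
    (X ⟨i, Nat.lt_of_succ_lt h⟩ - X ⟨i + 1, h⟩) * dividedDiff n i h g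
      = g - rename (simpleRefl n i h) g :=
  (Classical.choose_spec
    (sub_dvd_sub_rename_swap (⟨i, Nat.lt_of_succ_lt h⟩ : Fin n) ⟨i + 1, h⟩ g)).symm

/-! ### Schubert polynomials -/

/-- The staircase composition `ρ = (n-1, n-2, …, 2, 1)`, with a last entry `0` added. -/
noncomputable def rho (n : ℕ) : Fin n →₀ ℕ :=
  Finsupp.equivFunOnFinite.symm fun i => n - 1 - (i : ℕ)

/-- The recursive description of the Schubert polynomials:
`𝔖_{w₀} = x^ρ = x_1^{n-1} x_2^{n-2} ⋯ x_{n-1}`, and `𝔖_{s_i w} = N_i 𝔖_w` whenever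
`ℓ(s_i w) < ℓ(w)`. Here `w₀ = Fin.revPerm`, and variables are indexed from `0`. The last variable
`X (n-1)` is only needed to make sense of the last divided difference. -/
def IsSchubertFamily (n : ℕ) (S : Perm (Fin n) → MvPolynomial (Fin n) ℂ) : Prop :=
  S Fin.revPerm = monomial (rho n) 1 ∧
  ∀ (i : ℕ) (h : i + 1 < n) (w : Perm (Fin n)),
    permLength (simpleRefl n i h * w) < permLength w →
      S (simpleRefl n i h * w) = dividedDiff n i h (S w)

/-! The next lemmas prove that such a family exists and is unique. -/

theorem X_sub_X_ne_zero {n : ℕ} {a b : Fin n} (h : a ≠ b) :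
    (X a - X b : MvPolynomial (Fin n) ℂ) ≠ 0 := by
  rw [sub_ne_zero]
  exact fun e => h (X_injective e)

theorem dividedDiff_comm (n i j : ℕ) (hi : i + 1 < n) (hj : j + 1 < n) (hij : i + 1 < j)
    (g : MvPolynomial (Fin n) ℂ) :
    dividedDiff n i hi (dividedDiff n j hj g) = dividedDiff n j hj (dividedDiff n i hi g) := by
  have e1 := mul_dividedDiff n i hi g
  have e2 := mul_dividedDiff n j hj g
  have e3 := mul_dividedDiff n i hi (dividedDiff n j hj g)
  have e4 := mul_dividedDiff n j hj (dividedDiff n i hi g)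
  set a : Fin n := ⟨i, Nat.lt_of_succ_lt hi⟩ with ha
  set b : Fin n := ⟨i + 1, hi⟩ with hb
  set c : Fin n := ⟨j, Nat.lt_of_succ_lt hj⟩ with hc
  set d : Fin n := ⟨j + 1, hj⟩ with hd
  have hac : a ≠ c := by simp [ha, hc, Fin.ext_iff]; omega
  have had : a ≠ d := by simp [ha, hd, Fin.ext_iff]; omega
  have hbc : b ≠ c := by simp [hb, hc, Fin.ext_iff]; omega
  have hbd : b ≠ d := by simp [hb, hd, Fin.ext_iff]; omega
  have hab : a ≠ b := by simp [ha, hb, Fin.ext_iff]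
  have hcd : c ≠ d := by simp [hc, hd, Fin.ext_iff]
  have hs : simpleRefl n i hi = swap a b := rfl
  have ht : simpleRefl n j hj = swap c d := rfl
  rw [hs] at e1 e3
  rw [ht] at e2 e4
  have f1 := congrArg (rename (swap c d)) e1
  have f2 := congrArg (rename (swap a b)) e2
  have hcm : rename (swap c d) (rename (swap a b) g) = rename (swap a b) (rename (swap c d) g) := by
    rw [rename_rename, rename_rename]
    congr 2
    have : (swap c d * swap a b : Perm (Fin n)) = swap a b * swap c d := by
      refine (Equiv.Perm.Disjoint.commute ?_).eq
      intro x
      by_cases h1 : x = c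
      · subst h1; right; exact swap_apply_of_ne_of_ne hac.symm hbc.symm
      · by_cases h2 : x = d
        · subst h2; right; exact swap_apply_of_ne_of_ne had.symm hbd.symm
        · left; exact swap_apply_of_ne_of_ne h1 h2
    have h2 := congrArg (fun p : Perm (Fin n) => (p : Fin n → Fin n)) this
    simpa [Perm.coe_mul] using h2
  simp only [map_mul, map_sub, rename_X, swap_apply_of_ne_of_ne hac had,
    swap_apply_of_ne_of_ne hbc hbd] at f1
  simp only [map_mul, map_sub, rename_X, swap_apply_of_ne_of_ne hac.symm hbc.symm,
    swap_apply_of_ne_of_ne had.symm hbd.symm] at f2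
  rw [hcm] at f1
  have n1 : (X a - X b : MvPolynomial (Fin n) ℂ) ≠ 0 := X_sub_X_ne_zero hab
  have n2 : (X c - X d : MvPolynomial (Fin n) ℂ) ≠ 0 := X_sub_X_ne_zero hcd
  apply mul_left_cancel₀ (mul_ne_zero n1 n2)
  linear_combination (X c - X d) * e3 + e2 - f2 - (X a - X b) * e4 - e1 + f1

theorem dividedDiff_braid (n i : ℕ) (hi : i + 1 < n) (hj : i + 1 + 1 < n)
    (g : MvPolynomial (Fin n) ℂ) :
    dividedDiff n i hi (dividedDiff n (i + 1) hj (dividedDiff n i hi g))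
      = dividedDiff n (i + 1) hj (dividedDiff n i hi (dividedDiff n (i + 1) hj g)) := by
  have u1 := mul_dividedDiff n i hi g
  have u2 := mul_dividedDiff n (i + 1) hj (dividedDiff n i hi g)
  have u3 := mul_dividedDiff n i hi (dividedDiff n (i + 1) hj (dividedDiff n i hi g))
  have v1 := mul_dividedDiff n (i + 1) hj g
  have v2 := mul_dividedDiff n i hi (dividedDiff n (i + 1) hj g)
  have v3 := mul_dividedDiff n (i + 1) hj (dividedDiff n i hi (dividedDiff n (i + 1) hj g))
  set a : Fin n := ⟨i, Nat.lt_of_succ_lt hi⟩ with ha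
  set b : Fin n := ⟨i + 1, hi⟩ with hb
  set c : Fin n := ⟨i + 1 + 1, hj⟩ with hc
  have hab : a ≠ b := by simp [ha, hb, Fin.ext_iff]
  have hac : a ≠ c := by simp [ha, hc, Fin.ext_iff]; omega
  have hbc : b ≠ c := by simp [hb, hc, Fin.ext_iff]
  have hs : simpleRefl n i hi = swap a b := rfl
  have ht : simpleRefl n (i + 1) hj = swap b c := rfl
  rw [hs] at u1 u3 v2
  rw [ht] at u2 v1 v3
  set g1 := dividedDiff n i hi g
  set g2 := dividedDiff n (i + 1) hj g1
  set g3 := dividedDiff n i hi g2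
  set k1 := dividedDiff n (i + 1) hj g
  set k2 := dividedDiff n i hi k1
  set k3 := dividedDiff n (i + 1) hj k2
  have sc : swap a b c = c := swap_apply_of_ne_of_ne hac.symm hbc.symm
  have ta : swap b c a = a := swap_apply_of_ne_of_ne hab hac
  have tu1 := congrArg (rename (swap b c)) u1
  have stu1 := congrArg (rename (swap a b)) tu1
  have su2 := congrArg (rename (swap a b)) u2
  have sv1 := congrArg (rename (swap a b)) v1
  have tsv1 := congrArg (rename (swap b c)) sv1
  have tv2 := congrArg (rename (swap b c)) v2
  have su1 := congrArg (rename (swap a b)) u1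
  have tv1 := congrArg (rename (swap b c)) v1
  have hbr : rename (swap a b) (rename (swap b c) (rename (swap a b) g))
      = rename (swap b c) (rename (swap a b) (rename (swap b c) g)) := by
    simp only [rename_rename]
    congr 2
    have hb1 : (swap a b * swap b c * swap a b : Perm (Fin n))
        = swap b c * swap a b * swap b c := by
      rw [swap_mul_swap_mul_swap hab hac, swap_comm b c, swap_comm a b,
        swap_mul_swap_mul_swap hbc.symm hac.symm, swap_comm]
    have h2 := congrArg (fun p : Perm (Fin n) => (p : Fin n → Fin n)) hb1
    simpa [Perm.coe_mul, Function.comp_assoc] using h2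
  have ss : ∀ p : MvPolynomial (Fin n) ℂ, rename (swap a b) (rename (swap a b) p) = p := by
    intro p
    rw [rename_rename, show (swap a b : Fin n → Fin n) ∘ (swap a b : Fin n → Fin n) = id from by
      funext x; simp, rename_id_apply]
  have tt : ∀ p : MvPolynomial (Fin n) ℂ, rename (swap b c) (rename (swap b c) p) = p := by
    intro p
    rw [rename_rename, show (swap b c : Fin n → Fin n) ∘ (swap b c : Fin n → Fin n) = id from by
      funext x; simp, rename_id_apply]
  simp only [map_mul, map_sub, rename_X, swap_apply_left, swap_apply_right, sc, ta, ss, tt]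
    at tu1 stu1 su2 sv1 tsv1 tv2 su1 tv1
  rw [hbr] at stu1
  have n1 : (X a - X b : MvPolynomial (Fin n) ℂ) ≠ 0 := X_sub_X_ne_zero hab
  have n2 : (X a - X c : MvPolynomial (Fin n) ℂ) ≠ 0 := X_sub_X_ne_zero hac
  have n3 : (X b - X c : MvPolynomial (Fin n) ℂ) ≠ 0 := X_sub_X_ne_zero hbc
  -- each side, multiplied by the Vandermonde product, is the alternating sum over the
  -- six permutations of the three variables
  have A2 : (X a - X b) * (X a - X c) * (X b - X c) * g2
      = (X a - X c) * (g - rename (swap a b) g)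
        - (X a - X b) * (rename (swap b c) g - rename (swap b c) (rename (swap a b) g)) := by
    linear_combination (X a - X b) * (X a - X c) * u2 + (X a - X c) * u1 - (X a - X b) * tu1
  have A2' : (X b - X a) * (X b - X c) * (X a - X c) * rename (swap a b) g2
      = (X b - X c) * (rename (swap a b) g - g)
        - (X b - X a) * (rename (swap a b) (rename (swap b c) g)
            - rename (swap b c) (rename (swap a b) (rename (swap b c) g))) := by
    linear_combination (X b - X a) * (X b - X c) * su2 + (X b - X c) * su1 - (X b - X a) * stu1
  have A3 : (X a - X b) * ((X a - X b) * (X a - X c) * (X b - X c) * g3)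
      = (X a - X b) * (g - rename (swap a b) g - rename (swap b c) g
        + rename (swap b c) (rename (swap a b) g) + rename (swap a b) (rename (swap b c) g)
        - rename (swap b c) (rename (swap a b) (rename (swap b c) g))) := by
    linear_combination (X a - X b) * (X a - X c) * (X b - X c) * u3 + A2 + A2'
  have B2 : (X b - X c) * (X a - X c) * (X a - X b) * k2
      = (X a - X c) * (g - rename (swap b c) g)
        - (X b - X c) * (rename (swap a b) g - rename (swap a b) (rename (swap b c) g)) := by
    linear_combination (X b - X c) * (X a - X c) * v2 + (X a - X c) * v1 - (X b - X c) * sv1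
  have B2' : (X c - X b) * (X a - X b) * (X a - X c) * rename (swap b c) k2
      = (X a - X b) * (rename (swap b c) g - g)
        - (X c - X b) * (rename (swap b c) (rename (swap a b) g)
            - rename (swap b c) (rename (swap a b) (rename (swap b c) g))) := by
    linear_combination (X c - X b) * (X a - X b) * tv2 + (X a - X b) * tv1 - (X c - X b) * tsv1
  have B3 : (X b - X c) * ((X b - X c) * (X a - X c) * (X a - X b) * k3)
      = (X b - X c) * (g - rename (swap a b) g - rename (swap b c) g
        + rename (swap b c) (rename (swap a b) g) + rename (swap a b) (rename (swap b c) g)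
        - rename (swap b c) (rename (swap a b) (rename (swap b c) g))) := by
    linear_combination (X b - X c) * (X a - X c) * (X a - X b) * v3 + B2 + B2'
  have A4 := mul_left_cancel₀ n1 A3
  have B4 := mul_left_cancel₀ n3 B3
  apply mul_left_cancel₀ (mul_ne_zero (mul_ne_zero n1 n2) n3)
  linear_combination A4 - B4

/-- Pairs of values that are out of order in `w`. -/
def invSet {n : ℕ} (w : Perm (Fin n)) : Finset (Fin n × Fin n) :=
  Finset.univ.filter fun q => q.1 < q.2 ∧ w⁻¹ q.2 < w⁻¹ q.1

theorem simpleRefl_sq (n i : ℕ) (h : i + 1 < n) : simpleRefl n i h * simpleRefl n i h = 1 :=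
  swap_mul_self _ _

theorem inv_simpleRefl_mul {n : ℕ} (i : ℕ) (h : i + 1 < n) (w : Perm (Fin n)) (x : Fin n) :
    (simpleRefl n i h * w)⁻¹ x = w⁻¹ (simpleRefl n i h x) := by
  rw [mul_inv_rev, Perm.mul_apply, simpleRefl, swap_inv]

theorem simpleRefl_left (n i : ℕ) (h : i + 1 < n) :
    simpleRefl n i h ⟨i, Nat.lt_of_succ_lt h⟩ = ⟨i + 1, h⟩ := swap_apply_left _ _

theorem simpleRefl_right (n i : ℕ) (h : i + 1 < n) :
    simpleRefl n i h ⟨i + 1, h⟩ = ⟨i, Nat.lt_of_succ_lt h⟩ := swap_apply_right _ _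

theorem simpleRefl_of_ne (n i : ℕ) (h : i + 1 < n) (x : Fin n) (h1 : (x : ℕ) ≠ i)
    (h2 : (x : ℕ) ≠ i + 1) : simpleRefl n i h x = x :=
  swap_apply_of_ne_of_ne (fun e => h1 (by rw [e])) (fun e => h2 (by rw [e]))

theorem simpleRefl_val (n i : ℕ) (h : i + 1 < n) (x : Fin n) :
    (simpleRefl n i h x : ℕ) =
      if (x : ℕ) = i then i + 1 else if (x : ℕ) = i + 1 then i else x := by
  by_cases h1 : (x : ℕ) = i
  · have : x = ⟨i, Nat.lt_of_succ_lt h⟩ := Fin.ext h1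
    rw [this, simpleRefl_left]; simp
  · by_cases h2 : (x : ℕ) = i + 1
    · have : x = ⟨i + 1, h⟩ := Fin.ext h2
      rw [this, simpleRefl_right]; simp
    · rw [simpleRefl_of_ne n i h x h1 h2]; simp [h1, h2]

theorem simpleRefl_simpleRefl (n i : ℕ) (h : i + 1 < n) (x : Fin n) :
    simpleRefl n i h (simpleRefl n i h x) = x := by
  simp [simpleRefl]


theorem simpleRefl_braid (n i : ℕ) (hi : i + 1 < n) (hj : i + 1 + 1 < n) :
    simpleRefl n i hi * simpleRefl n (i + 1) hj * simpleRefl n i hi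
      = simpleRefl n (i + 1) hj * simpleRefl n i hi * simpleRefl n (i + 1) hj := by
  have hab : (⟨i, Nat.lt_of_succ_lt hi⟩ : Fin n) ≠ ⟨i + 1, hi⟩ := by simp [Fin.ext_iff]
  have hac : (⟨i, Nat.lt_of_succ_lt hi⟩ : Fin n) ≠ ⟨i + 1 + 1, hj⟩ := by
    simp [Fin.ext_iff]; omega
  have hbc : (⟨i + 1, hi⟩ : Fin n) ≠ ⟨i + 1 + 1, hj⟩ := by simp [Fin.ext_iff]
  simp only [simpleRefl]
  rw [swap_mul_swap_mul_swap hab hac, swap_comm (⟨i + 1, hi⟩ : Fin n) ⟨i + 1 + 1, hj⟩,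
    swap_comm (⟨i, Nat.lt_of_succ_lt hi⟩ : Fin n) ⟨i + 1, hi⟩,
    swap_mul_swap_mul_swap hbc.symm hac.symm, swap_comm]

theorem simpleRefl_lt {n i : ℕ} (h : i + 1 < n) {x y : Fin n} (hxy : x < y)
    (hne : ¬ ((x : ℕ) = i ∧ (y : ℕ) = i + 1)) : simpleRefl n i h x < simpleRefl n i h y := by
  rw [Fin.lt_def] at hxy ⊢
  rw [simpleRefl_val, simpleRefl_val]
  split_ifs <;> omega

theorem card_invSet_of_asc {n i : ℕ} (h : i + 1 < n) (w : Perm (Fin n))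
    (hw : w⁻¹ ⟨i, Nat.lt_of_succ_lt h⟩ < w⁻¹ ⟨i + 1, h⟩) :
    (invSet (simpleRefl n i h * w)).card = (invSet w).card + 1 := by
  classical
  set s := simpleRefl n i h with hs
  set a : Fin n := ⟨i, Nat.lt_of_succ_lt h⟩ with ha
  set b : Fin n := ⟨i + 1, h⟩ with hb
  have hss : ∀ x, s (s x) = x := simpleRefl_simpleRefl n i h
  have key : invSet (s * w) = insert (a, b) ((invSet w).map (s.prodCongr s).toEmbedding) := by
    ext ⟨x, y⟩
    have hm : (x, y) ∈ (invSet w).map (s.prodCongr s).toEmbedding ↔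
        s x < s y ∧ w⁻¹ (s y) < w⁻¹ (s x) := by
      simp only [invSet, Finset.mem_map, Finset.mem_filter, Finset.mem_univ, true_and,
        Prod.exists, Equiv.coe_toEmbedding, Equiv.prodCongr_apply, Prod.map_apply,
        Prod.mk.injEq]
      constructor
      · rintro ⟨x', y', h1, rfl, rfl⟩
        rwa [hss, hss]
      · intro h1
        exact ⟨s x, s y, h1, hss x, hss y⟩
    rw [Finset.mem_insert, hm]
    simp only [invSet, Finset.mem_filter, Finset.mem_univ, true_and, hs, inv_simpleRefl_mul]
    simp only [← hs]
    constructor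
    · rintro ⟨h1, h2⟩
      by_cases hc : (x : ℕ) = i ∧ (y : ℕ) = i + 1
      · left
        rw [Prod.mk.injEq]
        exact ⟨Fin.ext hc.1, Fin.ext hc.2⟩
      · right
        exact ⟨simpleRefl_lt h h1 hc, h2⟩
    · rintro (h1 | ⟨h1, h2⟩)
      · rw [Prod.mk.injEq] at h1
        obtain ⟨rfl, rfl⟩ := h1
        refine ⟨by rw [ha, hb, Fin.lt_def]; simp, ?_⟩
        rw [hs, ha, hb, simpleRefl_left, simpleRefl_right]
        exact hw
      · refine ⟨?_, h2⟩
        by_cases hc : ((s x : Fin n) : ℕ) = i ∧ ((s y : Fin n) : ℕ) = i + 1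
        · exfalso
          have e1 : s x = a := Fin.ext hc.1
          have e2 : s y = b := Fin.ext hc.2
          rw [e1, e2] at h2
          exact absurd hw (not_lt.2 h2.le)
        · have := simpleRefl_lt h h1 hc
          rwa [← hs, hss, hss] at this
  rw [key, Finset.card_insert_of_notMem, Finset.card_map]
  simp only [invSet, Finset.mem_map, Finset.mem_filter, Finset.mem_univ, true_and,
    Prod.exists, Equiv.coe_toEmbedding, Equiv.prodCongr_apply, Prod.map_apply, Prod.mk.injEq,
    not_exists, not_and]
  rintro x y ⟨h1, h2⟩ e1 e2
  have f1 : x = b := by rw [← hss x, e1, hs, ha, simpleRefl_left]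
  have f2 : y = a := by rw [← hss y, e2, hs, hb, simpleRefl_right]
  rw [f1, f2, ha, hb, Fin.lt_def] at h1
  simp at h1

theorem asc_or_desc {n i : ℕ} (h : i + 1 < n) (w : Perm (Fin n)) :
    w⁻¹ ⟨i, Nat.lt_of_succ_lt h⟩ < w⁻¹ ⟨i + 1, h⟩ ∨
      w⁻¹ ⟨i + 1, h⟩ < w⁻¹ ⟨i, Nat.lt_of_succ_lt h⟩ := by
  apply lt_or_gt_of_ne
  intro e
  have := w⁻¹.injective e
  simp [Fin.ext_iff] at this

theorem card_invSet_of_desc {n i : ℕ} (h : i + 1 < n) (w : Perm (Fin n))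
    (hw : w⁻¹ ⟨i + 1, h⟩ < w⁻¹ ⟨i, Nat.lt_of_succ_lt h⟩) :
    (invSet (simpleRefl n i h * w)).card + 1 = (invSet w).card := by
  have h1 := card_invSet_of_asc h (simpleRefl n i h * w) (by
    rw [inv_simpleRefl_mul, inv_simpleRefl_mul, simpleRefl_left, simpleRefl_right]
    exact hw)
  rw [← mul_assoc, simpleRefl_sq, one_mul] at h1
  exact h1.symm

theorem invSet_one (n : ℕ) : invSet (1 : Perm (Fin n)) = ∅ := by
  ext ⟨x, y⟩
  simp only [invSet, inv_one, Perm.one_apply, Finset.mem_filter, Finset.mem_univ, true_and,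
    Finset.notMem_empty, iff_false, not_and, not_lt]
  exact fun h => h.le

theorem card_invSet_prod_le {n : ℕ} (L : List (Perm (Fin n)))
    (hL : ∀ s ∈ L, ∃ i, ∃ h : i + 1 < n, s = simpleRefl n i h) :
    (invSet L.prod).card ≤ L.length := by
  induction L with
  | nil => simp [invSet_one]
  | cons s L ih =>
    have ih' := ih fun t ht => hL t (List.mem_cons_of_mem _ ht)
    obtain ⟨i, h, rfl⟩ := hL s List.mem_cons_self
    rw [List.prod_cons, List.length_cons]
    rcases asc_or_desc h L.prod with hd | hd
    · have := card_invSet_of_asc h _ hd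
      omega
    · have := card_invSet_of_desc h _ hd
      omega

theorem eq_one_of_forall_asc {n : ℕ} (p : Perm (Fin n))
    (hp : ∀ (i : ℕ) (h : i + 1 < n), p ⟨i, Nat.lt_of_succ_lt h⟩ < p ⟨i + 1, h⟩) : p = 1 := by
  have hm : StrictMono p := by
    cases n with
    | zero => exact fun x => x.elim0
    | succ n =>
      rw [Fin.strictMono_iff_lt_succ]
      intro i
      exact hp i (by omega)
  have : (hm.orderIsoOfSurjective p p.surjective) = OrderIso.refl (Fin n) := Subsingleton.elim _ _
  ext x
  have h2 := congrArg (fun f : Fin n ≃o Fin n => f x) this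
  exact congrArg Fin.val h2

theorem isWordProd_card_invSet {n : ℕ} (w : Perm (Fin n)) : IsWordProd w (invSet w).card := by
  generalize hk : (invSet w).card = k
  induction k generalizing w with
  | zero =>
    refine ⟨[], rfl, by simp, ?_⟩
    have : w⁻¹ = 1 := by
      apply eq_one_of_forall_asc
      intro i h
      rcases asc_or_desc h w with hd | hd
      · exact hd
      · have := card_invSet_of_desc h _ hd
        omega
    rw [List.prod_nil, ← inv_inv w, this, inv_one]
  | succ k ih =>
    by_cases hd : ∃ i, ∃ h : i + 1 < n, w⁻¹ ⟨i + 1, h⟩ < w⁻¹ ⟨i, Nat.lt_of_succ_lt h⟩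
    · obtain ⟨i, h, hd⟩ := hd
      have h1 := card_invSet_of_desc h _ hd
      obtain ⟨L, h2, h3, h4⟩ := ih (simpleRefl n i h * w) (by omega)
      refine ⟨simpleRefl n i h :: L, by simp [h2], ?_, ?_⟩
      · intro s hs
        rcases List.mem_cons.1 hs with rfl | hs
        · exact ⟨i, h, rfl⟩
        · exact h3 s hs
      · rw [List.prod_cons, h4, ← mul_assoc, simpleRefl_sq, one_mul]
    · exfalso
      have : w⁻¹ = 1 := by
        apply eq_one_of_forall_asc
        intro i h
        rcases asc_or_desc h w with h1 | h1
        · exact h1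
        · exact absurd ⟨i, h, h1⟩ hd
      have h2 : w = 1 := by rw [← inv_inv w, this, inv_one]
      rw [h2, invSet_one] at hk
      simp at hk

/-- The length is the number of inversions. -/
theorem permLength_eq {n : ℕ} (w : Perm (Fin n)) : permLength w = (invSet w).card := by
  apply le_antisymm
  · exact Nat.sInf_le (isWordProd_card_invSet w)
  · obtain ⟨L, h1, h2, h3⟩ : IsWordProd w (permLength w) :=
      Nat.sInf_mem (s := {k | IsWordProd w k}) ⟨_, isWordProd_card_invSet w⟩
    rw [← h1, ← h3]
    exact card_invSet_prod_le L h2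

theorem card_invSet_le {n : ℕ} (w : Perm (Fin n)) : (invSet w).card ≤ n * n := by
  refine (Finset.card_le_univ _).trans ?_
  simp

open Classical in
/-- Auxiliary: descend from the longest element, always through the ascent picked by choice;
`k` bounds the number of remaining steps. -/
noncomputable def schubertAux (n : ℕ) : ℕ → Perm (Fin n) → MvPolynomial (Fin n) ℂ
  | 0, _ => monomial (rho n) 1
  | k + 1, w =>
    if hw : ∃ i, ∃ h : i + 1 < n, w⁻¹ ⟨i, Nat.lt_of_succ_lt h⟩ < w⁻¹ ⟨i + 1, h⟩ then
      dividedDiff n hw.choose hw.choose_spec.choose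
        (schubertAux n k (simpleRefl n hw.choose hw.choose_spec.choose * w))
    else monomial (rho n) 1

noncomputable def schubertOf (n : ℕ) (w : Perm (Fin n)) : MvPolynomial (Fin n) ℂ :=
  schubertAux n (n * n - (invSet w).card) w

theorem schubertOf_exists {n : ℕ} (w : Perm (Fin n))
    (hw : ∃ i, ∃ h : i + 1 < n, w⁻¹ ⟨i, Nat.lt_of_succ_lt h⟩ < w⁻¹ ⟨i + 1, h⟩) :
    ∃ i, ∃ h : i + 1 < n, w⁻¹ ⟨i, Nat.lt_of_succ_lt h⟩ < w⁻¹ ⟨i + 1, h⟩ ∧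
      schubertOf n w = dividedDiff n i h (schubertOf n (simpleRefl n i h * w)) := by
  refine ⟨hw.choose, hw.choose_spec.choose, hw.choose_spec.choose_spec, ?_⟩
  have h1 := card_invSet_of_asc hw.choose_spec.choose w hw.choose_spec.choose_spec
  have h2 := card_invSet_le (simpleRefl n hw.choose hw.choose_spec.choose * w)
  obtain ⟨k, hk⟩ : ∃ k, n * n - (invSet w).card = k + 1 :=
    ⟨n * n - (invSet w).card - 1, by omega⟩
  have hk' : n * n - (invSet (simpleRefl n hw.choose hw.choose_spec.choose * w)).card = k := by
    omega
  rw [schubertOf, schubertOf, hk, hk', schubertAux, dif_pos hw]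

theorem schubertOf_of_asc {n : ℕ} (w : Perm (Fin n)) (i : ℕ) (h : i + 1 < n)
    (hw : w⁻¹ ⟨i, Nat.lt_of_succ_lt h⟩ < w⁻¹ ⟨i + 1, h⟩) :
    schubertOf n w = dividedDiff n i h (schubertOf n (simpleRefl n i h * w)) := by
  generalize hm : n * n - (invSet w).card = m
  induction m using Nat.strong_induction_on generalizing w i with
  | _ m ih =>
    have up : ∀ (v : Perm (Fin n)) (j : ℕ) (hj : j + 1 < n),
        v⁻¹ ⟨j, Nat.lt_of_succ_lt hj⟩ < v⁻¹ ⟨j + 1, hj⟩ → (invSet w).card < (invSet v).card →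
        schubertOf n v = dividedDiff n j hj (schubertOf n (simpleRefl n j hj * v)) := by
      intro v j hj hv hlt
      have := card_invSet_le v
      exact ih (n * n - (invSet v).card) (by omega) v j hj hv rfl
    -- two ascents at distance at least two
    have far : ∀ (i j : ℕ) (hi : i + 1 < n) (hj : j + 1 < n), i + 1 < j →
        w⁻¹ ⟨i, Nat.lt_of_succ_lt hi⟩ < w⁻¹ ⟨i + 1, hi⟩ →
        w⁻¹ ⟨j, Nat.lt_of_succ_lt hj⟩ < w⁻¹ ⟨j + 1, hj⟩ →
        dividedDiff n i hi (schubertOf n (simpleRefl n i hi * w))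
          = dividedDiff n j hj (schubertOf n (simpleRefl n j hj * w)) := by
      intro i j hi hj hij wi wj
      have ci := card_invSet_of_asc hi w wi
      have cj := card_invSet_of_asc hj w wj
      have e1 := up (simpleRefl n i hi * w) j hj (by
        rw [inv_simpleRefl_mul, inv_simpleRefl_mul,
          simpleRefl_of_ne n i hi _ (by simp; omega) (by simp; omega),
          simpleRefl_of_ne n i hi _ (by simp; omega) (by simp; omega)]
        exact wj) (by omega)
      have e2 := up (simpleRefl n j hj * w) i hi (by
        rw [inv_simpleRefl_mul, inv_simpleRefl_mul,
          simpleRefl_of_ne n j hj _ (by simp; omega) (by simp; omega),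
          simpleRefl_of_ne n j hj _ (by simp; omega) (by simp; omega)]
        exact wi) (by omega)
      have hc : simpleRefl n j hj * (simpleRefl n i hi * w)
          = simpleRefl n i hi * (simpleRefl n j hj * w) := by
        rw [← mul_assoc, ← mul_assoc]
        congr 1
        ext x
        simp only [Perm.mul_apply, simpleRefl_val]
        split_ifs <;> omega
      rw [e1, e2, hc, dividedDiff_comm n i j hi hj hij]
    -- two adjacent ascents
    have near : ∀ (i : ℕ) (hi : i + 1 < n) (hj : i + 1 + 1 < n),
        w⁻¹ ⟨i, Nat.lt_of_succ_lt hi⟩ < w⁻¹ ⟨i + 1, hi⟩ →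
        w⁻¹ ⟨i + 1, Nat.lt_of_succ_lt hj⟩ < w⁻¹ ⟨i + 1 + 1, hj⟩ →
        dividedDiff n i hi (schubertOf n (simpleRefl n i hi * w))
          = dividedDiff n (i + 1) hj (schubertOf n (simpleRefl n (i + 1) hj * w)) := by
      intro i hi hj wi wj
      have ci := card_invSet_of_asc hi w wi
      have cj := card_invSet_of_asc hj w wj
      have s1 : simpleRefl n i hi ⟨i + 1 + 1, hj⟩ = ⟨i + 1 + 1, hj⟩ :=
        simpleRefl_of_ne n i hi _ (by simp; omega) (by simp)
      have s2 : simpleRefl n (i + 1) hj ⟨i, Nat.lt_of_succ_lt hi⟩ = ⟨i, Nat.lt_of_succ_lt hi⟩ :=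
        simpleRefl_of_ne n (i + 1) hj _ (by simp) (by simp; omega)
      have a1 : (simpleRefl n i hi * w)⁻¹ ⟨i + 1, Nat.lt_of_succ_lt hj⟩
          < (simpleRefl n i hi * w)⁻¹ ⟨i + 1 + 1, hj⟩ := by
        rw [inv_simpleRefl_mul, inv_simpleRefl_mul, s1, simpleRefl_right]
        exact wi.trans wj
      have a2 : (simpleRefl n (i + 1) hj * w)⁻¹ ⟨i, Nat.lt_of_succ_lt hi⟩
          < (simpleRefl n (i + 1) hj * w)⁻¹ ⟨i + 1, hi⟩ := by
        rw [inv_simpleRefl_mul, inv_simpleRefl_mul, s2, simpleRefl_left]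
        exact wi.trans wj
      have c1 := card_invSet_of_asc hj _ a1
      have c2 := card_invSet_of_asc hi _ a2
      have e1 := up _ (i + 1) hj a1 (by omega)
      have e2 := up _ i hi a2 (by omega)
      have e3 := up (simpleRefl n (i + 1) hj * (simpleRefl n i hi * w)) i hi (by
        simp only [inv_simpleRefl_mul, s1, s2, simpleRefl_left]
        exact wj) (by omega)
      have e4 := up (simpleRefl n i hi * (simpleRefl n (i + 1) hj * w)) (i + 1) hj (by
        simp only [inv_simpleRefl_mul, s1, s2, simpleRefl_right]
        exact wi) (by omega)
      have hc : simpleRefl n i hi * (simpleRefl n (i + 1) hj * (simpleRefl n i hi * w))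
          = simpleRefl n (i + 1) hj * (simpleRefl n i hi * (simpleRefl n (i + 1) hj * w)) := by
        have := congrArg (· * w) (simpleRefl_braid n i hi hj)
        simpa only [mul_assoc] using this
      rw [e1, e3, e2, e4, hc, dividedDiff_braid n i hi hj]
    obtain ⟨j, hj, wj, e⟩ := schubertOf_exists w ⟨i, h, hw⟩
    rw [e]
    rcases lt_trichotomy i j with hij | rfl | hij
    · rcases Nat.lt_or_ge (i + 1) j with hij' | hij'
      · exact (far i j h hj hij' hw wj).symm
      · obtain rfl : j = i + 1 := by omega
        exact (near i h hj hw wj).symm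
    · rfl
    · rcases Nat.lt_or_ge (j + 1) i with hij' | hij'
      · exact far j i hj h hij' wj hw
      · obtain rfl : i = j + 1 := by omega
        exact near j hj h wj hw

theorem exists_schubertFamily (n : ℕ) :
    ∃ S : Perm (Fin n) → MvPolynomial (Fin n) ℂ, IsSchubertFamily n S := by
  refine ⟨schubertOf n, ?_, ?_⟩
  · have hno : ¬ ∃ i, ∃ h : i + 1 < n, (Fin.revPerm : Perm (Fin n))⁻¹ ⟨i, Nat.lt_of_succ_lt h⟩
        < (Fin.revPerm : Perm (Fin n))⁻¹ ⟨i + 1, h⟩ := by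
      rintro ⟨i, h, hlt⟩
      have hr : (Fin.revPerm : Perm (Fin n))⁻¹ = Fin.revPerm := rfl
      rw [hr, Fin.revPerm_apply, Fin.revPerm_apply, Fin.rev_lt_rev, Fin.lt_def] at hlt
      simp at hlt
    rw [schubertOf]
    cases n * n - (invSet (Fin.revPerm : Perm (Fin n))).card with
    | zero => rfl
    | succ k => rw [schubertAux, dif_neg hno]
  · intro i h w hlt
    rw [permLength_eq, permLength_eq] at hlt
    have hd : w⁻¹ ⟨i + 1, h⟩ < w⁻¹ ⟨i, Nat.lt_of_succ_lt h⟩ := by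
      rcases asc_or_desc h w with h1 | h1
      · have := card_invSet_of_asc h w h1
        omega
      · exact h1
    have e := schubertOf_of_asc (simpleRefl n i h * w) i h (by
      rw [inv_simpleRefl_mul, inv_simpleRefl_mul, simpleRefl_left, simpleRefl_right]
      exact hd)
    rw [e, ← mul_assoc, simpleRefl_sq, one_mul]

theorem schubertFamily_unique {n : ℕ} {S T : Perm (Fin n) → MvPolynomial (Fin n) ℂ}
    (hS : IsSchubertFamily n S) (hT : IsSchubertFamily n T) : S = T := by
  funext w
  generalize hm : n * n - (invSet w).card = m
  induction m using Nat.strong_induction_on generalizing w with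
  | _ m ih =>
    by_cases hw : ∃ i, ∃ h : i + 1 < n, w⁻¹ ⟨i, Nat.lt_of_succ_lt h⟩ < w⁻¹ ⟨i + 1, h⟩
    · obtain ⟨i, h, hw⟩ := hw
      have c := card_invSet_of_asc h w hw
      have cle := card_invSet_le (simpleRefl n i h * w)
      have e : simpleRefl n i h * (simpleRefl n i h * w) = w := by
        rw [← mul_assoc, simpleRefl_sq, one_mul]
      have hlt : permLength (simpleRefl n i h * (simpleRefl n i h * w))
          < permLength (simpleRefl n i h * w) := by
        rw [e, permLength_eq, permLength_eq]
        omega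
      have e1 := hS.2 i h _ hlt
      have e2 := hT.2 i h _ hlt
      rw [e] at e1 e2
      rw [e1, e2, ih _ (by omega) (simpleRefl n i h * w) rfl]
    · have h1 : w⁻¹ * Fin.revPerm = 1 := by
        apply eq_one_of_forall_asc
        intro i h
        rw [Perm.mul_apply, Perm.mul_apply, Fin.revPerm_apply, Fin.revPerm_apply]
        have hj : (n - (i + 1 + 1)) + 1 < n := by omega
        have ea : Fin.rev (⟨i, Nat.lt_of_succ_lt h⟩ : Fin n) = ⟨(n - (i + 1 + 1)) + 1, hj⟩ := by
          rw [Fin.ext_iff, Fin.val_rev]; simp only; omega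
        have eb : Fin.rev (⟨i + 1, h⟩ : Fin n) = ⟨n - (i + 1 + 1), Nat.lt_of_succ_lt hj⟩ := by
          rw [Fin.ext_iff, Fin.val_rev]
        rw [ea, eb]
        rcases asc_or_desc hj w with h2 | h2
        · exact absurd ⟨_, hj, h2⟩ hw
        · exact h2
      have h2 : w = Fin.revPerm := (inv_mul_eq_one.1 h1)
      rw [h2, hS.1, hT.1]

/-- The Schubert polynomial `𝔖_w`. -/
noncomputable def schubert (n : ℕ) : Perm (Fin n) → MvPolynomial (Fin n) ℂ :=
  Classical.choose (exists_schubertFamily n)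

theorem isSchubertFamily_schubert (n : ℕ) : IsSchubertFamily n (schubert n) :=
  Classical.choose_spec (exists_schubertFamily n)

/-! ### Padding, and the operators `∇` and `Δ`

The variables `x_i` and `y_i` are `X (Sum.inl i)` and `X (Sum.inr i)`. -/

/-- The padded monomial `x^α y^{ρ-α}`. -/
noncomputable def paddedMonomial (n : ℕ) (α : Fin n →₀ ℕ) : MvPolynomial (Fin n ⊕ Fin n) ℂ :=
  monomial (Finsupp.sumElim α (rho n - α)) 1

/-- `Ṽ`, the span of the `x^α y^{ρ-α}` with `α ≤ ρ`. -/
noncomputable def paddedSpace (n : ℕ) : Submodule ℂ (MvPolynomial (Fin n ⊕ Fin n) ℂ) :=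
  Submodule.span ℂ {f | ∃ α, α ≤ rho n ∧ f = paddedMonomial n α}

/-- The linear map `x^α ↦ x^α y^{ρ-α}`; it is used only on the span `V` of the `x^α` with
`α ≤ ρ`. -/
noncomputable def pad (n : ℕ) : MvPolynomial (Fin n) ℂ →ₗ[ℂ] MvPolynomial (Fin n ⊕ Fin n) ℂ :=
  (basisMonomials (Fin n) ℂ).constr ℂ (paddedMonomial n)

/-- The padded Schubert polynomial of `w`. -/
noncomputable def paddedSchubert (n : ℕ) (w : Perm (Fin n)) : MvPolynomial (Fin n ⊕ Fin n) ℂ :=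
  pad n (schubert n w)

/-- `∇ = ∑_{i=1}^{n-1} y_i ∂/∂x_i`, on polynomials. -/
noncomputable def nablaPoly (n : ℕ) : Module.End ℂ (MvPolynomial (Fin n ⊕ Fin n) ℂ) :=
  ∑ i ∈ Finset.univ.filter (fun i : Fin n => (i : ℕ) + 1 < n),
    LinearMap.mulLeft ℂ (X (Sum.inr i)) ∘ₗ (pderiv (Sum.inl i)).toLinearMap

/-- `Δ = ∑_{i=1}^{n-1} x_i ∂/∂y_i`, on polynomials. -/
noncomputable def deltaPoly (n : ℕ) : Module.End ℂ (MvPolynomial (Fin n ⊕ Fin n) ℂ) :=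
  ∑ i ∈ Finset.univ.filter (fun i : Fin n => (i : ℕ) + 1 < n),
    LinearMap.mulLeft ℂ (X (Sum.inl i)) ∘ₗ (pderiv (Sum.inr i)).toLinearMap

theorem nablaPoly_mem (n : ℕ) : ∀ f ∈ paddedSpace n, nablaPoly n f ∈ paddedSpace n := by
  intro f hf
  refine (Submodule.span_le (p := (paddedSpace n).comap (nablaPoly n))).2 ?_ hf
  rintro _ ⟨α, hα, rfl⟩
  simp only [Submodule.comap_coe, Set.mem_preimage, SetLike.mem_coe, nablaPoly,
    LinearMap.sum_apply, LinearMap.comp_apply, LinearMap.mulLeft_apply, Derivation.coeFn_coe]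
  refine Submodule.sum_mem _ fun i _ => ?_
  rw [paddedMonomial, pderiv_monomial, X, monomial_mul, one_mul, one_mul, Finsupp.sumElim_inl]
  rcases Nat.eq_zero_or_pos (α i) with h0 | hpos
  · rw [h0, Nat.cast_zero, monomial_zero]
    exact Submodule.zero_mem _
  · have hle : α - Finsupp.single i 1 ≤ rho n := tsub_le_self.trans hα
    have e : (Finsupp.single (Sum.inr i) 1 +
        (Finsupp.sumElim α (rho n - α) - Finsupp.single (Sum.inl i) 1) : Fin n ⊕ Fin n →₀ ℕ)
        = Finsupp.sumElim (α - Finsupp.single i 1) (rho n - (α - Finsupp.single i 1)) := by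
      classical
      ext (k | k)
      · simp [Finsupp.single_apply]
      · have hk := hα k
        by_cases hik : i = k
        · subst hik
          simp
          omega
        · simp [hik]
    rw [e, ← mul_one ((α i : ℕ) : ℂ), ← smul_eq_mul, ← smul_monomial]
    exact Submodule.smul_mem _ _ (Submodule.subset_span ⟨_, hle, rfl⟩)

theorem deltaPoly_mem (n : ℕ) : ∀ f ∈ paddedSpace n, deltaPoly n f ∈ paddedSpace n := by
  intro f hf
  refine (Submodule.span_le (p := (paddedSpace n).comap (deltaPoly n))).2 ?_ hf
  rintro _ ⟨α, hα, rfl⟩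
  simp only [Submodule.comap_coe, Set.mem_preimage, SetLike.mem_coe, deltaPoly,
    LinearMap.sum_apply, LinearMap.comp_apply, LinearMap.mulLeft_apply, Derivation.coeFn_coe]
  refine Submodule.sum_mem _ fun i _ => ?_
  rw [paddedMonomial, pderiv_monomial, X, monomial_mul, one_mul, one_mul, Finsupp.sumElim_inr]
  rcases Nat.eq_zero_or_pos ((rho n - α) i) with h0 | hpos
  · rw [h0, Nat.cast_zero, monomial_zero]
    exact Submodule.zero_mem _
  · have hpos' : α i < rho n i := by
      rw [Finsupp.tsub_apply] at hpos
      omega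
    have hle : α + Finsupp.single i 1 ≤ rho n := by
      classical
      intro k
      have hk := hα k
      by_cases hik : i = k
      · subst hik
        simp
        omega
      · simpa [Finsupp.single_apply, hik] using hk
    have e : (Finsupp.single (Sum.inl i) 1 +
        (Finsupp.sumElim α (rho n - α) - Finsupp.single (Sum.inr i) 1) : Fin n ⊕ Fin n →₀ ℕ)
        = Finsupp.sumElim (α + Finsupp.single i 1) (rho n - (α + Finsupp.single i 1)) := by
      classical
      ext (k | k)
      · simp [Finsupp.single_apply, add_comm]
      · by_cases hik : i = k
        · subst hik
          simp
          omega
        · simp [hik]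
    rw [e, ← mul_one (((rho n - α) i : ℕ) : ℂ), ← smul_eq_mul, ← smul_monomial]
    exact Submodule.smul_mem _ _ (Submodule.subset_span ⟨_, hle, rfl⟩)

/-- The operator `∇` on `Ṽ`. -/
noncomputable def nabla (n : ℕ) : Module.End ℂ (paddedSpace n) :=
  (nablaPoly n).restrict (nablaPoly_mem n)

/-- The operator `Δ` on `Ṽ`. -/
noncomputable def delta (n : ℕ) : Module.End ℂ (paddedSpace n) :=
  (deltaPoly n).restrict (deltaPoly_mem n)

/-! ### Matrices of iterated raising and lowering operators

`b` is a basis indexed by permutations, that is, an identification of `Ṽ` with the space of formal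
linear combinations of permutations. Columns are indexed by the source. -/

/-- `A` is the matrix of `U^{[i,j]} = U_{j-1} ⋯ U_{i+1} U_i`, mapping rank `i` to rank `j`. -/
def IsRaisingMatrix {n : ℕ} (b : Module.Basis (Perm (Fin n)) ℂ (paddedSpace n))
    (U : Module.End ℂ (paddedSpace n)) (i j : ℕ) (A : Matrix (Level n j) (Level n i) ℤ) : Prop :=
  ∀ u : Level n i, (U ^ (j - i)) (b u) = ∑ w : Level n j, (A w u : ℂ) • b w

/-- `A` is the matrix of `D^{[i,j]} = D_{i+1} ⋯ D_{j-1} D_j`, mapping rank `j` to rank `i`. -/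
def IsLoweringMatrix {n : ℕ} (b : Module.Basis (Perm (Fin n)) ℂ (paddedSpace n))
    (D : Module.End ℂ (paddedSpace n)) (i j : ℕ) (A : Matrix (Level n i) (Level n j) ℤ) : Prop :=
  ∀ u : Level n j, (D ^ (j - i)) (b u) = ∑ w : Level n i, (A w u : ℂ) • b w

/-! ### Smith normal forms -/

/-- `B` is the Smith normal form of `A`. -/
def IsSNF {m k : ℕ} (A B : Matrix (Fin m) (Fin k) ℤ) : Prop :=
  (∀ (i : Fin m) (j : Fin k), (i : ℕ) ≠ j → B i j = 0) ∧
  (∀ (i : Fin m) (j : Fin k), (i : ℕ) = j → 0 ≤ B i j) ∧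
  (∀ (i : Fin m) (j : Fin k) (i' : Fin m) (j' : Fin k), (i : ℕ) = j →
    (i' : ℕ) = j' → (i' : ℕ) = i + 1 → B i j ∣ B i' j') ∧
  ∃ (P : GL (Fin m) ℤ) (Q : GL (Fin k) ℤ),
    B = (P : Matrix (Fin m) (Fin m) ℤ) * A * (Q : Matrix (Fin k) (Fin k) ℤ)

/-- The square matrix `S` is the reduced Smith normal form of `A`: the Smith normal form of `A` (for
some, equivalently any, ordering of its rows and columns), with the extra zero rows or columns
removed. If `A` is square this is the Smith normal form of `A`. -/
def IsReducedSNF {ι κ : Type*} [Fintype ι] [Fintype κ] (A : Matrix ι κ ℤ)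
    {r : ℕ} (S : Matrix (Fin r) (Fin r) ℤ) : Prop :=
  r = min (Fintype.card ι) (Fintype.card κ) ∧
  ∃ (e : ι ≃ Fin (Fintype.card ι)) (f : κ ≃ Fin (Fintype.card κ))
    (B : Matrix (Fin (Fintype.card ι)) (Fin (Fintype.card κ)) ℤ),
    IsSNF (A.reindex e f) B ∧
    ∀ (a c : Fin r) (i : Fin (Fintype.card ι)) (j : Fin (Fintype.card κ)),
      (i : ℕ) = a → (j : ℕ) = c → S a c = B i j

/-- The diagonal matrix with `#(W_n)_i - #(W_n)_{i-1}` entries equal to `C(ℓ' - i, ℓ - i)`, for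
`i = 0, …, ℓ`. -/
noncomputable def diagD (n ℓ ℓ' : ℕ) : Matrix ((i : Fin (ℓ + 1)) × Fin (rankJump n i))
    ((i : Fin (ℓ + 1)) × Fin (rankJump n i)) ℤ :=
  Matrix.diagonal fun p => ((Nat.choose (ℓ' - p.1) (ℓ - p.1) : ℕ) : ℤ)

end PaddedSchubert

namespace PaddedSchubert

/-! ### Equivalence of integer matrices -/

/-! Write N for C(n,2). In the basis of padded monomials, `∇` sends `α` to `∑ α_i (α - e_i)`: it is
the sl₂ lowering operator on a tensor product of symmetric powers of the plane. Hence `∇^k / k!` is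
an integer matrix with entries `∏ C(α_i, γ_i)` (`lowering`), which explains the global factorial.
Complementation `α ↦ ρ - α` turns `Δ` into `∇`. In each degree the Schubert polynomials form a
ℤ-basis of the lattice of monomials bounded by the staircase (`exists_inverse_schubertMatrix`):
their coefficients are integers, and constant terms of iterated divided differences are integral
dual functionals. So the passage to the padded Schubert basis is unimodular and does not affect
Smith forms (`exists_matrix_paddedSchubert`).

It remains to find the Smith form of `lowering`. The functionals `α ↦ ∏ C(α_i, γ_i)` satisfy `∑_β
C(β,γ) C(α,β) = C(e-|γ|, d-|γ|) C(α,γ)` for `α` of degree e and `β` running over degree d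
(`sum_binomProd_mul_binomProd`), so each γ behaves like one sl₂ string, from degree `|γ|` to degree
`N - |γ|`. Letting γ run over the ballot vectors, which encode an iterated Clebsch–Gordan rule,
selects as many functionals as there are monomials of degree d (`card_lowBallot`). These functionals
have no common kernel over any commutative ring (`eq_zero_of_sum_binomProd`); applied modulo every
prime, this makes their matrix unimodular. When `d ≤ e` and `d + e ≤ N`, the ballot vectors active
in degree d are also active in degree e, and `lowering` becomes a diagonal matrix of binomial
coefficients followed by zero columns (`unimodEquiv_lowering`). Counting ballot vectors by `|γ|`
gives the rank jumps.

For the complementary pair of degrees, the Vandermonde signs define a pairing between degrees d and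
N - d. It is unimodular by a Pieri-type recursion (`eq_zero_of_sum_expSign`), and `∇` is
skew-adjoint for it because the functional `x^μ ↦ expSign μ` kills `∑ ∂_i x^μ` when all `μ_i < n`
(`sum_mul_expSign_update`). Lowering between the two top degrees is therefore equivalent to the
transpose of lowering between the two bottom ones, and a diagonal Smith form is its own transpose.
-/

/-- `A` and `B` have mutually inverse integer matrices on both sides relating them. -/
def UnimodEquiv {ι κ ι' κ' : Type*} [Fintype ι] [Fintype κ] [Fintype ι'] [Fintype κ']
    [DecidableEq ι] [DecidableEq κ] [DecidableEq ι'] [DecidableEq κ']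
    (A : Matrix ι κ ℤ) (B : Matrix ι' κ' ℤ) : Prop :=
  ∃ (P : Matrix ι' ι ℤ) (P' : Matrix ι ι' ℤ) (Q : Matrix κ κ' ℤ) (Q' : Matrix κ' κ ℤ),
    P * P' = 1 ∧ P' * P = 1 ∧ Q * Q' = 1 ∧ Q' * Q = 1 ∧ B = P * A * Q

section UnimodEquiv

variable {ι κ ι' κ' ι'' κ'' μ ν μ' ν' : Type*} [Fintype ι] [Fintype κ] [Fintype ι'] [Fintype κ']
  [Fintype ι''] [Fintype κ''] [Fintype μ] [Fintype ν] [Fintype μ'] [Fintype ν']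
  [DecidableEq ι] [DecidableEq κ] [DecidableEq ι'] [DecidableEq κ']
  [DecidableEq ι''] [DecidableEq κ''] [DecidableEq μ] [DecidableEq ν] [DecidableEq μ']
  [DecidableEq ν']

theorem UnimodEquiv.refl (A : Matrix ι κ ℤ) : UnimodEquiv A A :=
  ⟨1, 1, 1, 1, by simp⟩

theorem UnimodEquiv.symm {A : Matrix ι κ ℤ} {B : Matrix ι' κ' ℤ} (h : UnimodEquiv A B) :
    UnimodEquiv B A := by
  obtain ⟨P, P', Q, Q', h1, h2, h3, h4, rfl⟩ := h
  refine ⟨P', P, Q', Q, h2, h1, h4, h3, ?_⟩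
  calc A = (P' * P) * A * (Q * Q') := by rw [h2, h3]; simp
    _ = _ := by simp only [Matrix.mul_assoc]

theorem UnimodEquiv.trans {A : Matrix ι κ ℤ} {B : Matrix ι' κ' ℤ} {C : Matrix ι'' κ'' ℤ}
    (h : UnimodEquiv A B) (h' : UnimodEquiv B C) : UnimodEquiv A C := by
  obtain ⟨P, P', Q, Q', h1, h2, h3, h4, rfl⟩ := h
  obtain ⟨R, R', S, S', k1, k2, k3, k4, rfl⟩ := h'
  refine ⟨R * P, P' * R', Q * S, S' * Q', ?_, ?_, ?_, ?_, ?_⟩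
  · rw [Matrix.mul_assoc, ← Matrix.mul_assoc P, h1, Matrix.one_mul, k1]
  · rw [Matrix.mul_assoc, ← Matrix.mul_assoc R', k2, Matrix.one_mul, h2]
  · rw [Matrix.mul_assoc, ← Matrix.mul_assoc S, k3, Matrix.one_mul, h3]
  · rw [Matrix.mul_assoc, ← Matrix.mul_assoc Q', h4, Matrix.one_mul, k4]
  · simp only [Matrix.mul_assoc]

theorem UnimodEquiv.transpose {A : Matrix ι κ ℤ} {B : Matrix ι' κ' ℤ} (h : UnimodEquiv A B) :
    UnimodEquiv A.transpose B.transpose := by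
  obtain ⟨P, P', Q, Q', h1, h2, h3, h4, rfl⟩ := h
  refine ⟨Q.transpose, Q'.transpose, P.transpose, P'.transpose, ?_, ?_, ?_, ?_, ?_⟩
  · rw [← Matrix.transpose_mul, h4, Matrix.transpose_one]
  · rw [← Matrix.transpose_mul, h3, Matrix.transpose_one]
  · rw [← Matrix.transpose_mul, h2, Matrix.transpose_one]
  · rw [← Matrix.transpose_mul, h1, Matrix.transpose_one]
  · simp only [Matrix.transpose_mul, Matrix.mul_assoc]

theorem UnimodEquiv.smul {A : Matrix ι κ ℤ} {B : Matrix ι' κ' ℤ} (c : ℤ) (h : UnimodEquiv A B) :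
    UnimodEquiv (c • A) (c • B) := by
  obtain ⟨P, P', Q, Q', h1, h2, h3, h4, rfl⟩ := h
  exact ⟨P, P', Q, Q', h1, h2, h3, h4, by simp⟩

theorem UnimodEquiv.submatrix (A : Matrix ι κ ℤ) (e : ι' ≃ ι) (f : κ' ≃ κ) :
    UnimodEquiv A (A.submatrix e f) := by
  refine ⟨(1 : Matrix ι ι ℤ).submatrix e id, (1 : Matrix ι ι ℤ).submatrix id e,
    (1 : Matrix κ κ ℤ).submatrix id f, (1 : Matrix κ κ ℤ).submatrix f id, ?_, ?_, ?_, ?_, ?_⟩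
  · rw [← Matrix.submatrix_mul _ _ _ _ _ Function.bijective_id]; simp
  · rw [← Matrix.submatrix_mul _ _ _ _ _ e.bijective]; simp
  · rw [← Matrix.submatrix_mul _ _ _ _ _ f.bijective]; simp
  · rw [← Matrix.submatrix_mul _ _ _ _ _ Function.bijective_id]; simp
  · have h : A = A.submatrix id id := by simp
    conv_rhs => rw [h]
    rw [← Matrix.submatrix_mul _ _ _ _ _ Function.bijective_id,
      ← Matrix.submatrix_mul _ _ _ _ _ Function.bijective_id]
    simp

theorem UnimodEquiv.fromBlocks {A : Matrix ι κ ℤ} {B : Matrix ι' κ' ℤ} {A' : Matrix μ ν ℤ}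
    {B' : Matrix μ' ν' ℤ} (h : UnimodEquiv A B) (h' : UnimodEquiv A' B') :
    UnimodEquiv (Matrix.fromBlocks A 0 0 A') (Matrix.fromBlocks B 0 0 B') := by
  obtain ⟨P, P', Q, Q', h1, h2, h3, h4, rfl⟩ := h
  obtain ⟨R, R', S, S', k1, k2, k3, k4, rfl⟩ := h'
  refine ⟨Matrix.fromBlocks P 0 0 R, Matrix.fromBlocks P' 0 0 R', Matrix.fromBlocks Q 0 0 S,
    Matrix.fromBlocks Q' 0 0 S', ?_, ?_, ?_, ?_, ?_⟩ <;>
  simp [Matrix.fromBlocks_multiply, *]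

theorem UnimodEquiv.fromCols_zero {A : Matrix ι κ ℤ} {B : Matrix ι' κ' ℤ} (h : UnimodEquiv A B) :
    UnimodEquiv (Matrix.fromCols A (0 : Matrix ι μ ℤ)) (Matrix.fromCols B (0 : Matrix ι' μ ℤ)) := by
  obtain ⟨P, P', Q, Q', h1, h2, h3, h4, rfl⟩ := h
  refine ⟨P, P', Matrix.fromBlocks Q 0 0 1, Matrix.fromBlocks Q' 0 0 1, h1, h2, ?_, ?_, ?_⟩
  · simp [Matrix.fromBlocks_multiply, *]
  · simp [Matrix.fromBlocks_multiply, *]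
  · simp [Matrix.mul_fromCols, Matrix.fromCols_mul_fromBlocks]

theorem UnimodEquiv.card_left {A : Matrix ι κ ℤ} {B : Matrix ι' κ' ℤ} (h : UnimodEquiv A B) :
    Fintype.card ι = Fintype.card ι' := by
  obtain ⟨P, P', Q, Q', h1, h2, h3, h4, rfl⟩ := h
  exact Matrix.square_of_invertible P' P h2 h1

theorem UnimodEquiv.card_right {A : Matrix ι κ ℤ} {B : Matrix ι' κ' ℤ} (h : UnimodEquiv A B) :
    Fintype.card κ = Fintype.card κ' :=
  h.transpose.card_left

/-- Each entry of an equivalent matrix is an integer combination of the original entries, so common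
divisors of the entries are invariants. -/
theorem UnimodEquiv.dvd {A : Matrix ι κ ℤ} {B : Matrix ι' κ' ℤ} (h : UnimodEquiv A B) {g : ℤ}
    (hg : ∀ i j, g ∣ A i j) (i : ι') (j : κ') : g ∣ B i j := by
  obtain ⟨P, P', Q, Q', h1, h2, h3, h4, rfl⟩ := h
  rw [Matrix.mul_apply]
  refine Finset.dvd_sum fun k _ => Dvd.dvd.mul_right ?_ _
  rw [Matrix.mul_apply]
  exact Finset.dvd_sum fun k _ => (hg _ _).mul_left _

/-! ### Smith normal forms of diagonal matrices -/

theorem UnimodEquiv.diagonal_comp (d : ι → ℤ) (e : ι' ≃ ι) :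
    UnimodEquiv (Matrix.diagonal d) (Matrix.diagonal (d ∘ e)) := by
  have := UnimodEquiv.submatrix (Matrix.diagonal d) e e
  rwa [Matrix.submatrix_diagonal_equiv] at this

/-- Bézout: with `a = g x`, `b = g y` and `x u + y v = 1`, the lcm is `g x y` and the required
matrices have determinant one. The case `g = 0` is separate because it does not allow cancelling
`g`. -/
theorem unimodEquiv_diagonal_gcd (a b : ℕ) :
    UnimodEquiv (Matrix.diagonal ![(a : ℤ), (b : ℤ)])
      (Matrix.diagonal ![((a.gcd b : ℕ) : ℤ), ((a.lcm b : ℕ) : ℤ)]) := by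
  rcases Nat.eq_zero_or_pos (a.gcd b) with h0 | hpos
  · obtain ⟨rfl, rfl⟩ := Nat.gcd_eq_zero_iff.1 h0
    exact UnimodEquiv.refl _
  · obtain ⟨x, hx⟩ := a.gcd_dvd_left b
    obtain ⟨y, hy⟩ := a.gcd_dvd_right b
    have hbez := Nat.gcd_eq_gcd_ab a b
    have hl := Nat.gcd_mul_lcm a b
    set g := a.gcd b
    set u := a.gcdA b
    set v := a.gcdB b
    have hx' : (a : ℤ) = g * x := by exact_mod_cast hx
    have hy' : (b : ℤ) = g * y := by exact_mod_cast hy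
    have hg0 : (g : ℤ) ≠ 0 := by exact_mod_cast hpos.ne'
    have hl' : ((a.lcm b : ℕ) : ℤ) = g * x * y := by
      apply mul_left_cancel₀ hg0
      have : (g : ℤ) * (a.lcm b : ℕ) = a * b := by exact_mod_cast hl
      rw [this, hx', hy']; ring
    have hone : (x : ℤ) * u + y * v = 1 := by
      apply mul_left_cancel₀ hg0
      rw [hx', hy'] at hbez
      linear_combination -hbez
    rw [hl', hx', hy', Matrix.diagonal_fin_two, Matrix.diagonal_fin_two]
    refine ⟨!![u, v; -y, x], !![(x : ℤ), -v; y, u], !![1, -v * y; 1, u * x],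
      !![u * x, v * y; -1, 1], ?_, ?_, ?_, ?_, ?_⟩
    all_goals
      ext i j
      fin_cases i <;> fin_cases j <;>
        simp [Matrix.mul_apply, Fin.sum_univ_two] <;>
        first
        | linear_combination hone
        | linear_combination (-(g : ℤ)) * hone
        | linear_combination (-(g : ℤ) * x * y) * hone
        | ring

/-- Make the tail a divisibility chain, then replace the head and the first tail entry by their gcd
and lcm. The new head divides everything, but the tail may have lost its chain, so the induction
hypothesis is applied to it a second time. -/
theorem exists_unimodEquiv_diagonal_dvd (r : ℕ) (d : Fin r → ℕ) :
    ∃ s : Fin r → ℕ, (∀ i j : Fin r, (j : ℕ) = i + 1 → s i ∣ s j) ∧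
      UnimodEquiv (Matrix.diagonal fun i => (d i : ℤ)) (Matrix.diagonal fun i => (s i : ℤ)) := by
  have hcons : ∀ (r : ℕ) (a : ℕ) (d s : Fin r → ℕ),
      UnimodEquiv (Matrix.diagonal fun i => (d i : ℤ)) (Matrix.diagonal fun i => (s i : ℤ)) →
      UnimodEquiv (Matrix.diagonal fun i => ((Fin.cons a d : Fin (r + 1) → ℕ) i : ℤ))
        (Matrix.diagonal fun i => ((Fin.cons a s : Fin (r + 1) → ℕ) i : ℤ)) := by
    intro r a d s h
    let e : Fin r ⊕ PUnit.{1} ≃ Fin (r + 1) :=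
      (optionEquivSumPUnit (Fin r)).symm.trans (finSuccEquiv r).symm
    have key : ∀ d : Fin r → ℕ, Matrix.fromBlocks (Matrix.diagonal fun i => (d i : ℤ)) 0 0
        (Matrix.diagonal fun _ : PUnit.{1} => (a : ℤ))
        = Matrix.diagonal ((fun i => ((Fin.cons a d : Fin (r + 1) → ℕ) i : ℤ)) ∘ e) := by
      intro d
      rw [Matrix.fromBlocks_diagonal]
      congr 1
      funext i
      rcases i with i | i <;> simp [e]
    have h2 := h.fromBlocks (UnimodEquiv.refl (Matrix.diagonal fun _ : PUnit.{1} => (a : ℤ)))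
    rw [key, key] at h2
    exact ((UnimodEquiv.diagonal_comp _ e).trans h2).trans (UnimodEquiv.diagonal_comp _ e).symm
  have hgcd : ∀ (r a b : ℕ) (d : Fin r → ℕ),
      UnimodEquiv
        (Matrix.diagonal fun i => ((Fin.cons a (Fin.cons b d : Fin (r + 1) → ℕ) :
          Fin (r + 1 + 1) → ℕ) i : ℤ))
        (Matrix.diagonal fun i => ((Fin.cons (a.gcd b) (Fin.cons (a.lcm b) d : Fin (r + 1) → ℕ) :
          Fin (r + 1 + 1) → ℕ) i : ℤ)) := by
    intro r a b d
    let e : Fin 2 ⊕ Fin r ≃ Fin (r + 1 + 1) := finSumFinEquiv.trans (finCongr (by omega))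
    have key : ∀ a b : ℕ, Matrix.fromBlocks (Matrix.diagonal ![(a : ℤ), (b : ℤ)]) 0 0
        (Matrix.diagonal fun i => (d i : ℤ))
        = Matrix.diagonal ((fun i => ((Fin.cons a (Fin.cons b d : Fin (r + 1) → ℕ) :
          Fin (r + 1 + 1) → ℕ) i : ℤ)) ∘ e) := by
      intro a b
      rw [Matrix.fromBlocks_diagonal]
      congr 1
      funext i
      rcases i with i | i
      · fin_cases i
        · rfl
        · rfl
      · have : e (Sum.inr i) = i.succ.succ := by
          ext; simp [e]
        simp [this]
    have h2 := (unimodEquiv_diagonal_gcd a b).fromBlocks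
      (UnimodEquiv.refl (Matrix.diagonal fun i => (d i : ℤ)))
    rw [key, key] at h2
    exact ((UnimodEquiv.diagonal_comp _ e).trans h2).trans (UnimodEquiv.diagonal_comp _ e).symm
  induction r with
  | zero => exact ⟨d, fun i => i.elim0, UnimodEquiv.refl _⟩
  | succ r ih =>
    cases r with
    | zero => exact ⟨d, fun i j h => by omega, UnimodEquiv.refl _⟩
    | succ r =>
      obtain ⟨s, hs, h1⟩ := ih (Fin.tail d)
      have h1' := hcons _ (d 0) _ _ h1
      rw [Fin.cons_self_tail] at h1'
      have h2 := hgcd r (d 0) (s 0) (Fin.tail s)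
      rw [Fin.cons_self_tail] at h2
      obtain ⟨t, ht, h3⟩ := ih (Fin.cons ((d 0).lcm (s 0)) (Fin.tail s))
      have hs0 : ∀ k (hk : k < r + 1), s 0 ∣ s ⟨k, hk⟩ := by
        intro k
        induction k with
        | zero => intro _; exact dvd_rfl
        | succ k ihk => intro hk; exact (ihk (by omega)).trans (hs _ _ rfl)
      -- The new head divides every entry of the tail before it is diagonalized again, and this
      -- property is invariant under unimodular equivalence.
      have hg : ∀ j, (d 0).gcd (s 0) ∣ t j := by
        intro j
        have := h3.dvd (g := (((d 0).gcd (s 0) : ℕ) : ℤ)) (by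
          intro i j
          rw [Matrix.diagonal_apply]
          split_ifs with hij
          · rw [Int.natCast_dvd_natCast]
            refine Fin.cases ?_ (fun k => ?_) i
            · exact (Nat.gcd_dvd_left _ _).trans (Nat.dvd_lcm_left _ _)
            · exact (Nat.gcd_dvd_right _ _).trans (hs0 _ _)
          · exact dvd_zero _) j j
        rwa [Matrix.diagonal_apply_eq, Int.natCast_dvd_natCast] at this
      refine ⟨Fin.cons ((d 0).gcd (s 0)) t, ?_, (h1'.trans h2).trans (hcons _ _ _ _ h3)⟩
      intro i j hij
      cases j using Fin.cases with
      | zero => simp at hij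
      | succ j =>
        cases i using Fin.cases with
        | zero => simpa using hg j
        | succ i => simpa using ht i j (by simpa using hij)

/-! ### Reduced Smith normal forms -/

/-- The sizes are variables tied to the cardinalities by equations, so that an index type such as
`Fin (card ι + card μ)` can be used without casts. -/
theorem isReducedSNF_of_unimodEquiv_rect {A : Matrix ι κ ℤ} {a b : ℕ}
    (ha : Fintype.card ι = a) (hb : Fintype.card κ = b) {B : Matrix (Fin a) (Fin b) ℤ}
    (h0 : ∀ (i : Fin a) (j : Fin b), (i : ℕ) ≠ j → B i j = 0)
    (h1 : ∀ (i : Fin a) (j : Fin b), (i : ℕ) = j → 0 ≤ B i j)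
    (h2 : ∀ (i : Fin a) (j : Fin b) (i' : Fin a) (j' : Fin b), (i : ℕ) = j →
      (i' : ℕ) = j' → (i' : ℕ) = i + 1 → B i j ∣ B i' j')
    (h : UnimodEquiv A B) {r : ℕ} (hr : r = min a b) {S : Matrix (Fin r) (Fin r) ℤ}
    (hS : ∀ (a' c : Fin r) (i : Fin a) (j : Fin b), (i : ℕ) = a' → (j : ℕ) = c → S a' c = B i j) :
    IsReducedSNF A S := by
  subst ha hb
  refine ⟨hr, Fintype.equivFin ι, Fintype.equivFin κ, B, ⟨h0, h1, h2, ?_⟩, hS⟩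
  have h3 := (UnimodEquiv.submatrix A (Fintype.equivFin ι).symm (Fintype.equivFin κ).symm).symm.trans
    h
  obtain ⟨P, P', Q, Q', e1, e2, e3, e4, e5⟩ := h3
  exact ⟨⟨P, P', e1, e2⟩, ⟨Q, Q', e3, e4⟩, e5⟩

/-- Mutually inverse integer matrices force equal index cardinalities, so the same normal form `B`
serves for both matrices. -/
theorem IsReducedSNF.unimodEquiv {A : Matrix ι κ ℤ} {r : ℕ} {S : Matrix (Fin r) (Fin r) ℤ}
    (h : IsReducedSNF A S) {A' : Matrix ι' κ' ℤ} (hA : UnimodEquiv A A') : IsReducedSNF A' S := by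
  obtain ⟨hr, e, f, B, ⟨h0, h1, h2, P, Q, hB⟩, hS⟩ := h
  refine isReducedSNF_of_unimodEquiv_rect hA.card_left.symm hA.card_right.symm h0 h1 h2 ?_ hr hS
  refine (hA.symm.trans (UnimodEquiv.submatrix A e.symm f.symm)).trans ?_
  exact ⟨P.1, P.2, Q.1, Q.2, P.3, P.4, Q.3, Q.4, hB⟩

theorem IsReducedSNF.smul {A : Matrix ι κ ℤ} {r : ℕ} {S : Matrix (Fin r) (Fin r) ℤ}
    (h : IsReducedSNF A S) {c : ℤ} (hc : 0 ≤ c) : IsReducedSNF (c • A) (c • S) := by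
  obtain ⟨hr, e, f, B, ⟨h0, h1, h2, P, Q, hB⟩, hS⟩ := h
  refine ⟨hr, e, f, c • B, ⟨?_, ?_, ?_, P, Q, ?_⟩, ?_⟩
  · intro i j hij
    simp [h0 i j hij]
  · intro i j hij
    exact mul_nonneg hc (h1 i j hij)
  · intro i j i' j' e1 e2 e3
    exact mul_dvd_mul_left c (h2 i j i' j' e1 e2 e3)
  · rw [hB]
    have : (c • A).reindex e f = c • A.reindex e f := rfl
    rw [this]
    simp
  · intro a c' i j e1 e2
    simp [hS a c' i j e1 e2]

theorem IsReducedSNF.transpose {A : Matrix ι κ ℤ} {r : ℕ} {S : Matrix (Fin r) (Fin r) ℤ}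
    (h : IsReducedSNF A S) : IsReducedSNF A.transpose S.transpose := by
  obtain ⟨hr, e, f, B, ⟨h0, h1, h2, P, Q, hB⟩, hS⟩ := h
  refine isReducedSNF_of_unimodEquiv_rect rfl rfl (B := B.transpose) (fun i j hij => h0 j i hij.symm)
    (fun i j hij => h1 j i hij.symm) ?_ ?_ (by rw [hr, min_comm])
    (fun a c i j e1 e2 => hS c a j i e2 e1)
  · intro i j i' j' e1 e2 e3
    exact h2 j i j' i' e1.symm e2.symm (by omega)
  · apply UnimodEquiv.transpose
    exact (UnimodEquiv.submatrix A e.symm f.symm).trans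
      ⟨P.1, P.2, Q.1, Q.2, P.3, P.4, Q.3, Q.4, hB⟩

/-- A diagonal matrix with natural entries has a reduced Smith normal form, also shared by its
extensions by zero columns. -/
theorem exists_isReducedSNF_diagonal (d : ι → ℕ) :
    ∃ S : Matrix (Fin (Fintype.card ι)) (Fin (Fintype.card ι)) ℤ, S.transpose = S ∧
      IsReducedSNF (Matrix.diagonal fun i => (d i : ℤ)) S ∧
      IsReducedSNF (Matrix.fromCols (Matrix.diagonal fun i => (d i : ℤ)) (0 : Matrix ι μ ℤ)) S := by
  obtain ⟨s, hs, h⟩ := exists_unimodEquiv_diagonal_dvd _ (d ∘ (Fintype.equivFin ι).symm)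
  have h' := (UnimodEquiv.diagonal_comp (fun i => (d i : ℤ)) (Fintype.equivFin ι).symm).trans h
  refine ⟨Matrix.diagonal fun i => (s i : ℤ), Matrix.diagonal_transpose _, ?_, ?_⟩
  · refine isReducedSNF_of_unimodEquiv_rect rfl rfl ?_ ?_ ?_ h' (min_self _).symm ?_
    · intro i j hij
      exact Matrix.diagonal_apply_ne _ fun e => hij (congrArg Fin.val e)
    · intro i j hij
      rw [Fin.ext hij, Matrix.diagonal_apply_eq]
      exact Int.natCast_nonneg _
    · intro i j i' j' e1 e2 e3
      rw [← Fin.ext e1, ← Fin.ext e2, Matrix.diagonal_apply_eq, Matrix.diagonal_apply_eq,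
        Int.natCast_dvd_natCast]
      exact hs _ _ e3
    · intro a c i j e1 e2
      rw [Fin.ext e1, Fin.ext e2]
  -- The equivalence `g` lists the diagonal columns first and the zero columns after them, as a
  -- rectangular Smith form requires.
  · let g : Fin (Fintype.card ι + Fintype.card μ) ≃ Fin (Fintype.card ι) ⊕ μ :=
      finSumFinEquiv.symm.trans (Equiv.sumCongr (Equiv.refl _) (Fintype.equivFin μ).symm)
    have hg : ∀ (j : Fin (Fintype.card ι + Fintype.card μ)),
        (∃ k : Fin (Fintype.card ι), (k : ℕ) = j ∧ g j = Sum.inl k) ∨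
        (Fintype.card ι ≤ (j : ℕ) ∧ ∃ k, g j = Sum.inr k) := by
      intro j
      refine Fin.addCases (fun k => ?_) (fun k => ?_) j
      · left
        exact ⟨k, by simp, by simp [g]⟩
      · right
        exact ⟨by simp, (Fintype.equivFin μ).symm k, by simp [g]⟩
    have h2 := (UnimodEquiv.fromCols_zero (μ := μ) h').trans
      (UnimodEquiv.submatrix _ (Equiv.refl _) g)
    have hval : ∀ (i : Fin (Fintype.card ι)) (j : Fin (Fintype.card ι + Fintype.card μ)),
        (Matrix.fromCols (Matrix.diagonal fun i => (s i : ℤ))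
          (0 : Matrix (Fin (Fintype.card ι)) μ ℤ)).submatrix (Equiv.refl _) g i j
          = if (i : ℕ) = j then (s i : ℤ) else 0 := by
      intro i j
      rw [Matrix.submatrix_apply]
      rcases hg j with ⟨k, hk, hk'⟩ | ⟨hk, k, hk'⟩
      · rw [hk', Matrix.fromCols_apply_inl, Equiv.refl_apply, Matrix.diagonal_apply]
        simp [Fin.ext_iff, hk]
      · rw [hk', Matrix.fromCols_apply_inr, if_neg (by omega)]
        rfl
    refine isReducedSNF_of_unimodEquiv_rect rfl (by simp) ?_ ?_ ?_ h2 (by simp) ?_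
    · intro i j hij
      rw [hval, if_neg hij]
    · intro i j hij
      rw [hval, if_pos hij]
      exact Int.natCast_nonneg _
    · intro i j i' j' e1 e2 e3
      rw [hval, hval, if_pos e1, if_pos e2, Int.natCast_dvd_natCast]
      exact hs _ _ e3
    · intro a c i j e1 e2
      rw [hval, Matrix.diagonal_apply]
      rw [e2, Fin.ext e1]
      simp [Fin.ext_iff]

/-! ### Unimodular matrices -/

/-- A determinant that is not a unit of ℤ has a prime divisor `p` (every prime, if it is zero), and
modulo `p` the matrix then has a nonzero kernel vector. This reduces unimodularity to injectivity
over fields. -/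
theorem exists_inverse_of_forall_zmod {A : Matrix ι κ ℤ} (hc : Fintype.card ι = Fintype.card κ)
    (hA : ∀ p : ℕ, p.Prime → ∀ v : κ → ZMod p,
      (∀ i, ∑ j, (A i j : ZMod p) * v j = 0) → v = 0) :
    ∃ B : Matrix κ ι ℤ, A * B = 1 ∧ B * A = 1 := by
  obtain ⟨e⟩ := Fintype.card_eq.1 hc
  have hu : IsUnit (A.submatrix e.symm id).det := by
    rw [Int.isUnit_iff_natAbs_eq]
    by_contra hne
    obtain ⟨p, hp, hdvd⟩ := Nat.exists_prime_and_dvd hne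
    have := Fact.mk hp
    have h0 : ((A.submatrix e.symm id).map (Int.castRingHom (ZMod p))).det = 0 := by
      rw [← RingHom.mapMatrix_apply, ← RingHom.map_det]
      rw [eq_intCast, ZMod.intCast_zmod_eq_zero_iff_dvd]
      exact Int.natCast_dvd.2 hdvd
    obtain ⟨v, hv, hv0⟩ := Matrix.exists_mulVec_eq_zero_iff.2 h0
    apply hv
    apply hA p hp
    intro i
    have := congrFun hv0 (e i)
    simpa [Matrix.mulVec, dotProduct] using this
  have h1 := Matrix.mul_nonsing_inv _ hu
  have h2 : A * ((A.submatrix e.symm id)⁻¹).submatrix id e = 1 := by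
    have h3 := congrArg (fun M => Matrix.submatrix M e e) h1
    simp only [Matrix.submatrix_one_equiv] at h3
    rw [← h3, Matrix.submatrix_mul _ _ _ id _ Function.bijective_id]
    simp
  exact ⟨_, h2, (Matrix.mul_eq_one_comm_of_equiv e).1 h2⟩

/-- A block of an invertible matrix is invertible if all nonzero entries of its rows lie in it. -/
theorem submatrix_mul_submatrix_eq_one {A : Matrix ι κ ℤ} {B : Matrix κ ι ℤ} (h : A * B = 1)
    {e : ι' → ι} {f : κ' → κ} (he : Function.Injective e) (hf : Function.Injective f)
    (hA : ∀ i j, A (e i) j ≠ 0 → j ∈ Set.range f) :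
    A.submatrix e f * B.submatrix f e = 1 := by
  ext i i'
  have h1 := congrFun (congrFun h (e i)) (e i')
  rw [Matrix.mul_apply] at h1
  rw [Matrix.mul_apply]
  have h2 : (1 : Matrix ι ι ℤ) (e i) (e i') = (1 : Matrix ι' ι' ℤ) i i' := by
    simp [Matrix.one_apply, he.eq_iff]
  rw [← h2, ← h1]
  refine Fintype.sum_of_injective f hf _ _ (fun j hj => ?_) (fun j => rfl)
  by_contra hne
  exact hj (hA i j (left_ne_zero_of_mul hne))

end UnimodEquiv

/-! ### Boxes of exponent vectors -/

/-- The exponent vectors bounded by `m`. -/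
def box {r : ℕ} (m : Fin r → ℕ) : Finset (Fin r → ℕ) :=
  Fintype.piFinset fun i => Finset.range (m i + 1)

/-- The exponent vectors bounded by `m`, of total degree `d`. -/
def degBox {r : ℕ} (m : Fin r → ℕ) (d : ℕ) : Finset (Fin r → ℕ) :=
  (box m).filter fun α => ∑ i, α i = d

/-- The product of the binomial coefficients `C(α_i, γ_i)`. -/
def binomProd {r : ℕ} (γ α : Fin r → ℕ) : ℕ := ∏ i, (α i).choose (γ i)

theorem mem_box {r : ℕ} {m α : Fin r → ℕ} : α ∈ box m ↔ ∀ i, α i ≤ m i := by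
  simp [box]

theorem mem_degBox {r : ℕ} {m α : Fin r → ℕ} {d : ℕ} :
    α ∈ degBox m d ↔ (∀ i, α i ≤ m i) ∧ ∑ i, α i = d := by
  rw [degBox, Finset.mem_filter, mem_box]

theorem binomProd_eq_zero {r : ℕ} {γ α : Fin r → ℕ} {i : Fin r} (h : α i < γ i) :
    binomProd γ α = 0 :=
  Finset.prod_eq_zero (Finset.mem_univ i) (Nat.choose_eq_zero_of_lt h)

theorem le_of_binomProd_ne_zero {r : ℕ} {γ α : Fin r → ℕ} (h : binomProd γ α ≠ 0) : γ ≤ α := by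
  intro i
  by_contra hlt
  exact h (binomProd_eq_zero (not_le.1 hlt))

theorem binomProd_self {r : ℕ} (γ : Fin r → ℕ) : binomProd γ γ = 1 := by
  simp [binomProd]

/-- One-variable generating function: `C(a,b) C(b,g) = C(a,g) C(a-g, b-g)` followed by the binomial
theorem. -/
theorem sum_choose_mul_choose_mul_X_pow (m a g : ℕ) (ha : a ≤ m) :
    ∑ b ∈ Finset.range (m + 1), ((b.choose g * a.choose b : ℕ) : Polynomial ℕ) * Polynomial.X ^ b
      = ((a.choose g : ℕ) : Polynomial ℕ) *
        (Polynomial.X ^ g * (Polynomial.X + 1) ^ (a - g)) := by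
  rcases Nat.lt_or_ge a g with h | h
  · rw [Nat.choose_eq_zero_of_lt h, Nat.cast_zero, zero_mul]
    refine Finset.sum_eq_zero fun b _ => ?_
    rcases Nat.lt_or_ge b g with h' | h'
    · rw [Nat.choose_eq_zero_of_lt h']; simp
    · rw [Nat.choose_eq_zero_of_lt (h.trans_le h')]; simp
  · rw [add_pow, Finset.mul_sum, Finset.mul_sum]
    symm
    apply Finset.sum_of_injOn (fun c => g + c)
    · intro x _ y _ hxy
      simpa using hxy
    · intro c hc
      simp only [Finset.coe_range, Set.mem_Iio] at hc ⊢
      omega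
    · intro b hb hb'
      rcases Nat.lt_or_ge b g with h' | h'
      · rw [Nat.choose_eq_zero_of_lt h']; simp
      · rcases Nat.lt_or_ge a b with h'' | h''
        · rw [Nat.choose_eq_zero_of_lt h'']; simp
        · exact absurd ⟨b - g, by simp; omega, by simp; omega⟩ hb'
    · intro c hc
      rw [Finset.mem_range] at hc
      have h1 := Nat.choose_mul (n := a) (k := g + c) (s := g) (by omega)
      rw [mul_comm ((g + c).choose g), h1, Nat.add_sub_cancel_left]
      push_cast
      ring

/-- Composition of the divided powers of the lowering operator. -/
theorem sum_binomProd_mul_binomProd {r : ℕ} {m γ α : Fin r → ℕ} {d : ℕ} (hα : ∀ i, α i ≤ m i)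
    (hγ : ∑ i, γ i ≤ d) :
    ∑ β ∈ degBox m d, binomProd γ β * binomProd β α
      = (∑ i, α i - ∑ i, γ i).choose (d - ∑ i, γ i) * binomProd γ α := by
  -- Multiplying the one-variable identities marks the total degree of β by the exponent of `X`.
  -- Extracting the coefficient of `X^d` then restricts the sum to degree d.
  have h1 : ∑ β ∈ box m, ((binomProd γ β * binomProd β α : ℕ) : Polynomial ℕ)
        * Polynomial.X ^ (∑ i, β i)
      = ((binomProd γ α : ℕ) : Polynomial ℕ) *
        (Polynomial.X ^ (∑ i, γ i) * (Polynomial.X + 1) ^ (∑ i, (α i - γ i))) := by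
    have h2 : ∏ i, ∑ b ∈ Finset.range (m i + 1),
          ((b.choose (γ i) * (α i).choose b : ℕ) : Polynomial ℕ) * Polynomial.X ^ b
        = ∏ i, (((α i).choose (γ i) : ℕ) : Polynomial ℕ) *
        (Polynomial.X ^ (γ i) * (Polynomial.X + 1) ^ (α i - γ i)) :=
      Finset.prod_congr rfl fun i _ => sum_choose_mul_choose_mul_X_pow _ _ _ (hα i)
    rw [Finset.prod_univ_sum] at h2
    rw [box, binomProd, Nat.cast_prod, ← Finset.prod_pow_eq_pow_sum, ← Finset.prod_pow_eq_pow_sum,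
      ← Finset.prod_mul_distrib, ← Finset.prod_mul_distrib, ← h2]
    refine Finset.sum_congr rfl fun β _ => ?_
    rw [binomProd, binomProd, ← Finset.prod_mul_distrib, Nat.cast_prod,
      ← Finset.prod_pow_eq_pow_sum, ← Finset.prod_mul_distrib]
  have h3 := congrArg (fun p => Polynomial.coeff p d) h1
  simp only [Polynomial.finsetSum_coeff, Polynomial.coeff_natCast_mul, Polynomial.coeff_X_pow]
    at h3
  simp only [mul_ite, mul_one, mul_zero, Nat.cast_id] at h3
  rw [degBox, Finset.sum_filter]
  simp only [eq_comm (a := d)] at h3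
  rw [h3]
  obtain ⟨e, rfl⟩ := Nat.exists_eq_add_of_le hγ
  rw [add_comm (∑ i, γ i) e, Polynomial.coeff_X_pow_mul, Polynomial.coeff_X_add_one_pow,
    Nat.add_sub_cancel, mul_comm]
  -- The exponents `α i - γ i` are truncated differences; they add up to the difference of the
  -- degrees only when `γ ≤ α`, and otherwise both sides vanish.
  by_cases h0 : binomProd γ α = 0
  · simp [h0]
  · have hle := le_of_binomProd_ne_zero h0
    have : ∑ i, (α i - γ i) = ∑ i, α i - ∑ i, γ i :=
      Finset.sum_tsub_distrib _ fun i _ => hle i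
    rw [this]
    simp

theorem cons_mem_box {r : ℕ} {m : Fin (r + 1) → ℕ} {q : ℕ} {α : Fin r → ℕ} :
    (Fin.cons q α : Fin (r + 1) → ℕ) ∈ box m ↔ q ≤ m 0 ∧ α ∈ box (Fin.tail m) := by
  simp only [mem_box, Fin.forall_fin_succ, Fin.cons_zero, Fin.cons_succ, Fin.tail]

theorem sum_box_succ {M : Type*} [AddCommMonoid M] {r : ℕ} (m : Fin (r + 1) → ℕ)
    (F : (Fin (r + 1) → ℕ) → M) :
    ∑ α ∈ box m, F α = ∑ q ∈ Finset.range (m 0 + 1), ∑ α ∈ box (Fin.tail m), F (Fin.cons q α) := by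
  rw [← Finset.sum_product']
  symm
  refine Finset.sum_bij' (fun x _ => (Fin.cons x.1 x.2 : Fin (r + 1) → ℕ))
    (fun α _ => (α 0, Fin.tail α)) ?_ ?_ ?_ ?_ ?_
  · rintro ⟨q, α⟩ h
    simp only [Finset.mem_product, Finset.mem_range, Nat.lt_succ_iff] at h
    exact cons_mem_box.2 h
  · intro α h
    rw [← Fin.cons_self_tail α, cons_mem_box] at h
    simpa [Nat.lt_succ_iff] using h
  · rintro ⟨q, α⟩ h
    simp
  · intro α h
    simp
  · rintro ⟨q, α⟩ h
    rfl

theorem sum_degBox_succ {M : Type*} [AddCommMonoid M] {r : ℕ} (m : Fin (r + 1) → ℕ) (d : ℕ)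
    (F : (Fin (r + 1) → ℕ) → M) :
    ∑ α ∈ degBox m d, F α = ∑ q ∈ Finset.range (m 0 + 1),
      if q ≤ d then ∑ α ∈ degBox (Fin.tail m) (d - q), F (Fin.cons q α) else 0 := by
  rw [degBox, Finset.sum_filter, sum_box_succ]
  refine Finset.sum_congr rfl fun q _ => ?_
  split_ifs with h
  · rw [degBox, Finset.sum_filter]
    refine Finset.sum_congr rfl fun α _ => ?_
    have : (∑ i, (Fin.cons q α : Fin (r + 1) → ℕ) i = d) ↔ ∑ i, α i = d - q := by
      rw [Fin.sum_cons]; omega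
    simp only [this]
  · refine Finset.sum_eq_zero fun α _ => ?_
    rw [if_neg]
    rw [Fin.sum_cons]; omega

/-! ### Ballot vectors -/

/-- The exponent vectors that index the sections of the filtration of a tensor product of
symmetric powers of the plane. -/
def Ballot : (r : ℕ) → (Fin r → ℕ) → (Fin r → ℕ) → Prop
  | 0, _, _ => True
  | r + 1, m, γ => Ballot r (Fin.tail m) (Fin.tail γ) ∧ γ 0 ≤ m 0 ∧
      2 * ∑ i, Fin.tail γ i + γ 0 ≤ ∑ i, Fin.tail m i

open Classical in
/-- The ballot vectors of the sections that are nonzero in degree `d`. -/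
noncomputable def lowBallot {r : ℕ} (m : Fin r → ℕ) (d : ℕ) : Finset (Fin r → ℕ) :=
  (box m).filter fun γ => Ballot r m γ ∧ ∑ i, γ i ≤ d ∧ ∑ i, γ i + d ≤ ∑ i, m i

theorem Ballot.mem_box {r : ℕ} {m γ : Fin r → ℕ} (h : Ballot r m γ) : γ ∈ box m := by
  induction r with
  | zero => exact PaddedSchubert.mem_box.2 fun i => i.elim0
  | succ r ih =>
    rw [← Fin.cons_self_tail γ, cons_mem_box]
    exact ⟨h.2.1, ih h.1⟩

theorem mem_lowBallot {r : ℕ} {m γ : Fin r → ℕ} {d : ℕ} :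
    γ ∈ lowBallot m d ↔ Ballot r m γ ∧ ∑ i, γ i ≤ d ∧ ∑ i, γ i + d ≤ ∑ i, m i := by
  classical
  rw [lowBallot, Finset.mem_filter]
  exact ⟨fun h => h.2, fun h => ⟨h.1.mem_box, h⟩⟩

/-- The string attached to γ occupies the degrees from `|γ|` to `N - |γ|`, N being the total of `m`;
this says that the interval is not empty. -/
theorem Ballot.two_mul_sum_le {r : ℕ} {m γ : Fin r → ℕ} (h : Ballot r m γ) :
    2 * ∑ i, γ i ≤ ∑ i, m i := by
  cases r with
  | zero => simp
  | succ r =>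
    have h2 := h.2
    rw [Fin.sum_univ_succ, Fin.sum_univ_succ m]
    simp only [Fin.tail] at h2
    omega

/-- Clebsch–Gordan at the level of counting. Fix a ballot vector of the tail: both sides count
points of degree d, on one side in the product of its string with the string of length `m 0`, on the
other side in the strings into which that product decomposes. -/
theorem card_lowBallot {r : ℕ} (m : Fin r → ℕ) (d : ℕ) :
    (lowBallot m d).card = (degBox m d).card := by
  classical
  induction r generalizing d with
  | zero =>
    congr 1
    ext γ
    rw [mem_lowBallot, mem_degBox]
    simp [Ballot, eq_comm]
  | succ r ih =>
    have e1 : (degBox m d).card = ∑ γ ∈ box (Fin.tail m), if Ballot r (Fin.tail m) γ then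
        ((Finset.range (m 0 + 1)).filter fun q => q + ∑ i, γ i ≤ d ∧
          ∑ i, γ i + d ≤ ∑ i, Fin.tail m i + q).card else 0 := by
      rw [Finset.card_eq_sum_ones, sum_degBox_succ]
      have : ∀ q ∈ Finset.range (m 0 + 1),
          (if q ≤ d then ∑ α ∈ degBox (Fin.tail m) (d - q), 1 else 0)
          = ∑ γ ∈ box (Fin.tail m), if Ballot r (Fin.tail m) γ then
            (if q + ∑ i, γ i ≤ d ∧ ∑ i, γ i + d ≤ ∑ i, Fin.tail m i + q then 1 else 0) else 0 := by
        intro q _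
        split_ifs with hq
        · rw [← Finset.card_eq_sum_ones, ← ih, lowBallot, Finset.card_filter]
          refine Finset.sum_congr rfl fun γ _ => ?_
          rw [← ite_and]
          refine if_congr (and_congr_right fun _ => ?_) rfl rfl
          omega
        · symm
          refine Finset.sum_eq_zero fun γ _ => ?_
          rw [← ite_and, if_neg]
          rintro ⟨_, h, _⟩
          omega
      rw [Finset.sum_congr rfl this, Finset.sum_comm]
      refine Finset.sum_congr rfl fun γ _ => ?_
      split_ifs
      · rw [Finset.card_filter]
      · simp
    have e2 : (lowBallot m d).card = ∑ γ ∈ box (Fin.tail m), if Ballot r (Fin.tail m) γ then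
        ((Finset.range (m 0 + 1)).filter fun q => 2 * ∑ i, γ i + q ≤ ∑ i, Fin.tail m i ∧
          q + ∑ i, γ i ≤ d ∧ q + ∑ i, γ i + d ≤ m 0 + ∑ i, Fin.tail m i).card else 0 := by
      rw [lowBallot, Finset.card_filter, sum_box_succ, Finset.sum_comm]
      refine Finset.sum_congr rfl fun γ _ => ?_
      split_ifs with hb
      · rw [Finset.card_filter]
        refine Finset.sum_congr rfl fun q hq => ?_
        refine if_congr ?_ rfl rfl
        rw [Fin.sum_cons, Fin.sum_univ_succ m]
        simp only [Ballot, Fin.tail_cons, Fin.cons_zero, hb, true_and]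
        rw [Finset.mem_range] at hq
        simp only [Fin.tail]
        constructor
        · rintro ⟨⟨_, h1⟩, h2, h3⟩
          exact ⟨h1, h2, h3⟩
        · rintro ⟨h1, h2, h3⟩
          exact ⟨⟨by omega, h1⟩, h2, h3⟩
      · refine Finset.sum_eq_zero fun q _ => ?_
        rw [if_neg]
        rintro ⟨h, _⟩
        exact hb (by simpa using h.1)
    rw [e1, e2]
    refine Finset.sum_congr rfl fun γ _ => ?_
    split_ifs with hb
    · have hb2 := hb.two_mul_sum_le
      generalize ∑ i, γ i = s at *
      generalize ∑ i, Fin.tail m i = N at *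
      -- The exponents `q` compatible with the tail form an interval that starts at the truncated
      -- difference `s + d - N`, while the admissible first ballot entries start at zero. Shifting
      -- by this number matches the two intervals.
      refine Finset.card_bij' (fun q _ => q + (s + d - N)) (fun q _ => q - (s + d - N)) ?_ ?_ ?_ ?_
      all_goals
        intro q hq
        simp only [Finset.mem_filter, Finset.mem_range] at hq ⊢
        omega
    · rfl

/-- The square matrix `C(A + q, j)` is invertible over every ring. Since `C(A+q, j+1)` is a constant
plus `∑_{k<q} C(A+k, j)`, the tail sums of `u` solve the same system of size one less; their
successive differences give back `u`. -/
theorem eq_zero_of_sum_choose_mul {R : Type*} [CommRing R] (A d : ℕ) (u : ℕ → R)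
    (h : ∀ j ≤ d, ∑ q ∈ Finset.range (d + 1), ((A + q).choose j : R) * u q = 0) :
    ∀ q ≤ d, u q = 0 := by
  induction d generalizing u with
  | zero =>
    intro q hq
    obtain rfl : q = 0 := by omega
    simpa using h 0 le_rfl
  | succ d ih =>
    -- summation by parts
    have h0 : ∑ q ∈ Finset.range (d + 1 + 1), u q = 0 := by simpa using h 0 (by omega)
    have hs := ih (fun q => ∑ k ∈ Finset.Ico (q + 1) (d + 1 + 1), u k) (by
      intro j hj
      have h1 := h (j + 1) (by omega)
      have h2 : ∀ q, ((A + q).choose (j + 1) : R)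
          = (A.choose (j + 1) : R) + ∑ k ∈ Finset.range q, ((A + k).choose j : R) := by
        intro q
        induction q with
        | zero => simp
        | succ q ihq =>
          rw [Finset.sum_range_succ, ← add_assoc (A.choose (j + 1) : R), ← ihq, ← add_assoc,
            Nat.choose_succ_succ]
          push_cast
          ring
      simp only [h2, add_mul, Finset.sum_add_distrib, ← Finset.mul_sum, h0, mul_zero, zero_add,
        Finset.sum_mul] at h1
      rw [← h1]
      simp only [Finset.mul_sum]
      rw [Finset.sum_sigma', Finset.sum_sigma']
      refine Finset.sum_bij' (fun x _ => ⟨x.2, x.1⟩) (fun x _ => ⟨x.2, x.1⟩) ?_ ?_ ?_ ?_ ?_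
      · rintro ⟨x, y⟩ hx
        simp only [Finset.mem_sigma, Finset.mem_range, Finset.mem_Ico] at hx ⊢
        omega
      · rintro ⟨x, y⟩ hx
        simp only [Finset.mem_sigma, Finset.mem_range, Finset.mem_Ico] at hx ⊢
        omega
      · intros; rfl
      · intros; rfl
      · intros; rfl)
    have hs' : ∀ q ≤ d + 1, ∑ k ∈ Finset.Ico q (d + 1 + 1), u k = 0 := by
      intro q hq
      cases q with
      | zero => rw [← Finset.range_eq_Ico]; exact h0
      | succ q => exact hs q (by omega)
    intro q hq
    have h1 := hs' q hq
    rw [Finset.sum_eq_sum_Ico_succ_bot (by omega)] at h1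
    rcases Nat.lt_or_ge q (d + 1) with h2 | h2
    · rwa [hs' (q + 1) (by omega), add_zero] at h1
    · rwa [Finset.Ico_eq_empty (by omega), Finset.sum_empty, add_zero] at h1

theorem binomProd_cons {r : ℕ} (j q : ℕ) (γ α : Fin r → ℕ) :
    binomProd (Fin.cons j γ : Fin (r + 1) → ℕ) (Fin.cons q α : Fin (r + 1) → ℕ)
      = q.choose j * binomProd γ α := by
  simp [binomProd, Fin.prod_univ_succ]

/-- Peel off the first exponent `q`. For each ballot vector γ of the tail, the partial pairings at
fixed `q` are shown to vanish by a second induction, on `|γ|`; the induction hypothesis on `r` then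
kills `f` on each slice. No division occurs, so the argument is valid in every characteristic. -/
theorem eq_zero_of_sum_binomProd {R : Type*} [CommRing R] {r : ℕ} (m : Fin r → ℕ) (d : ℕ)
    (f : (Fin r → ℕ) → R)
    (h : ∀ γ ∈ lowBallot m d, ∑ α ∈ degBox m d, (binomProd γ α : R) * f α = 0) :
    ∀ α ∈ degBox m d, f α = 0 := by
  induction r generalizing d with
  | zero =>
    intro α hα
    have h1 := h α (by
      rw [mem_degBox] at hα
      rw [mem_lowBallot]
      simpa [Ballot, eq_comm] using hα)
    rw [Finset.sum_eq_single_of_mem α hα fun b _ hb => absurd (Subsingleton.elim _ _) hb] at h1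
    simpa [binomProd] using h1
  | succ r ih =>
    have key : ∀ (i : ℕ) (γ : Fin r → ℕ), Ballot r (Fin.tail m) γ → ∑ k, γ k = i →
        ∀ q, q ≤ m 0 → q ≤ d →
        ∑ α ∈ degBox (Fin.tail m) (d - q), (binomProd γ α : R) * f (Fin.cons q α) = 0 := by
      intro i
      induction i using Nat.strong_induction_on with
      | _ i ihi =>
        intro γ hγ hγi
        -- Outside the window in which γ is active there is nothing to solve. If `d - q < i`, all
        -- binomial products vanish. If `d - q` is too large, every ballot vector active on that
        -- slice has sum less than `i`, so the inner induction already gives `f = 0` on the whole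
        -- slice.
        have hvan : ∀ q, q ≤ m 0 → q ≤ d → (d < q + i ∨ ∑ k, Fin.tail m k + q < d + i) →
            ∑ α ∈ degBox (Fin.tail m) (d - q), (binomProd γ α : R) * f (Fin.cons q α) = 0 := by
          intro q hq hqd hor
          refine Finset.sum_eq_zero fun α hα => ?_
          rcases hor with hlt | hlt
          · have : binomProd γ α = 0 := by
              by_contra hne
              have h1 : ∑ k, γ k ≤ ∑ k, α k :=
                Finset.sum_le_sum fun k _ => le_of_binomProd_ne_zero hne k
              rw [(mem_degBox.1 hα).2] at h1
              omega
            rw [this]; simp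
          · rw [ih (Fin.tail m) (d - q) (fun α => f (Fin.cons q α)) ?_ α hα, mul_zero]
            intro γ' hγ'
            rw [mem_lowBallot] at hγ'
            exact ihi (∑ k, γ' k) (by omega) γ' hγ'.1 rfl q hq hqd
        have hγ2 := hγ.two_mul_sum_le
        intro q hq hqd
        by_cases hor : d < q + i ∨ ∑ k, Fin.tail m k + q < d + i
        · exact hvan q hq hqd hor
        · set N := ∑ k, Fin.tail m k with hN
          let u : ℕ → R := fun q =>
            ∑ α ∈ degBox (Fin.tail m) (d - q), (binomProd γ α : R) * f (Fin.cons q α)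
          -- The window for `q` is the interval from `A` to `B`. The vectors obtained by putting `j`
          -- in front of γ belong to `lowBallot m d` for all `j ≤ B - A`, which gives exactly as
          -- many equations as unknowns.
          obtain ⟨A, hA⟩ : ∃ A, A = d + i - N := ⟨_, rfl⟩
          obtain ⟨B, hB⟩ : ∃ B, B = min (m 0) (d - i) := ⟨_, rfl⟩
          have hAq : A ≤ q := by omega
          have hqB : q ≤ B := by omega
          have hsys : ∀ j ≤ B - A, ∑ k ∈ Finset.range (B - A + 1),
              ((A + k).choose j : R) * u (A + k) = 0 := by
            intro j hj
            have h1 := h (Fin.cons j γ) (by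
              rw [mem_lowBallot, Fin.sum_cons, Fin.sum_univ_succ m]
              have hm : ∑ k : Fin r, m k.succ = N := rfl
              rw [hm]
              refine ⟨⟨by simpa using hγ, ?_, ?_⟩, ?_, ?_⟩
              · rw [Fin.cons_zero]; omega
              · rw [Fin.cons_zero, Fin.tail_cons]; omega
              · omega
              · omega)
            rw [sum_degBox_succ] at h1
            rw [← h1]
            -- Only the exponents `q = A + k` inside the window contribute to the hypothesis for
            -- `Fin.cons j γ`; the remaining ones are removed by `hvan`.
            apply Finset.sum_of_injOn (fun k => A + k)
            · intro x _ y _ hxy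
              simpa using hxy
            · intro k hk
              simp only [Finset.coe_range, Set.mem_Iio] at hk ⊢
              omega
            · intro q' hq' hq''
              rw [Finset.mem_range] at hq'
              split_ifs with hq'd
              · simp only [binomProd_cons, Nat.cast_mul, mul_assoc, ← Finset.mul_sum]
                rw [hvan q' (by omega) hq'd ?_, mul_zero]
                by_contra hcon
                exact hq'' ⟨q' - A, by simp; omega, by simp; omega⟩
              · rfl
            · intro k hk
              rw [Finset.mem_range] at hk
              rw [if_pos (by omega)]
              simp only [binomProd_cons, Nat.cast_mul, mul_assoc, ← Finset.mul_sum]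
              rfl
          have := eq_zero_of_sum_choose_mul A (B - A) (fun k => u (A + k)) hsys (q - A) (by omega)
          rwa [Nat.add_sub_cancel' hAq] at this
    intro α hα
    rw [← Fin.cons_self_tail α] at hα ⊢
    rw [mem_degBox, ← mem_box, cons_mem_box, Fin.sum_cons] at hα
    refine ih (Fin.tail m) (d - α 0) (fun β => f (Fin.cons (α 0) β)) ?_ (Fin.tail α) ?_
    · intro γ hγ
      rw [mem_lowBallot] at hγ
      exact key _ γ hγ.1 rfl (α 0) hα.1.1 (by omega)
    · rw [mem_degBox]
      exact ⟨mem_box.1 hα.1.2, by omega⟩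

/-! ### The divided powers of the lowering operator -/

/-- The matrix of a divided power of the lowering operator, from degree `e` to degree `d`. -/
def lowering {r : ℕ} (m : Fin r → ℕ) (d e : ℕ) : Matrix (degBox m d) (degBox m e) ℤ :=
  Matrix.of fun γ α => (binomProd (γ : Fin r → ℕ) α : ℤ)

/-- The pairing of ballot vectors with exponent vectors of degree `d`. -/
noncomputable def ballotPairing {r : ℕ} (m : Fin r → ℕ) (d : ℕ) :
    Matrix (lowBallot m d) (degBox m d) ℤ :=
  Matrix.of fun γ α => (binomProd (γ : Fin r → ℕ) α : ℤ)

/-- The matrix is square by the Clebsch–Gordan count and injective modulo each prime by the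
vanishing theorem, hence unimodular. -/
theorem exists_inverse_ballotPairing {r : ℕ} (m : Fin r → ℕ) (d : ℕ) :
    ∃ B : Matrix (degBox m d) (lowBallot m d) ℤ,
      ballotPairing m d * B = 1 ∧ B * ballotPairing m d = 1 := by
  apply exists_inverse_of_forall_zmod
  · rw [Fintype.card_coe, Fintype.card_coe, card_lowBallot]
  · intro p hp v hv
    have h1 := eq_zero_of_sum_binomProd m d
      (fun α => if hα : α ∈ degBox m d then v ⟨α, hα⟩ else 0) (by
        intro γ hγ
        rw [← hv ⟨γ, hγ⟩, ← Finset.sum_coe_sort]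
        refine Finset.sum_congr rfl fun α _ => ?_
        simp [ballotPairing])
    funext α
    simpa using h1 α α.2

theorem lowBallot_subset {r : ℕ} {m : Fin r → ℕ} {d e : ℕ} (h : d ≤ e) (hde : d + e ≤ ∑ i, m i) :
    lowBallot m d ⊆ lowBallot m e := by
  intro γ
  simp only [mem_lowBallot]
  rintro ⟨h1, h2, h3⟩
  exact ⟨h1, by omega, by omega⟩

/-- The functional of γ in degree d, pulled back along a divided power of the lowering operator, is
a binomial multiple of the functional of the same γ in degree e. The condition on `d + e` ensures
that γ is still active there. -/
theorem ballotPairing_mul_lowering {r : ℕ} (m : Fin r → ℕ) {d e : ℕ} (h : d ≤ e)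
    (hde : d + e ≤ ∑ i, m i) :
    ballotPairing m d * lowering m d e = (Matrix.of fun (γ : lowBallot m d) (γ' : lowBallot m e) =>
      if (γ : Fin r → ℕ) = γ' then
        (((e - ∑ i, (γ : Fin r → ℕ) i).choose (d - ∑ i, (γ : Fin r → ℕ) i) : ℕ) : ℤ) else 0)
      * ballotPairing m e := by
  ext γ α
  have hγ := mem_lowBallot.1 γ.2
  have hα := mem_degBox.1 α.2
  rw [Matrix.mul_apply, Matrix.mul_apply]
  rw [Finset.sum_eq_single (⟨γ, lowBallot_subset h hde γ.2⟩ : lowBallot m e)]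
  · have h1 := sum_binomProd_mul_binomProd (d := d) hα.1 hγ.2.1
    simp only [ballotPairing, lowering, Matrix.of_apply, if_true]
    rw [Finset.sum_coe_sort (degBox m d)
      (fun β => (binomProd (γ : Fin r → ℕ) β : ℤ) * (binomProd β (α : Fin r → ℕ) : ℤ))]
    rw [hα.2] at h1
    exact_mod_cast h1
  · intro γ' _ hne
    rw [Matrix.of_apply, if_neg, zero_mul]
    intro e'
    exact hne (Subtype.ext e'.symm)
  · intro h'
    exact absurd (Finset.mem_univ _) h'

open Classical in
/-- The lowering matrices are diagonalized by the ballot vectors. -/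
theorem unimodEquiv_lowering {r : ℕ} (m : Fin r → ℕ) {d e : ℕ} (h : d ≤ e)
    (hde : d + e ≤ ∑ i, m i) :
    UnimodEquiv (Matrix.fromCols (Matrix.diagonal fun γ : lowBallot m d =>
        (((e - ∑ i, (γ : Fin r → ℕ) i).choose (d - ∑ i, (γ : Fin r → ℕ) i) : ℕ) : ℤ))
        (0 : Matrix _ {γ : lowBallot m e // (γ : Fin r → ℕ) ∉ lowBallot m d} ℤ))
      (lowering m d e) := by
  obtain ⟨B, hB, hB'⟩ := exists_inverse_ballotPairing m d
  obtain ⟨C, hC, hC'⟩ := exists_inverse_ballotPairing m e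
  have key := ballotPairing_mul_lowering m h hde
  set D : Matrix (lowBallot m d) (lowBallot m e) ℤ :=
    (Matrix.of fun (γ : lowBallot m d) (γ' : lowBallot m e) =>
      if (γ : Fin r → ℕ) = γ' then
        (((e - ∑ i, (γ : Fin r → ℕ) i).choose (d - ∑ i, (γ : Fin r → ℕ) i) : ℕ) : ℤ) else 0) with hD
  have h1 : UnimodEquiv D (lowering m d e) := by
    refine ⟨B, ballotPairing m d, ballotPairing m e, C, hB', hB, hC, hC', ?_⟩
    rw [Matrix.mul_assoc, ← key, ← Matrix.mul_assoc, hB', Matrix.one_mul]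
  -- Reordering the ballot vectors of degree e, with those of degree d first, puts the intertwining
  -- matrix into the form of a diagonal block followed by zero columns.
  let g : lowBallot m d ⊕ {γ : lowBallot m e // (γ : Fin r → ℕ) ∉ lowBallot m d} ≃ lowBallot m e :=
    { toFun := Sum.elim (fun γ => ⟨γ, lowBallot_subset h hde γ.2⟩) (fun γ => γ.1)
      invFun := fun γ => if hγ : (γ : Fin r → ℕ) ∈ lowBallot m d then Sum.inl ⟨γ, hγ⟩ else
        Sum.inr ⟨γ, hγ⟩
      left_inv := by
        rintro (γ | γ)
        · simp
        · simp [γ.2]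
      right_inv := by
        intro γ
        by_cases hγ : (γ : Fin r → ℕ) ∈ lowBallot m d <;> simp [hγ] }
  have h2 : Matrix.fromCols (Matrix.diagonal fun γ : lowBallot m d =>
        (((e - ∑ i, (γ : Fin r → ℕ) i).choose (d - ∑ i, (γ : Fin r → ℕ) i) : ℕ) : ℤ))
        (0 : Matrix _ {γ : lowBallot m e // (γ : Fin r → ℕ) ∉ lowBallot m d} ℤ)
      = D.submatrix (Equiv.refl _) g := by
    ext γ (γ' | γ')
    · rw [Matrix.fromCols_apply_inl, Matrix.submatrix_apply, Matrix.diagonal_apply]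
      exact if_congr Subtype.ext_iff rfl rfl
    · have : (γ : Fin r → ℕ) ≠ γ' := fun e' => γ'.2 (e' ▸ γ.2)
      rw [Matrix.fromCols_apply_inr, Matrix.submatrix_apply]
      exact (if_neg this).symm
  rw [h2]
  exact (UnimodEquiv.submatrix D (Equiv.refl _) g).symm.trans h1

/-! ### The sign of an exponent vector, and the invariant pairing -/

/-- The sign of `μ` as a permutation of `0, …, n - 1`, or zero if it is not a permutation: the
coefficient of `x^μ` in the Vandermonde determinant. -/
def expSign {n : ℕ} (μ : Fin n → ℕ) : ℤ :=
  (Matrix.of fun i j : Fin n => if μ i = j then (1 : ℤ) else 0).det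

theorem expSign_eq_zero {n : ℕ} {μ : Fin n → ℕ} {a b : Fin n} (hab : a ≠ b) (h : μ a = μ b) :
    expSign μ = 0 :=
  Matrix.det_zero_of_row_eq hab (by funext j; simp [h])

theorem expSign_eq_zero_of_le {n : ℕ} {μ : Fin n → ℕ} {a : Fin n} (h : n ≤ μ a) :
    expSign μ = 0 := by
  refine Matrix.det_eq_zero_of_row_eq_zero a fun j => ?_
  rw [Matrix.of_apply, if_neg]
  omega

theorem expSign_comp_swap {n : ℕ} (μ : Fin n → ℕ) {a b : Fin n} (hab : a ≠ b) :
    expSign (μ ∘ swap a b) = -expSign μ := by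
  have h := Matrix.det_permute (swap a b)
    (Matrix.of fun i j : Fin n => if μ i = j then (1 : ℤ) else 0)
  rw [Perm.sign_swap hab] at h
  rw [expSign, expSign, ← neg_one_mul]
  exact_mod_cast h

/-- A nonzero sign means that the entries are `0, …, n-1` in some order. This makes the pairing
graded. -/
theorem sum_eq_of_expSign_ne_zero {n : ℕ} {μ : Fin n → ℕ} (h : expSign μ ≠ 0) :
    ∑ i, μ i = ∑ i : Fin n, (i : ℕ) := by
  have hlt : ∀ i, μ i < n := fun i => by
    by_contra hle
    exact h (expSign_eq_zero_of_le (not_lt.1 hle))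
  let f : Fin n → Fin n := fun i => ⟨μ i, hlt i⟩
  have hf : Function.Injective f := by
    intro a b hab
    by_contra hne
    exact h (expSign_eq_zero hne (congrArg Fin.val hab))
  exact (Finite.injective_iff_bijective.1 hf).sum_comp fun i : Fin n => (i : ℕ)

/-- Expand the determinant along its first row: the only nonzero entry is in column `a`, and
deleting that column undoes the shift of the values at least `a`. -/
theorem expSign_cons {n : ℕ} (μ : Fin n → ℕ) {a : ℕ} (ha : a ≤ n) :
    expSign (Fin.cons a (fun i => if μ i < a then μ i else μ i + 1) : Fin (n + 1) → ℕ)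
      = (-1) ^ a * expSign μ := by
  rw [expSign, Matrix.det_succ_row_zero,
    Finset.sum_eq_single (⟨a, Nat.lt_succ_of_le ha⟩ : Fin (n + 1))]
  · rw [Matrix.of_apply, Fin.cons_zero, if_pos rfl, mul_one, expSign]
    congr 2
    ext i j
    simp only [Matrix.submatrix_apply, Matrix.of_apply, Fin.cons_succ]
    refine if_congr ?_ rfl rfl
    by_cases hj : (j : ℕ) < a
    · rw [Fin.succAbove_of_castSucc_lt _ _ (by simpa [Fin.lt_def] using hj), Fin.val_castSucc]
      split_ifs <;> omega
    · rw [Fin.succAbove_of_le_castSucc _ _ (by simpa [Fin.le_def] using hj), Fin.val_succ]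
      split_ifs <;> omega
  · intro j _ hj
    rw [Matrix.of_apply, Fin.cons_zero, if_neg, mul_zero, zero_mul]
    exact fun e => hj (Fin.ext e.symm)
  · intro h
    exact absurd (Finset.mem_univ _) h

/-- A Pieri rule: adding vertical strips. -/
theorem sum_powersetCard_expSign {n : ℕ} (μ : Fin n → ℕ) (hμ : ∀ i, μ i < n) {a a' : ℕ}
    (ha : a ≤ n) (ha' : a' ≤ n) :
    ∑ S ∈ Finset.powersetCard (n - a) (Finset.univ : Finset (Fin n)),
      expSign (Fin.cons a' (fun i => μ i + if i ∈ S then 1 else 0) : Fin (n + 1) → ℕ)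
      = if a' = a then (-1) ^ a * expSign μ else 0 := by
  by_cases hinj : Function.Injective μ
  · have hsurj : ∀ v < n, ∃ i, μ i = v := by
      let f : Fin n → Fin n := fun i => ⟨μ i, hμ i⟩
      have hf : Function.Injective f := fun x y hxy => hinj (congrArg Fin.val hxy)
      intro v hv
      obtain ⟨i, hi⟩ := Finite.surjective_of_injective hf ⟨v, hv⟩
      exact ⟨i, congrArg Fin.val hi⟩
    -- When μ is a permutation, only the strip on the values at least `a` can survive. Adding it
    -- leaves exactly the value `a` free, so the extra entry `a'` must equal `a`.
    let T : Finset (Fin n) := Finset.univ.filter fun i => a ≤ μ i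
    have hT : T.card = n - a := by
      have h1 : T.image μ = Finset.Ico a n := by
        ext v
        simp only [T, Finset.mem_image, Finset.mem_filter, Finset.mem_univ, true_and,
          Finset.mem_Ico]
        constructor
        · rintro ⟨i, hi, rfl⟩
          exact ⟨hi, hμ i⟩
        · rintro ⟨h1, h2⟩
          obtain ⟨i, rfl⟩ := hsurj v h2
          exact ⟨i, h1, rfl⟩
      rw [← Finset.card_image_of_injective T hinj, h1, Nat.card_Ico]
    rw [Finset.sum_eq_single_of_mem T (Finset.mem_powersetCard.2 ⟨Finset.subset_univ _, hT⟩)]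
    · split_ifs with h
      · subst h
        rw [← expSign_cons μ ha]
        congr 2
        funext i
        simp only [T, Finset.mem_filter, Finset.mem_univ, true_and]
        split_ifs <;> omega
      · rcases lt_or_gt_of_ne h with h | h
        · obtain ⟨i, hi⟩ := hsurj a' (by omega)
          refine expSign_eq_zero (a := 0) (b := i.succ) (Fin.succ_ne_zero i).symm ?_
          simp only [Fin.cons_zero, Fin.cons_succ, T, Finset.mem_filter, Finset.mem_univ, true_and]
          rw [if_neg (by omega)]
          omega
        · obtain ⟨i, hi⟩ := hsurj (a' - 1) (by omega)
          refine expSign_eq_zero (a := 0) (b := i.succ) (Fin.succ_ne_zero i).symm ?_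
          simp only [Fin.cons_zero, Fin.cons_succ, T, Finset.mem_filter, Finset.mem_univ, true_and]
          rw [if_pos (by omega)]
          omega
    · intro S hS hne
      by_contra h0
      apply hne
      have hSc := (Finset.mem_powersetCard.1 hS).2
      -- If `i` is raised while the index holding the next value is not, two entries collide. Hence
      -- a contributing `S` is closed upwards in the values of μ, and its cardinality then forces `S
      -- = T`.
      have hstep : ∀ i j, i ∈ S → μ j = μ i + 1 → j ∈ S := by
        intro i j hi hj
        by_contra hjS
        refine h0 (expSign_eq_zero (a := i.succ) (b := j.succ) ?_ ?_)
        · intro e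
          exact hjS (Fin.succ_injective _ e ▸ hi)
        · simp [hi, hjS, hj]
      have hup : ∀ k i j, i ∈ S → μ j = μ i + k → j ∈ S := by
        intro k
        induction k with
        | zero =>
          intro i j hi hj
          exact hinj hj ▸ hi
        | succ k ih =>
          intro i j hi hj
          obtain ⟨l, hl⟩ := hsurj (μ i + k) (by have := hμ j; omega)
          exact hstep l j (ih i l hi hl) (by omega)
      by_cases hST : S ⊆ T
      · exact Finset.eq_of_subset_of_card_le hST (by omega)
      · obtain ⟨i, hi, hiT⟩ := Finset.not_subset.1 hST
        have hiT' : ¬ a ≤ μ i := by simpa [T] using hiT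
        refine (Finset.eq_of_subset_of_card_le (fun j hj => ?_) (by omega)).symm
        have hj' : a ≤ μ j := by simpa [T] using hj
        exact hup (μ j - μ i) i j hi (by omega)
  -- If μ repeats a value at `b` and `c`, exchanging these two indices in `S` reverses the sign, and
  -- a set fixed by the exchange contributes zero.
  · have h0 : ∃ b c, μ b = μ c ∧ b ≠ c := by
      simpa [Function.Injective] using hinj
    obtain ⟨b, c, hbc, hne⟩ := h0
    rw [expSign_eq_zero hne hbc, mul_zero, ite_self]
    have hμs : ∀ i, μ (swap b c i) = μ i := by
      intro i
      by_cases h1 : i = b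
      · rw [h1, swap_apply_left, hbc]
      · by_cases h2 : i = c
        · rw [h2, swap_apply_right, hbc]
        · rw [swap_apply_of_ne_of_ne h1 h2]
    have hmem : ∀ (S : Finset (Fin n)) i,
        i ∈ S.map (swap b c).toEmbedding ↔ swap b c i ∈ S := by
      intro S i
      rw [Finset.mem_map_equiv, symm_swap]
    refine Finset.sum_involution (fun S _ => S.map (swap b c).toEmbedding) ?_ ?_ ?_ ?_
    · intro S _
      have hcomp : (Fin.cons a' (fun i => μ i + if i ∈ S.map (swap b c).toEmbedding then 1 else 0) :
          Fin (n + 1) → ℕ)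
          = (Fin.cons a' (fun i => μ i + if i ∈ S then 1 else 0) : Fin (n + 1) → ℕ) ∘
            swap b.succ c.succ := by
        funext i
        refine Fin.cases ?_ (fun i => ?_) i
        · rw [Function.comp_apply, swap_apply_of_ne_of_ne (Fin.succ_ne_zero b).symm
            (Fin.succ_ne_zero c).symm]
          rfl
        · have : swap b.succ c.succ i.succ = (swap b c i).succ := by
            simp only [swap_apply_def, Fin.succ_inj]
            split_ifs <;> rfl
          rw [Function.comp_apply, this, Fin.cons_succ, Fin.cons_succ, hμs]
          simp only [hmem]
      rw [hcomp, expSign_comp_swap _ (fun e => hne (Fin.succ_injective _ e)), add_neg_cancel]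
    · intro S _ hS e
      apply hS
      have : (b ∈ S ↔ c ∈ S) := by
        conv_lhs => rw [← e, hmem, swap_apply_left]
      refine expSign_eq_zero (a := b.succ) (b := c.succ)
        (fun e => hne (Fin.succ_injective _ e)) ?_
      simp [this, hbc]
    · intro S hS
      rw [Finset.mem_powersetCard] at hS ⊢
      exact ⟨Finset.subset_univ _, by rw [Finset.card_map, hS.2]⟩
    · intro S _
      ext i
      rw [hmem, hmem, swap_apply_self]

/-! ### Unimodularity of the Vandermonde pairing -/

/-- The exponents `n - 1, n - 2, …, 0`. -/
def stair (n : ℕ) : Fin n → ℕ := fun i => n - 1 - i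

theorem tail_stair (n : ℕ) : Fin.tail (stair (n + 1)) = stair n := by
  funext i
  simp only [Fin.tail, stair, Fin.val_succ]
  omega

/-- Triangularity through the Pieri rule: summing the hypotheses over all ways of raising `n - a`
entries of a test vector isolates the exponents with first entry `a` and leaves, up to sign, the
same problem in one variable less. -/
theorem eq_zero_of_sum_expSign {R : Type*} [CommRing R] (n : ℕ) (f : (Fin n → ℕ) → R)
    (h : ∀ β : Fin n → ℕ, (∀ i, β i ≤ i) →
      ∑ α ∈ box (stair n), (expSign (α + β) : R) * f α = 0) :
    ∀ α ∈ box (stair n), f α = 0 := by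
  induction n with
  | zero =>
    intro α hα
    have h1 := h 0 fun i => i.elim0
    rw [Finset.sum_eq_single_of_mem α hα fun b _ hb => absurd (Subsingleton.elim _ _) hb] at h1
    simpa [expSign] using h1
  | succ n ih =>
    intro α hα
    rw [← Fin.cons_self_tail α] at hα ⊢
    rw [cons_mem_box, tail_stair] at hα
    obtain ⟨ha, hα⟩ := hα
    set a := α 0
    have ha' : a ≤ n := by simpa [stair] using ha
    refine ih (fun α => f (Fin.cons a α)) ?_ _ hα
    intro β hβ
    -- The raised vectors remain admissible tests: prepending a zero moves every other index up by
    -- one, and so loosens its bound by the one unit that may be added.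
    have h1 : ∑ S ∈ Finset.powersetCard (n - a) (Finset.univ : Finset (Fin n)),
        ∑ α ∈ box (stair (n + 1)), (expSign (α +
          (Fin.cons 0 (fun i => β i + if i ∈ S then 1 else 0) : Fin (n + 1) → ℕ)) : R) * f α
        = 0 := by
      refine Finset.sum_eq_zero fun S _ => h _ ?_
      intro i
      refine Fin.cases ?_ (fun i => ?_) i
      · simp
      · have := hβ i
        rw [Fin.cons_succ, Fin.val_succ]
        split_ifs <;> omega
    have h2 : ∀ q ∈ Finset.range (n + 1), ∀ α ∈ box (stair n),
        ∑ S ∈ Finset.powersetCard (n - a) (Finset.univ : Finset (Fin n)),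
        (expSign ((Fin.cons q α : Fin (n + 1) → ℕ) +
          (Fin.cons 0 (fun i => β i + if i ∈ S then 1 else 0) : Fin (n + 1) → ℕ)) : R)
          * f (Fin.cons q α)
        = if q = a then (-1) ^ a * ((expSign (α + β) : R) * f (Fin.cons a α)) else 0 := by
      intro q hq α hα
      rw [Finset.mem_range] at hq
      rw [mem_box] at hα
      have h3 : ∀ S : Finset (Fin n), (Fin.cons q α : Fin (n + 1) → ℕ) +
          (Fin.cons 0 (fun i => β i + if i ∈ S then 1 else 0) : Fin (n + 1) → ℕ)
          = Fin.cons q (fun i => (α + β) i + if i ∈ S then 1 else 0) := by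
        intro S
        funext i
        refine Fin.cases ?_ (fun i => ?_) i
        · simp
        · simp [add_assoc]
      simp only [h3]
      rw [← Finset.sum_mul, ← Int.cast_sum, sum_powersetCard_expSign (α + β) (fun i => by
        have h4 := hα i
        have h5 := hβ i
        have h6 := i.2
        simp only [stair] at h4
        rw [Pi.add_apply]
        omega) ha' (by omega)]
      split_ifs with h
      · subst h
        push_cast
        ring
      · simp
    simp only [sum_box_succ] at h1
    rw [Finset.sum_comm] at h1
    rw [tail_stair] at h1
    have h4 : stair (n + 1) 0 = n := by simp [stair]
    rw [h4] at h1
    rw [Finset.sum_congr rfl fun q hq => by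
      rw [Finset.sum_comm, Finset.sum_congr rfl (h2 q hq)]] at h1
    rw [Finset.sum_eq_single_of_mem a (by simpa [Nat.lt_succ_iff] using ha')
      (fun q _ hq => by simp [hq])] at h1
    simp only [if_true, ← Finset.mul_sum] at h1
    -- The leftover sign `(-1)^a` is its own inverse, so it is removed by multiplication, in any
    -- ring.
    have h5 := congrArg (fun x => (-1 : R) ^ a * x) h1
    simp only [mul_zero, ← mul_assoc, ← mul_pow] at h5
    simpa [mul_assoc] using h5

/-- The matrix of the invariant pairing between the degrees `d` and `e`. -/
def pairing (n d e : ℕ) : Matrix (degBox (stair n) d) (degBox (stair n) e) ℤ :=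
  Matrix.of fun α β => expSign fun i => (α : Fin n → ℕ) i + (β : Fin n → ℕ) (Fin.rev i)

theorem sum_stair (n : ℕ) : ∑ i, stair n i = n.choose 2 := by
  rw [← Equiv.sum_comp Fin.revPerm]
  have : ∀ i : Fin n, stair n (Fin.revPerm i) = (i : ℕ) := by
    intro i
    have := i.2
    simp only [stair, Fin.revPerm_apply, Fin.val_rev]
    omega
  simp only [this]
  rw [Fin.sum_univ_eq_sum_range (fun i => i), Finset.sum_range_id, Nat.choose_two_right]

theorem sum_val (n : ℕ) : ∑ i : Fin n, (i : ℕ) = n.choose 2 := by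
  rw [Fin.sum_univ_eq_sum_range (fun i => i), Finset.sum_range_id, Nat.choose_two_right]

/-- The pairing on the whole box is nondegenerate modulo every prime, hence unimodular. Since its
nonzero entries pair degrees with sum N, each graded block is unimodular too. -/
theorem exists_inverse_pairing (n : ℕ) {d e : ℕ} (hde : d + e = n.choose 2) :
    ∃ B : Matrix (degBox (stair n) e) (degBox (stair n) d) ℤ,
      pairing n d e * B = 1 ∧ B * pairing n d e = 1 := by
  let G : Matrix (box (stair n)) (box (stair n)) ℤ :=
    Matrix.of fun β α => expSign fun i => (α : Fin n → ℕ) i + (β : Fin n → ℕ) (Fin.rev i)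
  obtain ⟨B, hB, hB'⟩ : ∃ B, G * B = 1 ∧ B * G = 1 := by
    apply exists_inverse_of_forall_zmod rfl
    intro p hp v hv
    have h1 := eq_zero_of_sum_expSign n
      (fun α => if hα : α ∈ box (stair n) then v ⟨α, hα⟩ else 0) (by
        intro β hβ
        have hβ' : (fun i => β (Fin.rev i)) ∈ box (stair n) := by
          rw [mem_box]
          intro i
          have := hβ (Fin.rev i)
          rw [Fin.val_rev] at this
          simp only [stair]
          omega
        rw [← hv ⟨_, hβ'⟩, ← Finset.sum_coe_sort]
        refine Finset.sum_congr rfl fun α _ => ?_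
        simp only [G, Matrix.of_apply, Fin.rev_rev, Finset.coe_mem, dif_pos]
        rfl)
    funext α
    simpa using h1 α α.2
  have hG : ∀ α β, G β α ≠ 0 → ∑ i, (α : Fin n → ℕ) i + ∑ i, (β : Fin n → ℕ) i = n.choose 2 := by
    intro α β h
    have h1 := sum_eq_of_expSign_ne_zero h
    rw [Finset.sum_add_distrib, sum_val] at h1
    rw [← h1]
    congr 1
    exact (Equiv.sum_comp Fin.revPerm (β : Fin n → ℕ)).symm
  have hsub : ∀ d, degBox (stair n) d ⊆ box (stair n) := fun d => Finset.filter_subset _ _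
  have hinj : ∀ d, Function.Injective (Set.inclusion (hsub d) :
      degBox (stair n) d → box (stair n)) := fun d => Set.inclusion_injective _
  have hrange : ∀ (d : ℕ) (α : box (stair n)), ∑ i, (α : Fin n → ℕ) i = d →
      α ∈ Set.range (Set.inclusion (hsub d) : degBox (stair n) d → box (stair n)) := by
    intro d α h
    exact ⟨⟨α, Finset.mem_filter.2 ⟨α.2, h⟩⟩, rfl⟩
  have hGt : pairing n d e = (G.transpose).submatrix
      (Set.inclusion (hsub d) : degBox (stair n) d → box (stair n))
      (Set.inclusion (hsub e) : degBox (stair n) e → box (stair n)) := rfl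
  have hT : G.transpose * B.transpose = 1 := by
    rw [← Matrix.transpose_mul, hB', Matrix.transpose_one]
  have h1 := submatrix_mul_submatrix_eq_one hT (hinj d) (hinj e) (by
    intro i j hij
    have := hG _ _ hij
    have h2 := (mem_degBox.1 i.2).2
    apply hrange
    have h3 : ∑ k, (Set.inclusion (hsub d) i : Fin n → ℕ) k = d := h2
    omega)
  have h2 := submatrix_mul_submatrix_eq_one hB (hinj e) (hinj d) (by
    intro i j hij
    have := hG _ _ hij
    have h2 := (mem_degBox.1 i.2).2
    apply hrange
    have h3 : ∑ k, (Set.inclusion (hsub e) i : Fin n → ℕ) k = e := h2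
    omega)
  refine ⟨_, hGt ▸ h1, ?_⟩
  have h3 := congrArg Matrix.transpose h2
  rw [Matrix.transpose_mul, Matrix.transpose_one] at h3
  exact h3

/-! ### Invariance of the pairing -/

/-- The divided-power law `∇^{(a)} ∇^{(b)} = C(a+b, a) ∇^{(a+b)}`. -/
theorem lowering_mul_lowering {r : ℕ} (m : Fin r → ℕ) {d e : ℕ} (h : d ≤ e) (f : ℕ) :
    lowering m d e * lowering m e f = ((f - d).choose (e - d) : ℤ) • lowering m d f := by
  ext γ α
  have hγ := mem_degBox.1 γ.2
  have hα := mem_degBox.1 α.2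
  have h1 := sum_binomProd_mul_binomProd (γ := (γ : Fin r → ℕ)) (d := e) hα.1 (by omega)
  rw [Matrix.mul_apply, Matrix.smul_apply]
  simp only [lowering, Matrix.of_apply]
  rw [Finset.sum_coe_sort (degBox m e)
      (fun β => (binomProd (γ : Fin r → ℕ) β : ℤ) * (binomProd β (α : Fin r → ℕ) : ℤ))]
  rw [hα.2, hγ.2] at h1
  rw [smul_eq_mul]
  exact_mod_cast h1

/-- A single step of the lowering operator. -/
theorem sum_binomProd_smul {M : Type*} [AddCommMonoid M] {r : ℕ} {m α : Fin r → ℕ} {d : ℕ}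
    (hα : α ∈ degBox m (d + 1)) (F : (Fin r → ℕ) → M) :
    ∑ β ∈ degBox m d, binomProd β α • F β
      = ∑ i, α i • F (Function.update α i (α i - 1)) := by
  rw [mem_degBox] at hα
  have hsum : ∀ i, α i ≠ 0 → ∑ j, Function.update α i (α i - 1) j = d := by
    intro i hi
    have h1 := Finset.sum_update_of_mem (Finset.mem_univ i) α (α i - 1)
    have h2 := Finset.add_sum_erase Finset.univ α (Finset.mem_univ i)
    rw [← Finset.erase_eq] at h1
    omega
  have h1 : ∑ i, α i • F (Function.update α i (α i - 1))
      = ∑ i ∈ Finset.univ.filter (fun i => α i ≠ 0), α i • F (Function.update α i (α i - 1)) := by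
    rw [Finset.sum_filter]
    refine Finset.sum_congr rfl fun i _ => ?_
    split_ifs with h
    · rfl
    · rw [not_not.1 h, zero_smul]
  rw [h1]
  symm
  apply Finset.sum_of_injOn (fun i => Function.update α i (α i - 1))
  · intro i hi j hj hij
    by_contra hne
    have h2 := congrFun hij i
    have hi' : α i ≠ 0 := by simpa using hi
    simp only [Function.update_self, Function.update_of_ne hne] at h2
    omega
  · intro i hi
    have hi' : α i ≠ 0 := by simpa using hi
    rw [Finset.mem_coe, mem_degBox]
    refine ⟨fun j => ?_, hsum i hi'⟩
    have := hα.1 j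
    beta_reduce
    by_cases hj : j = i
    · subst hj
      rw [Function.update_self]
      omega
    · rwa [Function.update_of_ne hj]
  · intro β hβ hβ'
    have hz : binomProd β α = 0 := by
      by_contra hne
      have hle := le_of_binomProd_ne_zero hne
      rw [mem_degBox] at hβ
      obtain ⟨i, hi⟩ : ∃ i, β i < α i := by
        by_contra hcon
        push Not at hcon
        have := Finset.sum_le_sum fun i (_ : i ∈ Finset.univ) => hcon i
        omega
      refine hβ' ⟨i, by simp; omega, ?_⟩
      have hle2 : ∀ j, β j ≤ Function.update α i (α i - 1) j := by
        intro j
        by_cases hj : j = i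
        · subst hj
          rw [Function.update_self]
          omega
        · rw [Function.update_of_ne hj]
          exact hle j
      have h3 := (Finset.sum_eq_sum_iff_of_le fun j (_ : j ∈ Finset.univ) => hle2 j).1
        (by rw [hβ.2, hsum i (by omega)])
      funext j
      exact (h3 j (Finset.mem_univ j)).symm
    rw [hz, zero_smul]
  · intro i hi
    have hi' : α i ≠ 0 := by simpa using hi
    congr 1
    rw [binomProd, Finset.prod_eq_single i]
    · rw [Function.update_self]
      obtain ⟨a, ha⟩ := Nat.exists_eq_succ_of_ne_zero hi'
      rw [ha]
      simp
    · intro j _ hj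
      rw [Function.update_of_ne hj, Nat.choose_self]
    · intro h
      exact absurd (Finset.mem_univ _) h

/-- If μ is a permutation, lowering a positive entry makes it collide with the index that already
holds the smaller value. If μ repeats a value, only the two equal entries can contribute, and
antisymmetry cancels them. The bound on μ is essential: an entry equal to `n` could be lowered to a
missing value. -/
theorem sum_mul_expSign_update {n : ℕ} (μ : Fin n → ℕ) (hμ : ∀ i, μ i < n) :
    ∑ i, (μ i : ℤ) * expSign (Function.update μ i (μ i - 1)) = 0 := by
  by_cases hinj : Function.Injective μ
  · have hsurj : ∀ v < n, ∃ i, μ i = v := by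
      let f : Fin n → Fin n := fun i => ⟨μ i, hμ i⟩
      have hf : Function.Injective f := fun x y hxy => hinj (congrArg Fin.val hxy)
      intro v hv
      obtain ⟨i, hi⟩ := Finite.surjective_of_injective hf ⟨v, hv⟩
      exact ⟨i, congrArg Fin.val hi⟩
    refine Finset.sum_eq_zero fun i _ => ?_
    rcases Nat.eq_zero_or_pos (μ i) with h0 | hpos
    · rw [h0, Nat.cast_zero, zero_mul]
    · obtain ⟨j, hj⟩ := hsurj (μ i - 1) (by have := hμ i; omega)
      have hne : j ≠ i := by
        rintro rfl
        omega
      rw [expSign_eq_zero hne, mul_zero]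
      rw [Function.update_self, Function.update_of_ne hne, hj]
  · have h0 : ∃ b c, μ b = μ c ∧ b ≠ c := by
      simpa [Function.Injective] using hinj
    obtain ⟨b, c, hbc, hne⟩ := h0
    have h1 : ∀ i, i ≠ b ∧ i ≠ c → (μ i : ℤ) * expSign (Function.update μ i (μ i - 1)) = 0 := by
      rintro i ⟨hb, hc⟩
      rw [expSign_eq_zero hne, mul_zero]
      rw [Function.update_of_ne hb.symm, Function.update_of_ne hc.symm, hbc]
    rw [Fintype.sum_eq_add b c hne h1]
    have h2 : Function.update μ c (μ c - 1) = Function.update μ b (μ b - 1) ∘ swap b c := by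
      funext i
      rw [Function.comp_apply]
      by_cases hib : i = b
      · subst hib
        rw [swap_apply_left, Function.update_of_ne hne, Function.update_of_ne hne.symm, hbc]
      · by_cases hic : i = c
        · subst hic
          rw [swap_apply_right, Function.update_self, Function.update_self, hbc]
        · rw [swap_apply_of_ne_of_ne hib hic, Function.update_of_ne hic, Function.update_of_ne hib]
    rw [h2, expSign_comp_swap _ hne, hbc]
    ring

/-- Skew-adjointness of one lowering step. By the Leibniz rule the two sides together give the
previous identity for `μ = α + rev β`, whose entries are less than `n` because `α i ≤ n - 1 - i` and
`β (rev i) ≤ i`. -/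
theorem lowering_transpose_mul_pairing_one (n d e : ℕ) :
    (lowering (stair n) d (d + 1)).transpose * pairing n d (e + 1)
      = -(pairing n (d + 1) e * lowering (stair n) e (e + 1)) := by
  ext α β
  have hα := mem_degBox.1 α.2
  have hβ := mem_degBox.1 β.2
  rw [Matrix.neg_apply, eq_neg_iff_add_eq_zero, Matrix.mul_apply, Matrix.mul_apply]
  simp only [Matrix.transpose_apply, lowering, pairing, Matrix.of_apply]
  have h1 := sum_binomProd_smul α.2
    (fun γ => expSign fun i => γ i + (β : Fin n → ℕ) (Fin.rev i))
  have h2 := sum_binomProd_smul β.2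
    (fun γ => expSign fun i => (α : Fin n → ℕ) i + γ (Fin.rev i))
  rw [← Finset.sum_coe_sort] at h1 h2
  simp only [nsmul_eq_mul] at h1 h2
  simp only [mul_comm (expSign _)]
  rw [h1, h2.trans (Equiv.sum_comp Fin.revPerm _).symm]
  have hlt : ∀ i, (α : Fin n → ℕ) i + (β : Fin n → ℕ) (Fin.rev i) < n := by
    intro i
    have h3 := hα.1 i
    have h4 := hβ.1 (Fin.rev i)
    have h5 := i.2
    simp only [stair, Fin.val_rev] at h3 h4
    omega
  rw [← sum_mul_expSign_update _ hlt, ← Finset.sum_add_distrib]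
  refine Finset.sum_congr rfl fun i _ => ?_
  rw [Fin.revPerm_apply, Nat.cast_add, add_mul]
  congr 1
  · rcases Nat.eq_zero_or_pos ((α : Fin n → ℕ) i) with h0 | hpos
    · rw [h0, Nat.cast_zero, zero_mul, zero_mul]
    · congr 2
      funext j
      by_cases hj : j = i
      · subst hj
        rw [Function.update_self, Function.update_self]
        omega
      · rw [Function.update_of_ne hj, Function.update_of_ne hj]
  · rcases Nat.eq_zero_or_pos ((β : Fin n → ℕ) (Fin.rev i)) with h0 | hpos
    · rw [h0, Nat.cast_zero, zero_mul, zero_mul]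
    · congr 2
      funext j
      by_cases hj : j = i
      · subst hj
        rw [Function.update_self, Function.update_self]
        omega
      · rw [Function.update_of_ne hj, Function.update_of_ne (fun h => hj (Fin.rev_injective h))]

theorem lowering_transpose_mul_pairing (n k : ℕ) {d d' e e' : ℕ} (hd : d' = d + k)
    (he : e' = e + k) :
    (lowering (stair n) d d').transpose * pairing n d e'
      = (-1 : ℤ) ^ k • (pairing n d' e * lowering (stair n) e e') := by
  induction k generalizing d e' with
  | zero =>
    obtain rfl : d' = d := by omega
    obtain rfl : e' = e := by omega
    have h1 : ∀ d, lowering (stair n) d d = 1 := by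
      intro d
      ext γ α
      rw [Matrix.one_apply, lowering, Matrix.of_apply]
      split_ifs with h
      · rw [h, binomProd_self, Nat.cast_one]
      · rw [Nat.cast_eq_zero]
        by_contra hne
        apply h
        have hle := le_of_binomProd_ne_zero hne
        have h3 := (Finset.sum_eq_sum_iff_of_le fun j (_ : j ∈ Finset.univ) => hle j).1
          (by rw [(mem_degBox.1 γ.2).2, (mem_degBox.1 α.2).2])
        exact Subtype.ext (funext fun j => h3 j (Finset.mem_univ j))
    rw [h1, h1]
    simp
  | succ k ih =>
    subst he
    have h1 := lowering_mul_lowering (stair n) (d := d) (e := d + 1) (by omega) d'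
    have h2 := lowering_mul_lowering (stair n) (d := e) (e := e + k) (by omega) (e + (k + 1))
    have e1 : ((d' - d).choose (d + 1 - d) : ℤ) = (k + 1 : ℤ) := by
      rw [show d' - d = k + 1 by omega, show d + 1 - d = 1 by omega]
      simp
    have e2 : ((e + (k + 1) - e).choose (e + k - e) : ℤ) = (k + 1 : ℤ) := by
      rw [show e + (k + 1) - e = k + 1 by omega, show e + k - e = k by omega]
      simp
    rw [e1] at h1
    rw [e2] at h2
    have h3 := ih (d := d + 1) (e' := e + k) (by omega) rfl
    have h4 := lowering_transpose_mul_pairing_one n d (e + k)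
    have hk : (k + 1 : ℤ) ≠ 0 := by positivity
    -- The divided power of order `k + 1` is not a product of smaller ones, but `k + 1` times it is;
    -- the factor cancels because integer matrices have no torsion.
    have key : (k + 1 : ℤ) • ((lowering (stair n) d d').transpose * pairing n d (e + (k + 1)))
        = (k + 1 : ℤ) • ((-1 : ℤ) ^ (k + 1) •
          (pairing n d' e * lowering (stair n) e (e + (k + 1)))) := by
      rw [← Matrix.smul_mul, ← Matrix.transpose_smul, ← h1, Matrix.transpose_mul, Matrix.mul_assoc]
      rw [show e + (k + 1) = e + k + 1 from rfl, h4, Matrix.mul_neg, ← Matrix.mul_assoc, h3,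
        Matrix.smul_mul, Matrix.mul_assoc]
      rw [show e + k + 1 = e + (k + 1) from rfl, h2, Matrix.mul_smul, pow_succ, mul_neg_one,
        neg_smul, smul_neg, smul_comm]
    exact smul_right_injective _ hk key

/-- Lowering from the top degrees is the transpose of lowering to the bottom degrees. -/
theorem unimodEquiv_lowering_transpose (n : ℕ) {d e : ℕ} (h : d ≤ e) (he : e ≤ n.choose 2) :
    UnimodEquiv (lowering (stair n) d e).transpose
      (lowering (stair n) (n.choose 2 - e) (n.choose 2 - d)) := by
  obtain ⟨B, hB, hB'⟩ := exists_inverse_pairing n (d := d) (e := n.choose 2 - d) (by omega)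
  obtain ⟨C, hC, hC'⟩ := exists_inverse_pairing n (d := e) (e := n.choose 2 - e) (by omega)
  have key := lowering_transpose_mul_pairing n (e - d) (d := d) (d' := e) (e := n.choose 2 - e)
    (e' := n.choose 2 - d) (by omega) (by omega)
  have hs : (-1 : ℤ) ^ (e - d) * (-1) ^ (e - d) = 1 := by
    rw [← mul_pow]; simp
  -- The sign of the adjunction is absorbed into the left factor, which stays unimodular.
  refine ⟨(-1 : ℤ) ^ (e - d) • C, (-1 : ℤ) ^ (e - d) • pairing n e _, pairing n d _, B,
    ?_, ?_, hB, hB', ?_⟩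
  · rw [Matrix.smul_mul, Matrix.mul_smul, smul_smul, hs, one_smul, hC']
  · rw [Matrix.smul_mul, Matrix.mul_smul, smul_smul, hs, one_smul, hC]
  · rw [Matrix.mul_assoc, key, Matrix.smul_mul, Matrix.mul_smul, smul_smul, hs, one_smul,
      ← Matrix.mul_assoc, hC', Matrix.one_mul]

/-! ### Integral divided differences -/

/-- The divisibility holds over every commutative ring; it is needed over ℤ so that divided
differences preserve integrality. -/
theorem X_sub_X_dvd_sub_rename_swap {σ R : Type*} [DecidableEq σ] [CommRing R] (a b : σ)
    (g : MvPolynomial σ R) :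
    (X a - X b : MvPolynomial σ R) ∣ g - rename (swap a b) g := by
  induction g using MvPolynomial.induction_on with
  | C r => simp
  | add p q hp hq =>
    rw [map_add, add_sub_add_comm]
    exact dvd_add hp hq
  | mul_X p k hp =>
    rw [map_mul, rename_X]
    have hk : (X a - X b : MvPolynomial σ R) ∣ X k - X (swap a b k) := by
      by_cases h1 : k = a
      · subst h1; simp
      · by_cases h2 : k = b
        · subst h2
          rw [swap_apply_right]
          exact ⟨-1, by ring⟩
        · rw [swap_apply_of_ne_of_ne h1 h2]; simp
    have e : p * X k - rename (swap a b) p * X (swap a b k)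
        = (p - rename (swap a b) p) * X k + rename (swap a b) p * (X k - X (swap a b k)) := by
      ring
    rw [e]
    exact dvd_add (hp.mul_right _) (hk.mul_left _)

theorem int_X_sub_X_ne_zero {n : ℕ} {a b : Fin n} (h : a ≠ b) :
    (X a - X b : MvPolynomial (Fin n) ℤ) ≠ 0 := by
  rw [sub_ne_zero]
  exact fun e => h (X_injective e)

theorem castSucc_ne {n i : ℕ} (h : i + 1 < n) :
    (⟨i, Nat.lt_of_succ_lt h⟩ : Fin n) ≠ ⟨i + 1, h⟩ := by
  simp [Fin.ext_iff]

/-- The divided difference on integer polynomials. -/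
noncomputable def intDividedDiff (n i : ℕ) (h : i + 1 < n) :
    MvPolynomial (Fin n) ℤ →+ MvPolynomial (Fin n) ℤ :=
  AddMonoidHom.mk' (fun g => Classical.choose
    (X_sub_X_dvd_sub_rename_swap (⟨i, Nat.lt_of_succ_lt h⟩ : Fin n) ⟨i + 1, h⟩ g)) (by
    intro f g
    apply mul_left_cancel₀ (int_X_sub_X_ne_zero (castSucc_ne h))
    rw [mul_add, ← Classical.choose_spec
      (X_sub_X_dvd_sub_rename_swap (⟨i, Nat.lt_of_succ_lt h⟩ : Fin n) ⟨i + 1, h⟩ (f + g)),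
      ← Classical.choose_spec
      (X_sub_X_dvd_sub_rename_swap (⟨i, Nat.lt_of_succ_lt h⟩ : Fin n) ⟨i + 1, h⟩ f),
      ← Classical.choose_spec
      (X_sub_X_dvd_sub_rename_swap (⟨i, Nat.lt_of_succ_lt h⟩ : Fin n) ⟨i + 1, h⟩ g), map_add]
    ring)

theorem mul_intDividedDiff (n i : ℕ) (h : i + 1 < n) (g : MvPolynomial (Fin n) ℤ) :
    (X ⟨i, Nat.lt_of_succ_lt h⟩ - X ⟨i + 1, h⟩) * intDividedDiff n i h g
      = g - rename (simpleRefl n i h) g :=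
  (Classical.choose_spec
    (X_sub_X_dvd_sub_rename_swap (⟨i, Nat.lt_of_succ_lt h⟩ : Fin n) ⟨i + 1, h⟩ g)).symm

theorem eq_intDividedDiff {n i : ℕ} (h : i + 1 < n) {f g : MvPolynomial (Fin n) ℤ}
    (hf : (X ⟨i, Nat.lt_of_succ_lt h⟩ - X ⟨i + 1, h⟩) * f = g - rename (simpleRefl n i h) g) :
    intDividedDiff n i h g = f :=
  mul_left_cancel₀ (int_X_sub_X_ne_zero (castSucc_ne h)) ((mul_intDividedDiff n i h g).trans hf.symm)

/-- Both are the quotient by the same nonzero linear form in a domain, so integral and complex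
divided differences agree. -/
theorem dividedDiff_map (n i : ℕ) (h : i + 1 < n) (g : MvPolynomial (Fin n) ℤ) :
    dividedDiff n i h (map (Int.castRingHom ℂ) g)
      = map (Int.castRingHom ℂ) (intDividedDiff n i h g) := by
  apply mul_left_cancel₀ (X_sub_X_ne_zero (castSucc_ne h))
  rw [mul_dividedDiff]
  have h1 := congrArg (map (Int.castRingHom ℂ)) (mul_intDividedDiff n i h g)
  rw [map_mul, map_sub, map_sub, map_X, map_X, map_rename] at h1
  exact h1.symm

theorem intDividedDiff_intDividedDiff (n i : ℕ) (h : i + 1 < n) (g : MvPolynomial (Fin n) ℤ) :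
    intDividedDiff n i h (intDividedDiff n i h g) = 0 := by
  apply eq_intDividedDiff
  have e1 := mul_intDividedDiff n i h g
  have e2 := congrArg (rename (simpleRefl n i h)) e1
  have ss : rename (simpleRefl n i h) (rename (simpleRefl n i h) g) = g := by
    rw [rename_rename, show (simpleRefl n i h : Fin n → Fin n) ∘ simpleRefl n i h = id from by
      funext x; exact simpleRefl_simpleRefl n i h x, rename_id_apply]
  rw [map_mul, map_sub, map_sub, rename_X, rename_X, simpleRefl_left, simpleRefl_right, ss] at e2
  apply mul_left_cancel₀ (int_X_sub_X_ne_zero (castSucc_ne h))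
  linear_combination -e1 - e2

theorem homogeneousComponent_X_mul {σ R : Type*} [CommSemiring R] (a : σ) (k : ℕ)
    (g : MvPolynomial σ R) :
    homogeneousComponent (k + 1) (X a * g) = X a * homogeneousComponent k g := by
  classical
  ext d
  rw [coeff_homogeneousComponent, coeff_X_mul', coeff_X_mul', coeff_homogeneousComponent]
  by_cases ha : a ∈ d.support
  · have hd : (d - Finsupp.single a 1).degree + 1 = d.degree := by
      have h1 : d - Finsupp.single a 1 + Finsupp.single a 1 = d := by
        apply tsub_add_cancel_of_le
        rw [Finsupp.single_le_iff]
        exact Nat.one_le_iff_ne_zero.2 (Finsupp.mem_support_iff.1 ha)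
      conv_rhs => rw [← h1]
      rw [map_add, Finsupp.degree_single]
    simp only [ha, if_true, ← hd, Nat.add_right_cancel_iff]
  · simp [ha]

/-- The degree d component of the quotient satisfies the same defining equation, and quotients in a
domain are unique. -/
theorem isHomogeneous_intDividedDiff {n i : ℕ} (h : i + 1 < n) {g : MvPolynomial (Fin n) ℤ} {d : ℕ}
    (hg : g.IsHomogeneous (d + 1)) : (intDividedDiff n i h g).IsHomogeneous d := by
  have h1 : intDividedDiff n i h g = homogeneousComponent d (intDividedDiff n i h g) := by
    apply eq_intDividedDiff
    rw [sub_mul, ← homogeneousComponent_X_mul, ← homogeneousComponent_X_mul, ← map_sub, ← sub_mul,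
      mul_intDividedDiff]
    exact homogeneousComponent_eq_self (hg.sub hg.rename_isHomogeneous)
  rw [h1]
  exact homogeneousComponent_isHomogeneous _ _

/-- Degrees in one variable add in a domain. The numerator has degree at most the larger of the two
neighbouring staircase bounds, which differ by one, and dividing by `x_i - x_{i+1}` lowers the
degree in either of these variables by one. -/
theorem degreeOf_intDividedDiff_le {n i : ℕ} (h : i + 1 < n) {g : MvPolynomial (Fin n) ℤ}
    (hg : ∀ k, degreeOf k g ≤ stair n k) (k : Fin n) :
    degreeOf k (intDividedDiff n i h g) ≤ stair n k := by
  by_cases h0 : intDividedDiff n i h g = 0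
  · rw [h0, degreeOf_zero]
    exact Nat.zero_le _
  · have hX := int_X_sub_X_ne_zero (castSucc_ne h)
    have e := congrArg (degreeOf k) (mul_intDividedDiff n i h g)
    rw [degreeOf_mul_eq hX h0] at e
    have hle := degreeOf_sub_le k g (rename (simpleRefl n i h) g)
    have hr : degreeOf k (rename (simpleRefl n i h) g) = degreeOf (simpleRefl n i h k) g := by
      conv_lhs => rw [← simpleRefl_simpleRefl n i h k]
      exact degreeOf_rename_of_injective (simpleRefl n i h).injective _
    rw [hr] at hle
    have hk := hg k
    have hsk := hg (simpleRefl n i h k)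
    -- Only the lower bound on the degree of the linear form is needed, since it is subtracted.
    have hdeg : ∀ a b : Fin n, a ≠ b → 1 ≤ degreeOf a (X a - X b : MvPolynomial (Fin n) ℤ) := by
      intro a b hab
      have h2 : coeff (Finsupp.single a 1) (X a - X b : MvPolynomial (Fin n) ℤ) ≠ 0 := by
        rw [coeff_sub, coeff_X, coeff_X, if_pos rfl, if_neg]
        · simp
        · rw [Finsupp.single_left_inj one_ne_zero]
          exact hab.symm
      have h3 := monomial_le_degreeOf a (mem_support_iff.2 h2)
      rwa [Finsupp.single_eq_same] at h3
    by_cases h1 : (k : ℕ) = i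
    · have hk' : k = ⟨i, Nat.lt_of_succ_lt h⟩ := Fin.ext h1
      subst hk'
      rw [simpleRefl_left] at hle hsk
      have := hdeg _ _ (castSucc_ne h)
      simp only [stair] at hk hsk ⊢
      omega
    · by_cases h2 : (k : ℕ) = i + 1
      · have hk' : k = ⟨i + 1, h⟩ := Fin.ext h2
        subst hk'
        rw [simpleRefl_right] at hle hsk
        have h5 := hdeg _ _ (castSucc_ne h).symm
        rw [← degreeOf_neg, neg_sub] at h5
        simp only [stair] at hk hsk ⊢
        omega
      · rw [simpleRefl_of_ne n i h k h1 h2] at hle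
        omega

/-! ### Integral Schubert polynomials -/

theorem eq_revPerm_of_forall_desc {n : ℕ} {w : Perm (Fin n)}
    (hw : ∀ (i : ℕ) (h : i + 1 < n), w⁻¹ ⟨i + 1, h⟩ < w⁻¹ ⟨i, Nat.lt_of_succ_lt h⟩) :
    w = Fin.revPerm := by
  have h1 : w⁻¹ * Fin.revPerm = 1 := by
    apply eq_one_of_forall_asc
    intro i h
    rw [Perm.mul_apply, Perm.mul_apply, Fin.revPerm_apply, Fin.revPerm_apply]
    have hj : (n - (i + 1 + 1)) + 1 < n := by omega
    have ea : Fin.rev (⟨i, Nat.lt_of_succ_lt h⟩ : Fin n) = ⟨(n - (i + 1 + 1)) + 1, hj⟩ := by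
      rw [Fin.ext_iff, Fin.val_rev]; simp only; omega
    have eb : Fin.rev (⟨i + 1, h⟩ : Fin n) = ⟨n - (i + 1 + 1), Nat.lt_of_succ_lt hj⟩ := by
      rw [Fin.ext_iff, Fin.val_rev]
    rw [ea, eb]
    exact hw _ hj
  exact inv_mul_eq_one.1 h1

/-- Induction from the longest permutation down the left weak order. -/
theorem weakOrder_induction {n : ℕ} {P : Perm (Fin n) → Prop} (h0 : P Fin.revPerm)
    (h1 : ∀ (i : ℕ) (h : i + 1 < n) (w : Perm (Fin n)),
      w⁻¹ ⟨i, Nat.lt_of_succ_lt h⟩ < w⁻¹ ⟨i + 1, h⟩ → P (simpleRefl n i h * w) → P w)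
    (w : Perm (Fin n)) : P w := by
  generalize hm : n * n - (invSet w).card = m
  induction m using Nat.strong_induction_on generalizing w with
  | _ m ih =>
    by_cases hw : ∃ i, ∃ h : i + 1 < n, w⁻¹ ⟨i, Nat.lt_of_succ_lt h⟩ < w⁻¹ ⟨i + 1, h⟩
    · obtain ⟨i, h, hw⟩ := hw
      have c := card_invSet_of_asc h w hw
      have cle := card_invSet_le (simpleRefl n i h * w)
      exact h1 i h w hw (ih _ (by omega) _ rfl)
    · have hrev : w = Fin.revPerm := by
        apply eq_revPerm_of_forall_desc
        intro i h
        rcases asc_or_desc h w with h2 | h2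
        · exact absurd ⟨i, h, h2⟩ hw
        · exact h2
      rw [hrev]
      exact h0

theorem schubert_of_asc {n i : ℕ} (h : i + 1 < n) (w : Perm (Fin n))
    (hw : w⁻¹ ⟨i, Nat.lt_of_succ_lt h⟩ < w⁻¹ ⟨i + 1, h⟩) :
    schubert n w = dividedDiff n i h (schubert n (simpleRefl n i h * w)) := by
  have e : simpleRefl n i h * (simpleRefl n i h * w) = w := by
    rw [← mul_assoc, simpleRefl_sq, one_mul]
  have h1 := (isSchubertFamily_schubert n).2 i h (simpleRefl n i h * w)
  rw [e, permLength_eq, permLength_eq, card_invSet_of_asc h w hw] at h1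
  exact h1 (Nat.lt_succ_self _)

theorem exists_int_schubert (n : ℕ) (w : Perm (Fin n)) :
    ∃ f : MvPolynomial (Fin n) ℤ, map (Int.castRingHom ℂ) f = schubert n w := by
  refine weakOrder_induction (P := fun w => ∃ f, map (Int.castRingHom ℂ) f = schubert n w)
    ?_ ?_ w
  · refine ⟨monomial (rho n) 1, ?_⟩
    rw [(isSchubertFamily_schubert n).1, map_monomial, RingHom.map_one]
  · rintro i h w hw ⟨f, hf⟩
    exact ⟨intDividedDiff n i h f, by rw [← dividedDiff_map, hf, schubert_of_asc h w hw]⟩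

/-- The Schubert polynomial with integer coefficients. -/
noncomputable def intSchubert (n : ℕ) (w : Perm (Fin n)) : MvPolynomial (Fin n) ℤ :=
  Classical.choose (exists_int_schubert n w)

theorem map_intSchubert (n : ℕ) (w : Perm (Fin n)) :
    map (Int.castRingHom ℂ) (intSchubert n w) = schubert n w :=
  Classical.choose_spec (exists_int_schubert n w)

theorem intSchubert_revPerm (n : ℕ) : intSchubert n Fin.revPerm = monomial (rho n) 1 := by
  apply map_injective (Int.castRingHom ℂ) Int.cast_injective
  rw [map_intSchubert, (isSchubertFamily_schubert n).1, map_monomial, RingHom.map_one]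

theorem intSchubert_of_asc {n i : ℕ} (h : i + 1 < n) (w : Perm (Fin n))
    (hw : w⁻¹ ⟨i, Nat.lt_of_succ_lt h⟩ < w⁻¹ ⟨i + 1, h⟩) :
    intSchubert n w = intDividedDiff n i h (intSchubert n (simpleRefl n i h * w)) := by
  apply map_injective (Int.castRingHom ℂ) Int.cast_injective
  rw [← dividedDiff_map, map_intSchubert, map_intSchubert, schubert_of_asc h w hw]

theorem intDividedDiff_intSchubert_of_asc {n i : ℕ} (h : i + 1 < n) (w : Perm (Fin n))
    (hw : w⁻¹ ⟨i, Nat.lt_of_succ_lt h⟩ < w⁻¹ ⟨i + 1, h⟩) :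
    intDividedDiff n i h (intSchubert n w) = 0 := by
  rw [intSchubert_of_asc h w hw, intDividedDiff_intDividedDiff]

theorem intDividedDiff_intSchubert_of_desc {n i : ℕ} (h : i + 1 < n) (w : Perm (Fin n))
    (hw : w⁻¹ ⟨i + 1, h⟩ < w⁻¹ ⟨i, Nat.lt_of_succ_lt h⟩) :
    intDividedDiff n i h (intSchubert n w) = intSchubert n (simpleRefl n i h * w) := by
  rw [intSchubert_of_asc h (simpleRefl n i h * w), ← mul_assoc, simpleRefl_sq, one_mul]
  rw [inv_simpleRefl_mul, inv_simpleRefl_mul, simpleRefl_left, simpleRefl_right]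
  exact hw

theorem rho_apply (n : ℕ) (i : Fin n) : rho n i = stair n i := rfl

theorem card_invSet_revPerm (n : ℕ) : (invSet (Fin.revPerm : Perm (Fin n))).card = n.choose 2 := by
  have h1 : invSet (Fin.revPerm : Perm (Fin n))
      = Finset.univ.filter fun q : Fin n × Fin n => q.1 < q.2 := by
    refine Finset.filter_congr fun q _ => ?_
    have hr : (Fin.revPerm : Perm (Fin n))⁻¹ = Fin.revPerm := rfl
    rw [hr, Fin.revPerm_apply, Fin.revPerm_apply, Fin.rev_lt_rev]
    exact and_self_iff
  rw [h1, Finset.card_filter, Fintype.sum_prod_type_right, ← sum_val]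
  refine Finset.sum_congr rfl fun j _ => ?_
  rw [← Finset.card_filter, ← Fin.card_Iio j]
  congr 1
  ext x
  simp

theorem isHomogeneous_intSchubert (n : ℕ) (w : Perm (Fin n)) :
    (intSchubert n w).IsHomogeneous (permLength w) := by
  refine weakOrder_induction (P := fun w => (intSchubert n w).IsHomogeneous (permLength w)) ?_ ?_ w
  · rw [intSchubert_revPerm, permLength_eq, card_invSet_revPerm]
    apply isHomogeneous_monomial
    rw [Finsupp.degree_eq_sum, ← sum_stair]
    rfl
  · intro i h w hw ih
    rw [intSchubert_of_asc h w hw]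
    apply isHomogeneous_intDividedDiff
    rw [permLength_eq, ← card_invSet_of_asc h w hw, ← permLength_eq]
    exact ih

theorem degreeOf_intSchubert_le (n : ℕ) (w : Perm (Fin n)) (k : Fin n) :
    degreeOf k (intSchubert n w) ≤ stair n k := by
  refine weakOrder_induction (P := fun w => ∀ k, degreeOf k (intSchubert n w) ≤ stair n k)
    ?_ ?_ w k
  · intro k
    rw [intSchubert_revPerm, degreeOf_monomial_eq _ _ one_ne_zero, rho_apply]
  · intro i h w hw ih
    rw [intSchubert_of_asc h w hw]
    exact degreeOf_intDividedDiff_le h ih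

/-! ### Dominant permutations -/

/-- The Lehmer code of `w⁻¹`. -/
def code {n : ℕ} (w : Perm (Fin n)) (i : Fin n) : ℕ :=
  (Finset.univ.filter fun j => i < j ∧ w⁻¹ j < w⁻¹ i).card

theorem code_one {n : ℕ} (i : Fin n) : code (1 : Perm (Fin n)) i = 0 := by
  rw [code, Finset.card_eq_zero, Finset.filter_eq_empty_iff]
  rintro j - ⟨h1, h2⟩
  exact absurd h1 (not_lt.2 (by simpa using h2.le))

theorem code_revPerm {n : ℕ} (i : Fin n) : code (Fin.revPerm : Perm (Fin n)) i = stair n i := by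
  rw [code, stair, ← Fin.card_Ioi i]
  congr 1
  ext j
  have hr : (Fin.revPerm : Perm (Fin n))⁻¹ = Fin.revPerm := rfl
  rw [Finset.mem_filter, hr, Fin.revPerm_apply, Fin.revPerm_apply, Fin.rev_lt_rev, Finset.mem_Ioi]
  simp

theorem code_lt_of_desc {n i : ℕ} (h : i + 1 < n) (w : Perm (Fin n))
    (hw : w⁻¹ ⟨i + 1, h⟩ < w⁻¹ ⟨i, Nat.lt_of_succ_lt h⟩) :
    code w ⟨i + 1, h⟩ < code w ⟨i, Nat.lt_of_succ_lt h⟩ := by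
  apply Finset.card_lt_card
  rw [Finset.ssubset_iff_of_subset]
  · refine ⟨⟨i + 1, h⟩, ?_, ?_⟩
    · simpa using hw
    · simp
  · intro j
    simp only [Finset.mem_filter, Finset.mem_univ, true_and]
    rintro ⟨h1, h2⟩
    exact ⟨lt_trans (by simp [Fin.lt_def]) h1, h2.trans hw⟩

theorem code_le_of_asc {n i : ℕ} (h : i + 1 < n) (w : Perm (Fin n))
    (hw : w⁻¹ ⟨i, Nat.lt_of_succ_lt h⟩ < w⁻¹ ⟨i + 1, h⟩) :
    code w ⟨i, Nat.lt_of_succ_lt h⟩ ≤ code w ⟨i + 1, h⟩ := by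
  apply Finset.card_le_card
  intro j
  simp only [Finset.mem_filter, Finset.mem_univ, true_and]
  rintro ⟨h1, h2⟩
  refine ⟨lt_of_le_of_ne ?_ ?_, h2.trans hw⟩
  · rw [Fin.lt_def] at h1
    rw [Fin.le_def]
    exact h1
  · rintro rfl
    exact absurd hw (not_lt.2 h2.le)

/-- Left multiplication at an ascent exchanges the two code entries at `i` and `i + 1` and adds one
to the entry at `i`. When the two entries are equal, only the increment is visible. -/
theorem code_simpleRefl_mul {n i : ℕ} (h : i + 1 < n) (w : Perm (Fin n))
    (hw : w⁻¹ ⟨i, Nat.lt_of_succ_lt h⟩ < w⁻¹ ⟨i + 1, h⟩)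
    (he : code w ⟨i, Nat.lt_of_succ_lt h⟩ = code w ⟨i + 1, h⟩) (k : Fin n) :
    code (simpleRefl n i h * w) k = code w k + if (k : ℕ) = i then 1 else 0 := by
  have hc : code (simpleRefl n i h * w) k
      = (Finset.univ.filter fun j => k < simpleRefl n i h j ∧
          w⁻¹ j < w⁻¹ (simpleRefl n i h k)).card := by
    rw [code]
    refine Finset.card_bij' (fun j _ => simpleRefl n i h j) (fun j _ => simpleRefl n i h j)
      ?_ ?_ ?_ ?_
    · intro j hj
      simp only [Finset.mem_filter, Finset.mem_univ, true_and, inv_simpleRefl_mul,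
        simpleRefl_simpleRefl] at hj ⊢
      exact hj
    · intro j hj
      simp only [Finset.mem_filter, Finset.mem_univ, true_and, inv_simpleRefl_mul,
        simpleRefl_simpleRefl] at hj ⊢
      exact hj
    · intro j _
      exact simpleRefl_simpleRefl n i h j
    · intro j _
      exact simpleRefl_simpleRefl n i h j
  rw [hc]
  by_cases h1 : (k : ℕ) = i
  · have hk : k = ⟨i, Nat.lt_of_succ_lt h⟩ := Fin.ext h1
    subst hk
    rw [simpleRefl_left, if_pos rfl, he, code, ← Finset.card_insert_of_notMem
      (a := (⟨i, Nat.lt_of_succ_lt h⟩ : Fin n))]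
    · congr 1
      ext j
      simp only [Finset.mem_filter, Finset.mem_univ, true_and, Finset.mem_insert, Fin.lt_def,
        simpleRefl_val]
      constructor
      · rintro ⟨h2, h3⟩
        by_cases hj : (j : ℕ) = i
        · exact Or.inl (Fin.ext hj)
        · right
          refine ⟨?_, h3⟩
          split_ifs at h2 <;> omega
      · rintro (rfl | ⟨h2, h3⟩)
        · exact ⟨by simp, hw⟩
        · refine ⟨?_, h3⟩
          split_ifs <;> omega
    · intro hmem
      have h3 := Fin.lt_def.1 (Finset.mem_filter.1 hmem).2.1
      simp only at h3
      omega
  · rw [if_neg h1, add_zero]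
    by_cases h2 : (k : ℕ) = i + 1
    · have hk : k = ⟨i + 1, h⟩ := Fin.ext h2
      subst hk
      rw [simpleRefl_right, ← he, code]
      congr 1
      ext j
      simp only [Finset.mem_filter, Finset.mem_univ, true_and, Fin.lt_def, simpleRefl_val]
      refine and_congr_left fun h3 => ?_
      by_cases hj : (j : ℕ) = i + 1
      · have hj' : j = ⟨i + 1, h⟩ := Fin.ext hj
        subst hj'
        exact absurd hw (not_lt.2 (Fin.lt_def.2 h3).le)
      · split_ifs <;> omega
    · rw [simpleRefl_of_ne n i h k h1 h2, code]
      congr 1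
      ext j
      simp only [Finset.mem_filter, Finset.mem_univ, true_and, Fin.lt_def, simpleRefl_val]
      refine and_congr_left fun _ => ?_
      split_ifs <;> omega

/-- Climb from `w` to the longest element through dominant permutations, increasing one code entry
at each step; each divided difference on the way down removes one variable from a monomial. The case
needed afterwards is the identity, whose Schubert polynomial is thereby `1`. -/
theorem intSchubert_of_dominant {n : ℕ} (w : Perm (Fin n))
    (hw : ∀ (i : ℕ) (h : i + 1 < n), code w ⟨i + 1, h⟩ ≤ code w ⟨i, Nat.lt_of_succ_lt h⟩) :
    intSchubert n w = monomial (Finsupp.equivFunOnFinite.symm (code w)) 1 := by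
  generalize hm : n * n - (invSet w).card = m
  induction m using Nat.strong_induction_on generalizing w with
  | _ m ih =>
    by_cases hex : ∃ i, ∃ h : i + 1 < n,
        code w ⟨i, Nat.lt_of_succ_lt h⟩ = code w ⟨i + 1, h⟩
    · classical
      -- The leftmost equality is chosen so that the preceding code entry, if any, is strictly
      -- larger, and the code remains weakly decreasing after its entry at `i` is increased.
      obtain ⟨i, ⟨h, he⟩, hmin⟩ : ∃ i, (∃ h : i + 1 < n,
          code w ⟨i, Nat.lt_of_succ_lt h⟩ = code w ⟨i + 1, h⟩) ∧
          ∀ j < i, ¬ ∃ h : j + 1 < n, code w ⟨j, Nat.lt_of_succ_lt h⟩ = code w ⟨j + 1, h⟩ :=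
        ⟨Nat.find hex, Nat.find_spec hex, fun j => Nat.find_min hex⟩
      have hasc : w⁻¹ ⟨i, Nat.lt_of_succ_lt h⟩ < w⁻¹ ⟨i + 1, h⟩ := by
        rcases asc_or_desc h w with h2 | h2
        · exact h2
        · exact absurd (code_lt_of_desc h w h2) (by rw [he]; exact lt_irrefl _)
      have hcode := code_simpleRefl_mul h w hasc he
      have c := card_invSet_of_asc h w hasc
      have cle := card_invSet_le (simpleRefl n i h * w)
      have hS := ih _ (by omega) (simpleRefl n i h * w) (by
        intro j hj
        rw [hcode, hcode]
        have h1 := hw j hj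
        by_cases hji : j + 1 = i
        · have h2 : code w ⟨j, Nat.lt_of_succ_lt hj⟩ ≠ code w ⟨j + 1, hj⟩ :=
            fun e => hmin j (by omega) ⟨hj, e⟩
          split_ifs <;> omega
        · rw [if_neg hji]
          omega) rfl
      rw [intSchubert_of_asc h w hasc, hS]
      -- With equal exponents at `i` and `i + 1`, the numerator is `(x_i - x_{i+1}) x^code`, so the
      -- quotient is the monomial itself.
      apply eq_intDividedDiff
      rw [rename_monomial, sub_mul, X, X, monomial_mul, monomial_mul, one_mul]
      refine congrArg₂ (· - ·) (congrArg (fun s => monomial s (1 : ℤ)) ?_)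
        (congrArg (fun s => monomial s (1 : ℤ)) ?_)
      · ext k
        simp only [Finsupp.add_apply, Finsupp.equivFunOnFinite_symm_apply_apply, hcode,
          Finsupp.single_apply, Fin.ext_iff]
        rw [add_comm]
        simp only [eq_comm]
      · ext k
        rw [Finsupp.mapDomain_equiv_apply]
        have hsymm : (simpleRefl n i h).symm k = simpleRefl n i h k := by
          rw [Equiv.symm_apply_eq, simpleRefl_simpleRefl]
        rw [hsymm]
        simp only [Finsupp.add_apply, Finsupp.equivFunOnFinite_symm_apply_apply, hcode,
          Finsupp.single_apply, Fin.ext_iff]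
        by_cases h1 : (k : ℕ) = i
        · have hk : k = ⟨i, Nat.lt_of_succ_lt h⟩ := Fin.ext h1
          subst hk
          rw [simpleRefl_left, he]
          simp
        · by_cases h2 : (k : ℕ) = i + 1
          · have hk : k = ⟨i + 1, h⟩ := Fin.ext h2
            subst hk
            rw [simpleRefl_right, he, add_comm]
            simp
          · rw [simpleRefl_of_ne n i h k h1 h2, if_neg h1, if_neg (Ne.symm h2), add_comm]
    -- An ascent makes the code weakly increase there, and dominance would turn this into an
    -- equality. So without equalities there are no ascents.
    · have hrev : w = Fin.revPerm := by
        apply eq_revPerm_of_forall_desc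
        intro i h
        rcases asc_or_desc h w with h2 | h2
        · exact absurd ⟨i, h, le_antisymm (code_le_of_asc h w h2) (hw i h)⟩ hex
        · exact h2
      rw [hrev, intSchubert_revPerm]
      refine congrArg (fun s => monomial s (1 : ℤ)) ?_
      ext i
      rw [Finsupp.equivFunOnFinite_symm_apply_apply, code_revPerm, rho_apply]

theorem intSchubert_one (n : ℕ) : intSchubert n 1 = 1 := by
  rw [intSchubert_of_dominant 1 fun i h => by rw [code_one, code_one]]
  have : (Finsupp.equivFunOnFinite.symm (code (1 : Perm (Fin n))) : Fin n →₀ ℕ) = 0 := by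
    ext i
    rw [Finsupp.equivFunOnFinite_symm_apply_apply, code_one, Finsupp.zero_apply]
  rw [this]
  rfl

/-! ### Schubert polynomials as an integral basis -/

/-- The functional dual to `w` is the constant term after the divided differences along a reduced
word of `w`. A divided difference permutes the Schubert polynomials with a descent down one step and
kills the others, and homogeneity makes the constant term detect length zero. -/
theorem exists_dual_intSchubert {n : ℕ} (w : Perm (Fin n)) :
    ∃ η : MvPolynomial (Fin n) ℤ →+ ℤ, ∀ v, η (intSchubert n v) = if v = w then 1 else 0 := by
  generalize hm : (invSet w).card = m
  induction m generalizing w with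
  | zero =>
    have hlen : ∀ v : Perm (Fin n), permLength v = 0 → v = 1 := by
      intro v hv
      rw [permLength_eq] at hv
      obtain ⟨L, h1, -, h3⟩ := isWordProd_card_invSet v
      rw [hv, List.length_eq_zero_iff] at h1
      rw [← h3, h1, List.prod_nil]
    have hw : w = 1 := hlen w (by rw [permLength_eq, hm])
    subst hw
    refine ⟨(constantCoeff : MvPolynomial (Fin n) ℤ →+* ℤ).toAddMonoidHom, fun v => ?_⟩
    split_ifs with hv
    · rw [hv, intSchubert_one]
      exact (constantCoeff : MvPolynomial (Fin n) ℤ →+* ℤ).map_one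
    · refine (isHomogeneous_intSchubert n v).coeff_eq_zero ?_
      rw [map_zero]
      exact fun h => hv (hlen v h.symm)
  | succ m ih =>
    obtain ⟨i, h, hd⟩ : ∃ i, ∃ h : i + 1 < n,
        w⁻¹ ⟨i + 1, h⟩ < w⁻¹ ⟨i, Nat.lt_of_succ_lt h⟩ := by
      by_contra hcon
      have : w⁻¹ = 1 := by
        apply eq_one_of_forall_asc
        intro i h
        rcases asc_or_desc h w with h1 | h1
        · exact h1
        · exact absurd ⟨i, h, h1⟩ hcon
      have h2 : w = 1 := by rw [← inv_inv w, this, inv_one]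
      rw [h2, invSet_one] at hm
      simp at hm
    have c := card_invSet_of_desc h w hd
    obtain ⟨η, hη⟩ := ih (simpleRefl n i h * w) (by omega)
    -- If `v` has an ascent at `i`, its polynomial is killed and `v ≠ w`. Otherwise the claim is
    -- that of the induction hypothesis with `s_i` cancelled on both sides.
    refine ⟨η.comp (intDividedDiff n i h), fun v => ?_⟩
    rw [AddMonoidHom.comp_apply]
    rcases asc_or_desc h v with hv | hv
    · rw [intDividedDiff_intSchubert_of_asc h v hv, map_zero, if_neg]
      rintro rfl
      exact absurd hv (not_lt.2 hd.le)
    · rw [intDividedDiff_intSchubert_of_desc h v hv, hη]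
      simp only [mul_right_inj]

/-- The coefficients of the Schubert polynomials of length `d`. -/
noncomputable def schubertMatrix (n d : ℕ) : Matrix (Level n d) (degBox (stair n) d) ℤ :=
  Matrix.of fun w α => coeff (Finsupp.equivFunOnFinite.symm (α : Fin n → ℕ)) (intSchubert n w)

theorem mem_degBox_of_coeff_ne_zero {n : ℕ} {w : Perm (Fin n)} {s : Fin n →₀ ℕ}
    (h : coeff s (intSchubert n w) ≠ 0) : (s : Fin n → ℕ) ∈ degBox (stair n) (permLength w) := by
  rw [mem_degBox]
  constructor
  · intro i
    exact (monomial_le_degreeOf i (mem_support_iff.2 h)).trans (degreeOf_intSchubert_le n w i)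
  · by_contra hne
    apply h
    apply (isHomogeneous_intSchubert n w).coeff_eq_zero
    rwa [Finsupp.degree_eq_sum]

theorem card_box_stair (n : ℕ) : (box (stair n)).card = n.factorial := by
  rw [box, Fintype.card_piFinset]
  simp only [Finset.card_range]
  rw [← Equiv.prod_comp Fin.revPerm, ← Finset.prod_range_add_one_eq_factorial,
    ← Fin.prod_univ_eq_prod_range (fun i => i + 1)]
  refine Finset.prod_congr rfl fun i _ => ?_
  have := i.2
  simp only [stair, Fin.revPerm_apply, Fin.val_rev]
  omega

/-- The integral dual functionals give a right inverse of the coefficient matrix on the whole box.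
That matrix is square, since both index sets have `n!` elements, so the inverse is two-sided;
homogeneity then isolates the block of each degree. -/
theorem exists_inverse_schubertMatrix (n d : ℕ) :
    ∃ B : Matrix (degBox (stair n) d) (Level n d) ℤ,
      schubertMatrix n d * B = 1 ∧ B * schubertMatrix n d = 1 := by
  choose η hη using fun w : Perm (Fin n) => exists_dual_intSchubert w
  let T : Matrix (Perm (Fin n)) (box (stair n)) ℤ :=
    Matrix.of fun w α => coeff (Finsupp.equivFunOnFinite.symm (α : Fin n → ℕ)) (intSchubert n w)
  let H : Matrix (box (stair n)) (Perm (Fin n)) ℤ :=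
    Matrix.of fun α w => η w (monomial (Finsupp.equivFunOnFinite.symm (α : Fin n → ℕ)) 1)
  have hmem : ∀ w (s : Fin n →₀ ℕ), coeff s (intSchubert n w) ≠ 0 →
      (s : Fin n → ℕ) ∈ box (stair n) := fun w s h =>
    (Finset.mem_filter.1 (mem_degBox_of_coeff_ne_zero h)).1
  have hTH : T * H = 1 := by
    ext v w
    rw [Matrix.mul_apply, Matrix.one_apply, ← hη w v]
    conv_rhs => rw [(intSchubert n v).as_sum, map_sum]
    symm
    -- The zero vector is only a default value: every exponent in the support of a Schubert
    -- polynomial lies in the box.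
    apply Finset.sum_of_injOn (fun s : Fin n →₀ ℕ => if hs : (s : Fin n → ℕ) ∈ box (stair n) then
      (⟨s, hs⟩ : box (stair n)) else ⟨0, mem_box.2 fun i => Nat.zero_le _⟩)
    · intro s hs t ht hst
      simp only [hmem v s (mem_support_iff.1 hs), hmem v t (mem_support_iff.1 ht), dif_pos,
        Subtype.mk.injEq] at hst
      exact DFunLike.coe_injective hst
    · intro s _
      exact Finset.mem_coe.2 (Finset.mem_univ _)
    · intro α _ hα
      have : coeff (Finsupp.equivFunOnFinite.symm (α : Fin n → ℕ)) (intSchubert n v) = 0 := by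
        by_contra hne
        refine hα ⟨_, mem_support_iff.2 hne, ?_⟩
        beta_reduce
        rw [dif_pos (hmem v _ hne)]
        rfl
      simp only [T, Matrix.of_apply, this, zero_mul]
    · intro s hs
      rw [dif_pos (hmem v s (mem_support_iff.1 hs))]
      simp only [T, H, Matrix.of_apply]
      have e1 : (Finsupp.equivFunOnFinite.symm (s : Fin n → ℕ)) = s :=
        Finsupp.equivFunOnFinite_symm_coe s
      rw [e1, ← smul_eq_mul (a := coeff s (intSchubert n v)), ← map_zsmul, smul_monomial,
        smul_eq_mul, mul_one]
  have hcard : Fintype.card (Perm (Fin n)) = Fintype.card (box (stair n)) := by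
    rw [Fintype.card_coe, card_box_stair, Fintype.card_perm, Fintype.card_fin]
  obtain ⟨e⟩ := Fintype.card_eq.1 hcard
  have hHT : H * T = 1 := (Matrix.mul_eq_one_comm_of_equiv e).1 hTH
  have hsub : degBox (stair n) d ⊆ box (stair n) := Finset.filter_subset _ _
  have hinj : Function.Injective (Set.inclusion hsub :
      degBox (stair n) d → box (stair n)) := Set.inclusion_injective _
  have h1 := submatrix_mul_submatrix_eq_one hTH
    (e := ((↑) : Level n d → Perm (Fin n))) Subtype.val_injective hinj (by
      intro w α hα
      have := mem_degBox_of_coeff_ne_zero hα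
      rw [w.2] at this
      exact ⟨⟨_, this⟩, rfl⟩)
  have hTt : T.transpose * H.transpose = 1 := by
    rw [← Matrix.transpose_mul, hHT, Matrix.transpose_one]
  have h2 := submatrix_mul_submatrix_eq_one hTt hinj
    (f := ((↑) : Level n d → Perm (Fin n))) Subtype.val_injective (by
      intro α w hα
      have h3 := mem_degBox.1 (mem_degBox_of_coeff_ne_zero hα)
      have h4 := (mem_degBox.1 α.2).2
      exact ⟨⟨w, h3.2.symm.trans h4⟩, rfl⟩)
  refine ⟨_, h1, ?_⟩
  have h3 := congrArg Matrix.transpose h2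
  rw [Matrix.transpose_mul, Matrix.transpose_one] at h3
  exact h3

/-- This expresses the rank numbers through boxes of exponents, where the ballot count applies. -/
theorem card_level (n d : ℕ) : Fintype.card (Level n d) = (degBox (stair n) d).card := by
  obtain ⟨B, h1, h2⟩ := exists_inverse_schubertMatrix n d
  rw [← Fintype.card_coe]
  exact Matrix.square_of_invertible _ _ h1 h2

/-! ### Powers of a lowering operator -/

/-- Stated for an abstract family `v`, so that it applies both to `∇` on padded monomials and to `Δ`
on complementary ones. The new step contributes the factor `C(k+1, 1)`, which turns `k!` into
`(k+1)!`. -/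
theorem pow_apply_of_lowering {R M : Type*} [CommRing R] [AddCommGroup M] [Module R M] {r : ℕ}
    {m : Fin r → ℕ} (D : Module.End R M) (v : (Fin r → ℕ) → M)
    (hD : ∀ α ∈ box m, D (v α) = ∑ i, α i • v (Function.update α i (α i - 1)))
    (k d : ℕ) {α : Fin r → ℕ} (hα : α ∈ degBox m (d + k)) :
    (D ^ k) (v α) = ∑ β ∈ degBox m d, (k.factorial * binomProd β α) • v β := by
  have hone : ∀ d, ∀ α ∈ degBox m (d + 1), D (v α) = ∑ β ∈ degBox m d, binomProd β α • v β := by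
    intro d α hα
    rw [sum_binomProd_smul hα, hD α (Finset.mem_filter.1 hα).1]
  induction k generalizing d with
  | zero =>
    rw [add_zero] at hα
    rw [Finset.sum_eq_single_of_mem α hα]
    · simp [binomProd_self]
    · intro β hβ hne
      have : binomProd β α = 0 := by
        by_contra h0
        apply hne
        have hle := le_of_binomProd_ne_zero h0
        have h3 := (Finset.sum_eq_sum_iff_of_le fun j (_ : j ∈ Finset.univ) => hle j).1
          (by rw [(mem_degBox.1 hβ).2, (mem_degBox.1 hα).2])
        exact funext fun j => h3 j (Finset.mem_univ j)
      rw [this, mul_zero, zero_smul]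
  | succ k ih =>
    rw [pow_succ', Module.End.mul_apply, ih (d + 1) (by rwa [add_right_comm, add_assoc]), map_sum]
    have h1 : ∀ β ∈ degBox m (d + 1), D ((k.factorial * binomProd β α) • v β)
        = ∑ γ ∈ degBox m d, (k.factorial * (binomProd γ β * binomProd β α)) • v γ := by
      intro β hβ
      rw [map_nsmul, hone d β hβ, Finset.smul_sum]
      refine Finset.sum_congr rfl fun γ _ => ?_
      rw [smul_smul]
      congr 1
      ring
    rw [Finset.sum_congr rfl h1, Finset.sum_comm]
    refine Finset.sum_congr rfl fun γ hγ => ?_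
    have hα' := mem_degBox.1 hα
    have hγ' := mem_degBox.1 hγ
    rw [← Finset.sum_smul, ← Finset.mul_sum,
      sum_binomProd_mul_binomProd hα'.1 (by omega), hα'.2, hγ'.2,
      show d + (k + 1) - d = k + 1 by omega, show d + 1 - d = 1 by omega, Nat.choose_one_right,
      Nat.factorial_succ]
    congr 1
    ring

/-! ### The operators on padded monomials -/

/-- The padded monomial with exponent vector `α`. -/
noncomputable def padMon (n : ℕ) (α : Fin n → ℕ) : MvPolynomial (Fin n ⊕ Fin n) ℂ :=
  paddedMonomial n (Finsupp.equivFunOnFinite.symm α)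

/-- The complement of an exponent vector in the staircase. -/
def compl {n : ℕ} (α : Fin n → ℕ) : Fin n → ℕ := fun i => stair n i - α i

theorem compl_mem_degBox {n d e : ℕ} (h : d + e = n.choose 2) {α : Fin n → ℕ}
    (hα : α ∈ degBox (stair n) d) : compl α ∈ degBox (stair n) e := by
  rw [mem_degBox] at hα ⊢
  refine ⟨fun i => Nat.sub_le _ _, ?_⟩
  have h1 : ∑ i, compl α i + ∑ i, α i = ∑ i, stair n i := by
    rw [← Finset.sum_add_distrib]
    exact Finset.sum_congr rfl fun i _ => Nat.sub_add_cancel (hα.1 i)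
  rw [sum_stair] at h1
  omega

theorem compl_compl {n : ℕ} {α : Fin n → ℕ} (hα : α ∈ box (stair n)) : compl (compl α) = α := by
  funext i
  have := mem_box.1 hα i
  simp only [compl]
  omega

/-- Complementation exchanges complementary degrees. -/
def complEquiv {n d e : ℕ} (h : d + e = n.choose 2) :
    degBox (stair n) d ≃ degBox (stair n) e where
  toFun α := ⟨compl α, compl_mem_degBox h α.2⟩
  invFun α := ⟨compl α, compl_mem_degBox ((add_comm e d).trans h) α.2⟩
  left_inv α := Subtype.ext (compl_compl (Finset.mem_filter.1 α.2).1)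
  right_inv α := Subtype.ext (compl_compl (Finset.mem_filter.1 α.2).1)

/-- The operators omit the last variable, whose staircase exponent is zero; allowing it adds
nothing. -/
theorem sum_filter_stair {n : ℕ} {M : Type*} [AddCommMonoid M] (F : Fin n → M)
    (hF : ∀ i, stair n i = 0 → F i = 0) :
    ∑ i ∈ Finset.univ.filter (fun i : Fin n => (i : ℕ) + 1 < n), F i = ∑ i, F i := by
  refine Finset.sum_subset (Finset.subset_univ _) fun i _ hi => hF i ?_
  simp only [Finset.mem_filter, Finset.mem_univ, true_and] at hi
  simp only [stair]
  omega

theorem nablaPoly_padMon {n : ℕ} {α : Fin n → ℕ} (hα : α ∈ box (stair n)) :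
    nablaPoly n (padMon n α) = ∑ i, α i • padMon n (Function.update α i (α i - 1)) := by
  rw [mem_box] at hα
  simp only [nablaPoly, LinearMap.sum_apply, LinearMap.comp_apply, LinearMap.mulLeft_apply,
    Derivation.coeFn_coe]
  rw [sum_filter_stair]
  · refine Finset.sum_congr rfl fun i _ => ?_
    rw [padMon, paddedMonomial, pderiv_monomial, X, monomial_mul, one_mul, one_mul,
      Finsupp.sumElim_inl, Finsupp.equivFunOnFinite_symm_apply_apply]
    rcases Nat.eq_zero_or_pos (α i) with h0 | hpos
    · rw [h0, Nat.cast_zero, monomial_zero, zero_smul]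
    · rw [padMon, paddedMonomial, ← Nat.cast_smul_eq_nsmul ℂ, smul_monomial, smul_eq_mul, mul_one]
      refine congrArg (fun s => monomial s (α i : ℂ)) ?_
      ext (k | k)
      · by_cases hik : k = i
        · subst hik
          simp
        · simp [hik]
      · have hk := hα k
        by_cases hik : k = i
        · subst hik
          simp [rho_apply]
          omega
        · simp [hik]
  · intro i hi
    have h0 : α i = 0 := by have := hα i; omega
    rw [padMon, paddedMonomial, pderiv_monomial, Finsupp.sumElim_inl,
      Finsupp.equivFunOnFinite_symm_apply_apply, h0, Nat.cast_zero, mul_zero, monomial_zero,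
      mul_zero]

theorem deltaPoly_padMon_compl {n : ℕ} {α : Fin n → ℕ} (hα : α ∈ box (stair n)) :
    deltaPoly n (padMon n (compl α))
      = ∑ i, α i • padMon n (compl (Function.update α i (α i - 1))) := by
  rw [mem_box] at hα
  have hc : ∀ i, (rho n - Finsupp.equivFunOnFinite.symm (compl α) : Fin n →₀ ℕ) i = α i := by
    intro i
    have := hα i
    rw [Finsupp.tsub_apply, Finsupp.equivFunOnFinite_symm_apply_apply, rho_apply, compl]
    omega
  simp only [deltaPoly, LinearMap.sum_apply, LinearMap.comp_apply, LinearMap.mulLeft_apply,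
    Derivation.coeFn_coe]
  rw [sum_filter_stair]
  · refine Finset.sum_congr rfl fun i _ => ?_
    rw [padMon, paddedMonomial, pderiv_monomial, X, monomial_mul, one_mul, one_mul,
      Finsupp.sumElim_inr, hc]
    rcases Nat.eq_zero_or_pos (α i) with h0 | hpos
    · rw [h0, Nat.cast_zero, monomial_zero, zero_smul]
    · rw [padMon, paddedMonomial, ← Nat.cast_smul_eq_nsmul ℂ, smul_monomial, smul_eq_mul, mul_one]
      refine congrArg (fun s => monomial s (α i : ℂ)) ?_
      ext (k | k)
      · have hk := hα k
        by_cases hik : k = i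
        · subst hik
          simp [compl]
          omega
        · simp [compl, hik]
      · have hk := hα k
        by_cases hik : k = i
        · subst hik
          simp [rho_apply, compl]
          omega
        · simp [rho_apply, compl, hik]
  · intro i hi
    have h0 : α i = 0 := by have := hα i; omega
    rw [padMon, paddedMonomial, pderiv_monomial, Finsupp.sumElim_inr, hc, h0, Nat.cast_zero,
      mul_zero, monomial_zero, mul_zero]

theorem nablaPoly_pow_padMon {n d e k : ℕ} (h : e = d + k) (α : degBox (stair n) e) :
    (nablaPoly n ^ k) (padMon n α) = ∑ β : degBox (stair n) d,
      ((((k.factorial : ℤ) • lowering (stair n) d e) β α : ℤ) : ℂ) • padMon n β := by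
  subst h
  rw [pow_apply_of_lowering (nablaPoly n) (padMon n) (fun α hα => nablaPoly_padMon hα) k d α.2,
    ← Finset.sum_coe_sort]
  refine Finset.sum_congr rfl fun β _ => ?_
  rw [← Nat.cast_smul_eq_nsmul ℂ]
  simp [lowering]

theorem deltaPoly_pow_padMon {n d e k : ℕ} (h : e = d + k) (he : e ≤ n.choose 2)
    (α : degBox (stair n) d) :
    (deltaPoly n ^ k) (padMon n α) = ∑ β : degBox (stair n) e,
      ((((k.factorial : ℤ) • (lowering (stair n) (n.choose 2 - e) (n.choose 2 - d)).submatrix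
        (complEquiv (by omega)) (complEquiv (by omega))) β α : ℤ) : ℂ) • padMon n β := by
  have hα := compl_mem_degBox (e := n.choose 2 - d) (by omega) α.2
  -- Indexed by the exponents of the `y` variables, `Δ` is a lowering operator, so the formula for
  -- `∇` applies between the complementary degrees.
  have h1 := pow_apply_of_lowering (deltaPoly n) (fun α => padMon n (compl α))
    (fun α hα => deltaPoly_padMon_compl hα) k (n.choose 2 - e)
    (α := compl (α : Fin n → ℕ)) (by convert hα using 2; omega)
  rw [compl_compl (Finset.mem_filter.1 α.2).1] at h1
  rw [h1, ← Finset.sum_coe_sort, ← Equiv.sum_comp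
    (complEquiv (d := e) (e := n.choose 2 - e) (by omega))]
  refine Finset.sum_congr rfl fun β _ => ?_
  rw [← Nat.cast_smul_eq_nsmul ℂ]
  have h2 : ((complEquiv (e := n.choose 2 - e) (by omega) β : degBox (stair n) _) : Fin n → ℕ)
      = compl β := rfl
  have h3 : ((complEquiv (e := n.choose 2 - d) (by omega) α : degBox (stair n) _) : Fin n → ℕ)
      = compl α := rfl
  rw [h2, compl_compl (Finset.mem_filter.1 β.2).1]
  simp [lowering, h2, h3]

/-! ### The padded Schubert basis -/

theorem schubert_eq_sum {n d : ℕ} (w : Level n d) :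
    schubert n w = ∑ α : degBox (stair n) d, ((schubertMatrix n d w α : ℤ) : ℂ) •
      monomial (Finsupp.equivFunOnFinite.symm (α : Fin n → ℕ)) 1 := by
  classical
  ext s
  rw [← map_intSchubert, coeff_map, eq_intCast]
  simp only [coeff_sum, coeff_smul, coeff_monomial]
  by_cases hs : coeff s (intSchubert n w) = 0
  · rw [hs, Int.cast_zero, Finset.sum_eq_zero]
    intro α _
    split_ifs with h
    · rw [schubertMatrix, Matrix.of_apply, h, hs, Int.cast_zero, zero_smul]
    · rw [smul_zero]
  · have hmem := mem_degBox_of_coeff_ne_zero hs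
    rw [w.2] at hmem
    rw [Finset.sum_eq_single (⟨s, hmem⟩ : degBox (stair n) d)]
    · simp [schubertMatrix]
    · intro α _ hα
      rw [if_neg, smul_zero]
      intro h
      apply hα
      apply Subtype.ext
      exact congrArg (fun t : Fin n →₀ ℕ => (t : Fin n → ℕ)) h
    · intro h
      exact absurd (Finset.mem_univ _) h

theorem paddedSchubert_eq_sum {n d : ℕ} (w : Level n d) :
    paddedSchubert n w = ∑ α : degBox (stair n) d, ((schubertMatrix n d w α : ℤ) : ℂ) •
      padMon n α := by
  rw [paddedSchubert, schubert_eq_sum, map_sum]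
  refine Finset.sum_congr rfl fun α _ => ?_
  rw [map_smul, padMon, pad]
  congr 1
  have h := (basisMonomials (Fin n) ℂ).constr_basis ℂ (paddedMonomial n)
    (Finsupp.equivFunOnFinite.symm (α : Fin n → ℕ))
  rwa [coe_basisMonomials] at h

theorem padMon_eq_sum {n d : ℕ} {B : Matrix (degBox (stair n) d) (Level n d) ℤ}
    (hB : B * schubertMatrix n d = 1) (α : degBox (stair n) d) :
    padMon n α = ∑ w : Level n d, ((B α w : ℤ) : ℂ) • paddedSchubert n w := by
  simp only [paddedSchubert_eq_sum, Finset.smul_sum, smul_smul]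
  rw [Finset.sum_comm]
  simp only [← Finset.sum_smul]
  rw [Finset.sum_eq_single α]
  · have h1 := congrFun (congrFun hB α) α
    rw [Matrix.mul_apply, Matrix.one_apply_eq] at h1
    have h2 : ∑ w, ((B α w : ℤ) : ℂ) * ((schubertMatrix n d w α : ℤ) : ℂ) = 1 := by
      exact_mod_cast h1
    rw [h2, one_smul]
  · intro β _ hβ
    have h1 := congrFun (congrFun hB α) β
    rw [Matrix.mul_apply, Matrix.one_apply_ne hβ.symm] at h1
    have h2 : ∑ w, ((B α w : ℤ) : ℂ) * ((schubertMatrix n d w β : ℤ) : ℂ) = 0 := by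
      exact_mod_cast h1
    rw [h2, zero_smul]
  · intro h
    exact absurd (Finset.mem_univ _) h

theorem paddedSpace_eq_span (n : ℕ) : paddedSpace n
    = Submodule.span ℂ (Set.range fun α : box (stair n) => padMon n α) := by
  rw [paddedSpace]
  congr 1
  ext f
  constructor
  · rintro ⟨α, hα, rfl⟩
    refine ⟨⟨α, mem_box.2 fun i => hα i⟩, ?_⟩
    simp [padMon]
  · rintro ⟨α, rfl⟩
    exact ⟨Finsupp.equivFunOnFinite.symm (α : Fin n → ℕ), fun i => mem_box.1 α.2 i, rfl⟩

theorem padMon_mem {n : ℕ} {α : Fin n → ℕ} (hα : α ∈ box (stair n)) :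
    padMon n α ∈ paddedSpace n := by
  rw [paddedSpace_eq_span]
  exact Submodule.subset_span ⟨⟨α, hα⟩, rfl⟩

theorem finrank_paddedSpace (n : ℕ) : Module.finrank ℂ (paddedSpace n) = n.factorial := by
  have hli : LinearIndependent ℂ fun α : box (stair n) => padMon n α := by
    have h1 := (basisMonomials (Fin n ⊕ Fin n) ℂ).linearIndependent
    rw [coe_basisMonomials] at h1
    refine h1.comp (fun α : box (stair n) => Finsupp.sumElim
      (Finsupp.equivFunOnFinite.symm (α : Fin n → ℕ))
      (rho n - Finsupp.equivFunOnFinite.symm (α : Fin n → ℕ))) ?_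
    intro α β hαβ
    apply Subtype.ext
    funext i
    have h2 := DFunLike.congr_fun hαβ (Sum.inl i)
    simpa using h2
  rw [paddedSpace_eq_span, finrank_span_eq_card hli, Fintype.card_coe, card_box_stair]

theorem paddedSchubert_mem (n : ℕ) (w : Perm (Fin n)) : paddedSchubert n w ∈ paddedSpace n := by
  have h := paddedSchubert_eq_sum (⟨w, rfl⟩ : Level n (permLength w))
  rw [h]
  exact Submodule.sum_mem _ fun α _ => Submodule.smul_mem _ _
    (padMon_mem (Finset.mem_filter.1 α.2).1)

/-- Inverting the coefficient matrix degree by degree shows that the padded Schubert polynomials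
span, and their number equals the dimension `n!`. -/
theorem exists_paddedSchubert_basis (n : ℕ) :
    ∃ b : Module.Basis (Perm (Fin n)) ℂ (paddedSpace n),
      ∀ w, (b w : MvPolynomial (Fin n ⊕ Fin n) ℂ) = paddedSchubert n w := by
  have hspan : ⊤ ≤ Submodule.span ℂ (Set.range fun w : Perm (Fin n) =>
      (⟨paddedSchubert n w, paddedSchubert_mem n w⟩ : paddedSpace n)) := by
    have h1 : (paddedSpace n) ≤ (Submodule.span ℂ (Set.range fun w : Perm (Fin n) =>
      (⟨paddedSchubert n w, paddedSchubert_mem n w⟩ : paddedSpace n))).map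
        (paddedSpace n).subtype := by
      conv_lhs => rw [paddedSpace_eq_span]
      rw [Submodule.span_le]
      rintro _ ⟨α, rfl⟩
      obtain ⟨B, -, hB⟩ := exists_inverse_schubertMatrix n (∑ i, (α : Fin n → ℕ) i)
      have h2 := padMon_eq_sum hB ⟨α, Finset.mem_filter.2 ⟨α.2, rfl⟩⟩
      simp only at h2
      rw [SetLike.mem_coe]
      beta_reduce
      rw [h2]
      refine Submodule.sum_mem _ fun w _ => Submodule.smul_mem _ _ ?_
      exact ⟨_, Submodule.subset_span ⟨w, rfl⟩, rfl⟩
    intro x _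
    obtain ⟨y, hy, hyx⟩ := h1 x.2
    have : y = x := Subtype.ext hyx
    exact this ▸ hy
  refine ⟨basisOfTopLeSpanOfCardEqFinrank _ hspan ?_, fun w => ?_⟩
  · rw [finrank_paddedSpace, Fintype.card_perm, Fintype.card_fin]
  · rw [coe_basisOfTopLeSpanOfCardEqFinrank]

/-- Change of basis from padded monomials to padded Schubert polynomials. -/
theorem exists_matrix_paddedSchubert {n d e : ℕ}
    (D : Module.End ℂ (MvPolynomial (Fin n ⊕ Fin n) ℂ))
    (M : Matrix (degBox (stair n) e) (degBox (stair n) d) ℤ)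
    (hM : ∀ α : degBox (stair n) d,
      D (padMon n α) = ∑ β : degBox (stair n) e, ((M β α : ℤ) : ℂ) • padMon n β) :
    ∃ A : Matrix (Level n e) (Level n d) ℤ, UnimodEquiv M A ∧
      ∀ u : Level n d, D (paddedSchubert n u)
        = ∑ w : Level n e, ((A w u : ℤ) : ℂ) • paddedSchubert n w := by
  obtain ⟨B, hB, hB'⟩ := exists_inverse_schubertMatrix n e
  obtain ⟨C, hC, hC'⟩ := exists_inverse_schubertMatrix n d
  refine ⟨B.transpose * M * (schubertMatrix n d).transpose,
    ⟨B.transpose, (schubertMatrix n e).transpose, (schubertMatrix n d).transpose, C.transpose,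
      ?_, ?_, ?_, ?_, rfl⟩, ?_⟩
  · rw [← Matrix.transpose_mul, hB, Matrix.transpose_one]
  · rw [← Matrix.transpose_mul, hB', Matrix.transpose_one]
  · rw [← Matrix.transpose_mul, hC', Matrix.transpose_one]
  · rw [← Matrix.transpose_mul, hC, Matrix.transpose_one]
  · intro u
    rw [paddedSchubert_eq_sum u, map_sum]
    simp only [map_smul, hM, padMon_eq_sum hB', Finset.smul_sum, smul_smul]
    conv_lhs =>
      enter [2, α]
      rw [Finset.sum_comm]
    rw [Finset.sum_comm]
    refine Finset.sum_congr rfl fun w _ => ?_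
    simp only [← Finset.sum_smul]
    congr 1
    simp only [Matrix.mul_apply, Matrix.transpose_apply, Int.cast_sum, Int.cast_mul,
      Finset.sum_mul]
    refine Finset.sum_congr rfl fun α _ => Finset.sum_congr rfl fun β _ => ?_
    ring

/-! ### The diagonal form -/

/-- Because `2ℓ ≤ N`, the upper condition is automatic for ballot vectors with sum `i ≤ ℓ`. Those
with sum exactly `i` are the ones that become active when the degree passes from `i - 1` to `i`. The
inclusion of the two sets makes the truncated subtraction in `rankJump` a true difference. -/
theorem card_filter_lowBallot {n ℓ i : ℕ} (hℓ : 2 * ℓ ≤ n.choose 2) (hi : i ≤ ℓ) :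
    ((lowBallot (stair n) ℓ).filter fun γ => ∑ k, γ k = i).card = rankJump n i := by
  have hN := sum_stair n
  cases i with
  | zero =>
    rw [rankJump, card_level, ← card_lowBallot]
    congr 1
    ext γ
    rw [Finset.mem_filter, mem_lowBallot, mem_lowBallot, hN]
    constructor
    · rintro ⟨⟨h1, h2, h3⟩, h4⟩
      exact ⟨h1, by omega, by omega⟩
    · rintro ⟨h1, h2, h3⟩
      exact ⟨⟨h1, by omega, by omega⟩, by omega⟩
  | succ i =>
    have hsub : lowBallot (stair n) i ⊆ lowBallot (stair n) (i + 1) :=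
      lowBallot_subset (by omega) (by omega)
    rw [rankJump, card_level, card_level, ← card_lowBallot, ← card_lowBallot,
      ← Finset.card_sdiff_of_subset hsub]
    congr 1
    ext γ
    rw [Finset.mem_filter, Finset.mem_sdiff, mem_lowBallot, mem_lowBallot, mem_lowBallot, hN]
    constructor
    · rintro ⟨⟨h1, h2, h3⟩, h4⟩
      exact ⟨⟨h1, by omega, by omega⟩, fun h5 => by omega⟩
    · rintro ⟨⟨h1, h2, h3⟩, h4⟩
      have h5 : ∑ k, γ k = i + 1 := by
        by_contra hne
        exact h4 ⟨h1, by omega, by omega⟩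
      exact ⟨⟨h1, by omega, by omega⟩, h5⟩

theorem exists_equiv_lowBallot {n ℓ : ℕ} (hℓ : 2 * ℓ ≤ n.choose 2) :
    ∃ e : ((i : Fin (ℓ + 1)) × Fin (rankJump n i)) ≃ lowBallot (stair n) ℓ,
      ∀ p, ∑ k, (e p : Fin n → ℕ) k = p.1 := by
  let f : lowBallot (stair n) ℓ → Fin (ℓ + 1) := fun γ =>
    ⟨∑ k, (γ : Fin n → ℕ) k, Nat.lt_succ_of_le (mem_lowBallot.1 γ.2).2.1⟩
  have hcard : ∀ i : Fin (ℓ + 1), Fintype.card {γ // f γ = i} = rankJump n i := by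
    intro i
    rw [← card_filter_lowBallot hℓ (Nat.le_of_lt_succ i.2), Fintype.card_subtype]
    refine Finset.card_bij (fun γ _ => (γ : Fin n → ℕ)) ?_ ?_ ?_
    · intro γ hγ
      rw [Finset.mem_filter] at hγ ⊢
      exact ⟨γ.2, congrArg Fin.val hγ.2⟩
    · intro γ _ γ' _ h
      exact Subtype.ext h
    · intro γ hγ
      rw [Finset.mem_filter] at hγ
      exact ⟨⟨γ, hγ.1⟩, Finset.mem_filter.2 ⟨Finset.mem_univ _, Fin.ext hγ.2⟩, rfl⟩
  let g : ∀ i : Fin (ℓ + 1), Fin (rankJump n i) ≃ {γ // f γ = i} := fun i =>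
    (Fintype.equivFinOfCardEq (hcard i)).symm
  refine ⟨(Equiv.sigmaCongrRight g).trans (Equiv.sigmaFiberEquiv f), ?_⟩
  rintro ⟨i, x⟩
  exact congrArg Fin.val (g i x).2

-- A single `S` must serve both for the square diagonal matrix and for the rectangular lowering
-- matrix. Its symmetry is recorded so that it can also be used after transposition.
open Classical in
theorem exists_isReducedSNF_lowering {n ℓ ℓ' : ℕ} (hlt : ℓ ≤ ℓ') (hle : ℓ + ℓ' ≤ n.choose 2) :
    ∃ (r : ℕ) (S : Matrix (Fin r) (Fin r) ℤ), S.transpose = S ∧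
      IsReducedSNF (diagD n ℓ ℓ') S ∧ IsReducedSNF (lowering (stair n) ℓ ℓ') S := by
  obtain ⟨S, hS, h1, h2⟩ := exists_isReducedSNF_diagonal
    (μ := {γ : lowBallot (stair n) ℓ' // (γ : Fin n → ℕ) ∉ lowBallot (stair n) ℓ})
    (fun γ : lowBallot (stair n) ℓ => (ℓ' - ∑ i, (γ : Fin n → ℕ) i).choose
      (ℓ - ∑ i, (γ : Fin n → ℕ) i))
  obtain ⟨e, he⟩ := exists_equiv_lowBallot (n := n) (ℓ := ℓ) (by omega)
  refine ⟨_, S, hS, ?_, ?_⟩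
  · refine h1.unimodEquiv ?_
    have h3 := UnimodEquiv.diagonal_comp (fun γ : lowBallot (stair n) ℓ =>
      (((ℓ' - ∑ i, (γ : Fin n → ℕ) i).choose (ℓ - ∑ i, (γ : Fin n → ℕ) i) : ℕ) : ℤ)) e
    have h4 : diagD n ℓ ℓ' = Matrix.diagonal ((fun γ : lowBallot (stair n) ℓ =>
      (((ℓ' - ∑ i, (γ : Fin n → ℕ) i).choose (ℓ - ∑ i, (γ : Fin n → ℕ) i) : ℕ) : ℤ)) ∘ e) := by
      rw [diagD]
      congr 1
      funext p
      simp only [Function.comp_apply, he]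
    rw [h4]
    convert h3
  · refine h2.unimodEquiv ?_
    convert unimodEquiv_lowering (stair n) hlt (by rwa [sum_stair])

end PaddedSchubert

/-! ### Assembly: the four operators in the padded Schubert basis -/

theorem mainTheorem3 (n ℓ ℓ' : ℕ) (hlt : ℓ < ℓ') (hle : ℓ + ℓ' ≤ n.choose 2) :
    ∃ b : Module.Basis (Equiv.Perm (Fin n)) ℂ (PaddedSchubert.paddedSpace n),
      (∀ w, (b w : MvPolynomial (Fin n ⊕ Fin n) ℂ) = PaddedSchubert.paddedSchubert n w) ∧
      ∃ (A₁ : Matrix (PaddedSchubert.Level n ℓ') (PaddedSchubert.Level n ℓ) ℤ)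
        (A₂ : Matrix (PaddedSchubert.Level n (n.choose 2 - ℓ))
          (PaddedSchubert.Level n (n.choose 2 - ℓ')) ℤ)
        (A₃ : Matrix (PaddedSchubert.Level n ℓ) (PaddedSchubert.Level n ℓ') ℤ)
        (A₄ : Matrix (PaddedSchubert.Level n (n.choose 2 - ℓ'))
          (PaddedSchubert.Level n (n.choose 2 - ℓ)) ℤ),
        PaddedSchubert.IsRaisingMatrix b (PaddedSchubert.delta n) ℓ ℓ' A₁ ∧
        PaddedSchubert.IsRaisingMatrix b (PaddedSchubert.delta n)
          (n.choose 2 - ℓ') (n.choose 2 - ℓ) A₂ ∧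
        PaddedSchubert.IsLoweringMatrix b (PaddedSchubert.nabla n) ℓ ℓ' A₃ ∧
        PaddedSchubert.IsLoweringMatrix b (PaddedSchubert.nabla n)
          (n.choose 2 - ℓ') (n.choose 2 - ℓ) A₄ ∧
        ∃ (r : ℕ) (S : Matrix (Fin r) (Fin r) ℤ),
          PaddedSchubert.IsReducedSNF (PaddedSchubert.diagD n ℓ ℓ') S ∧
          PaddedSchubert.IsReducedSNF A₁ (((ℓ' - ℓ).factorial : ℤ) • S) ∧
          PaddedSchubert.IsReducedSNF A₂ (((ℓ' - ℓ).factorial : ℤ) • S) ∧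
          PaddedSchubert.IsReducedSNF A₃ (((ℓ' - ℓ).factorial : ℤ) • S) ∧
          PaddedSchubert.IsReducedSNF A₄ (((ℓ' - ℓ).factorial : ℤ) • S) := by
  open PaddedSchubert in
  obtain ⟨b, hb⟩ := exists_paddedSchubert_basis n
  obtain ⟨r, S, hS, hD, hL⟩ := exists_isReducedSNF_lowering hlt.le hle
  have hN : n.choose 2 - ℓ - (n.choose 2 - ℓ') = ℓ' - ℓ := by omega
  have hc : (0 : ℤ) ≤ ((ℓ' - ℓ).factorial : ℤ) := Int.natCast_nonneg _
  have hbot := hL.smul hc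
  -- Through the invariant pairing, the top pair of degrees has the transposed Smith form, which is
  -- the same matrix because `S` is symmetric.
  have htop := (hL.transpose.unimodEquiv
    (unimodEquiv_lowering_transpose n hlt.le (by omega))).smul hc
  rw [hS] at htop
  have hnabla : ∀ (k : ℕ) (x : paddedSpace n),
      (((nabla n ^ k) x : paddedSpace n) : MvPolynomial (Fin n ⊕ Fin n) ℂ)
        = (nablaPoly n ^ k) x := by
    intro k x
    rw [nabla, Module.End.pow_restrict]
    rfl
  have hdelta : ∀ (k : ℕ) (x : paddedSpace n),
      (((delta n ^ k) x : paddedSpace n) : MvPolynomial (Fin n ⊕ Fin n) ℂ)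
        = (deltaPoly n ^ k) x := by
    intro k x
    rw [delta, Module.End.pow_restrict]
    rfl
  have hcoe : ∀ {d : ℕ} (c : Level n d → ℂ),
      ((∑ w, c w • b w : paddedSpace n) : MvPolynomial (Fin n ⊕ Fin n) ℂ)
        = ∑ w, c w • paddedSchubert n w := by
    intro d c
    simp only [AddSubmonoidClass.coe_finsetSum, Submodule.coe_smul, hb]
  obtain ⟨A₁, e₁, h₁⟩ := exists_matrix_paddedSchubert (deltaPoly n ^ (ℓ' - ℓ)) _
    (deltaPoly_pow_padMon (d := ℓ) (e := ℓ') (by omega) (by omega))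
  obtain ⟨A₂, e₂, h₂⟩ := exists_matrix_paddedSchubert (deltaPoly n ^ (ℓ' - ℓ)) _
    (deltaPoly_pow_padMon (d := n.choose 2 - ℓ') (e := n.choose 2 - ℓ) (by omega) (by omega))
  obtain ⟨A₃, e₃, h₃⟩ := exists_matrix_paddedSchubert (nablaPoly n ^ (ℓ' - ℓ)) _
    (nablaPoly_pow_padMon (d := ℓ) (e := ℓ') (by omega))
  obtain ⟨A₄, e₄, h₄⟩ := exists_matrix_paddedSchubert (nablaPoly n ^ (ℓ' - ℓ)) _
    (nablaPoly_pow_padMon (d := n.choose 2 - ℓ') (e := n.choose 2 - ℓ) (by omega))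
  refine ⟨b, hb, A₁, A₂, A₃, A₄, ?_, ?_, ?_, ?_, r, S, hD, ?_, ?_, ?_, ?_⟩
  · intro u
    apply Subtype.ext
    rw [hdelta, hb, hcoe, h₁]
  · intro u
    apply Subtype.ext
    rw [hdelta, hb, hcoe, hN, h₂]
  · intro u
    apply Subtype.ext
    rw [hnabla, hb, hcoe, h₃]
  · intro u
    apply Subtype.ext
    rw [hnabla, hb, hcoe, hN, h₄]
  -- Raising from `ℓ` to `ℓ'` is, after complementation, lowering from `N - ℓ` to `N - ℓ'`, so this
  -- case uses the top pair.
  · exact (htop.unimodEquiv ((UnimodEquiv.submatrix _ _ _).smul _)).unimodEquiv e₁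
  · have e5 : n.choose 2 - (n.choose 2 - ℓ) = ℓ := by omega
    have e6 : n.choose 2 - (n.choose 2 - ℓ') = ℓ' := by omega
    -- Complementing the top pair of degrees gives back `ℓ` and `ℓ'`, so raising between the top
    -- degrees is governed by lowering between the bottom ones.
    have hL' : IsReducedSNF (lowering (stair n) (n.choose 2 - (n.choose 2 - ℓ))
        (n.choose 2 - (n.choose 2 - ℓ'))) S := by
      rw [e5, e6]
      exact hL
    exact ((hL'.smul hc).unimodEquiv ((UnimodEquiv.submatrix _ _ _).smul _)).unimodEquiv e₂
  · exact hbot.unimodEquiv e₃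
  · exact htop.unimodEquiv e₄
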